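/- Let $n>2$ and $\mathfrak m=\mathbb R\oplus\operatorname{Im}\mathbb H\oplus\mathbb H^{n-1}$. For $r\in\mathbb R$, $v,w\in\operatorname{Im}\mathbb H$, $q,q_1,q_2\in\mathbb H^{n-1}$ consider the skew-symmetric brackets on $\mathfrak m$ determined by $\Theta(q_1,q_2)=\sum_{a=i,j,k}\operatorname{Re}(q_1a\,\overline{q_2})\,a$, $\Psi_1(r,v)=rv$, $\Psi_2(r,q)=rq$, $\Upsilon_1(v,w)=2\operatorname{Im}(vw)$, $\Upsilon_2(v,q)=q\bar v$ (where $\operatorname{Re}(p\,\bar q)=\sum_l\operatorname{Re}(p_l\overline{q_l})$ on $\mathbb H^{n-1}$). For the parameters $(\alpha,\beta_1,\beta_2,\gamma_1,\gamma_2)$ $$\mathcal H_1^{\pm}:(\pm1,2,1,0,0),\quad \mathcal H_2:(1,0,0,0,0),\quad \mathcal H_3^\beta:(0,2,\beta,0,0),\quad \mathcal H_4:(0,0,1,0,0),\quad \mathcal H_5^\beta:(0,0,\beta,1,0)\qquad(\beta\in\mathbb R)$$ let $M$ be the simply connected Lie group whose Lie algebra is $\mathfrak m$ with the bracket $\alpha\Theta+\beta_1\Psi_1+\beta_2\Psi_2+\gamma_1\Upsilon_1+\gamma_2\Upsilon_2$,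 and for $c_1,c_2>0$ let $g=g_{c_1,c_2}$ be the left-invariant Riemannian metric on $M$ that is $c_1g_{\mathbb R}+c_1g_{\operatorname{Im}\mathbb H}+c_2g_{\mathbb H^{n-1}}$ on $T_eM=\mathfrak m$, with the standard inner products on the three summands. Then, for each of these models and all $c_1,c_2>0$: * $g$ is Einstein if and only if the model is $\mathcal H_1^{+}$ or $\mathcal H_1^{-}$ and $c_1=2c_2$, or the model is $\mathcal H_3^2$. * $g$ is conformally flat if and only if the model is $\mathcal H_3^2$, $\mathcal H_5^{1}$ or $\mathcal H_5^{-1}$. * The following are equivalent: (a) $g$ has parallel curvature tensor; (b) $(M,g)$ is a Riemannian symmetric space; (c) the model is $\mathcal H_1^{+}$ or $\mathcal H_1^{-}$ and $c_1=2c_2$, or the model is $\mathcal H_3^0$, $\mathcal H_3^2$, $\mathcal H_4$, or $\mathcal H_5^\beta$ for some $\beta\in\mathbb R$. Moreover $(M,g_{c_1,c_2})$ is homothetic, i.e. diffeomorphic by a map that multiplies the metric by a positive constant, to: * the quaternionic hyperbolic space $\mathbb HH^n$, for $\mathcal H_1^{\pm}$ with $c_1=2c_2$; * the hyperbolic space $H^{4n}$,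 for $\mathcal H_3^2$ (all $c_1,c_2$); * $H^4\times\mathbb R^{4n-4}$, for $\mathcal H_3^0$ (all $c_1,c_2$); * $\mathbb R^3\times H^{4n-3}$, for $\mathcal H_4$ (all $c_1,c_2$); * $S^3_k\times H^{4n-3}$ with $k=1/\beta^2$, for $\mathcal H_5^\beta$ with $\beta\ne0$ (all $c_1,c_2$); * $S^3\times\mathbb R^{4n-3}$, for $\mathcal H_5^0$ (all $c_1,c_2$). Here $H^d$ has constant sectional curvature $-1$, $S^3_k$ is the 3-sphere of constant sectional curvature $k$, $S^3=S^3_1$, and products carry the product metric. -/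

import Mathlib

open scoped Manifold ContDiff Quaternion
open TopologicalSpace (Opens)

noncomputable section

/-! ## Riemannian geometry -/

namespace RiemGeom

/-- A field of bilinear forms on the tangent spaces of a manifold; all the metrics considered
here are fields of this kind. -/
abbrev MetricField {E : Type*} [NormedAddCommGroup E] [NormedSpace ℝ E] {H : Type*}
    [TopologicalSpace H] (I : ModelWithCorners ℝ E H) (M : Type*) [TopologicalSpace M]
    [ChartedSpace H M] : Type _ :=
  ∀ x : M, TangentSpace I x →L[ℝ] TangentSpace I x →L[ℝ] ℝ

/-! ### The coordinate formulas, for a metric `G` on (an open subset of) a vector space -/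

section Coordinates

variable {E : Type*} [NormedAddCommGroup E] [NormedSpace ℝ E]

/-- The Christoffel symbols `Γ(u, v)` of the Levi-Civita connection:
`G(Γ(u, v), w) = ½ (∂ᵤ G(v, w) + ∂ᵥ G(u, w) - ∂_w G(u, v))`. In the code, `T (u, v)` and `S (u, v)`
are the vectors that represent the linear forms `w ↦ ∂ᵤ G(v, w)` and `w ↦ ∂_w G(u, v)`. -/
def christoffel (G : E → E →L[ℝ] E →L[ℝ] ℝ) (y : E) : E →L[ℝ] E →L[ℝ] E :=
  let D : E →L[ℝ] E →L[ℝ] E →L[ℝ] ℝ := fderiv ℝ G y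
  let sharp : (E →L[ℝ] E →L[ℝ] ℝ) →L[ℝ] (E →L[ℝ] E) :=
    ContinuousLinearMap.compL ℝ E (E →L[ℝ] ℝ) E (G y).inverse
  let swap : (E →L[ℝ] E →L[ℝ] ℝ) →L[ℝ] (E →L[ℝ] E →L[ℝ] ℝ) :=
    (ContinuousLinearMap.flipₗᵢ ℝ E E ℝ).toContinuousLinearEquiv.toContinuousLinearMap
  let T : E →L[ℝ] E →L[ℝ] E := sharp ∘L D
  let S : E →L[ℝ] E →L[ℝ] E := sharp ∘L swap ∘L D.flip
  (1 / 2 : ℝ) • (T + T.flip - S)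

lemma christoffel_apply (G : E → E →L[ℝ] E →L[ℝ] ℝ) (y u v : E) :
    christoffel G y u v = (G y).inverse ((1 / 2 : ℝ) • (fderiv ℝ G y u v + fderiv ℝ G y v u
      - ((fderiv ℝ G y).flip u).flip v)) := by
  simp [christoffel, map_sub, map_add]

/-- The curvature tensor `R(u, v) w = ∇ᵤ ∇ᵥ w - ∇ᵥ ∇ᵤ w - ∇_[u,v] w`. -/
def coordCurvature (G : E → E →L[ℝ] E →L[ℝ] ℝ) (y u v w : E) : E :=
  fderiv ℝ (christoffel G) y u v w - fderiv ℝ (christoffel G) y v u w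
    + christoffel G y u (christoffel G y v w) - christoffel G y v (christoffel G y u w)

/-- The Ricci tensor `Ric(v, w) = tr (u ↦ R(u, v) w)`. -/
def coordRicci (G : E → E →L[ℝ] E →L[ℝ] ℝ) (y v w : E) : ℝ :=
  LinearMap.trace ℝ E
    { toFun := fun u => coordCurvature G y u v w
      map_add' := fun a b => by simp [coordCurvature]; abel
      map_smul' := fun c a => by simp [coordCurvature, smul_sub, smul_add] }

/-- The covariant derivative `(∇_z R)(u, v) w` of the curvature tensor. -/
def coordNablaCurvature (G : E → E →L[ℝ] E →L[ℝ] ℝ) (y z u v w : E) : E :=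
  fderiv ℝ (fun y' => coordCurvature G y' u v w) y z
    + christoffel G y z (coordCurvature G y u v w)
    - coordCurvature G y (christoffel G y z u) v w
    - coordCurvature G y u (christoffel G y z v) w
    - coordCurvature G y u v (christoffel G y z w)

end Coordinates

/-! ### Manifolds -/

section Manifold

variable {E : Type*} [NormedAddCommGroup E] [NormedSpace ℝ E] {M : Type*} [TopologicalSpace M]
  [ChartedSpace E M]

/-- The coordinate expression of a metric in the preferred chart at `p`. -/
def chartMetric (g : MetricField 𝓘(ℝ, E) M) (p : M) (y : E) : E →L[ℝ] E →L[ℝ] ℝ :=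
  let A : E →L[ℝ] E := mfderiv 𝓘(ℝ, E) 𝓘(ℝ, E) (extChartAt 𝓘(ℝ, E) p).symm y
  let B : E →L[ℝ] E →L[ℝ] ℝ := g ((extChartAt 𝓘(ℝ, E) p).symm y)
  B.bilinearComp A A

/-- The curvature tensor at `p`. The tangent space at `p` is identified with `E` by the preferred
chart at `p`, as everywhere in Mathlib. -/
def curvatureAt (g : MetricField 𝓘(ℝ, E) M) (p : M) (u v w : TangentSpace 𝓘(ℝ, E) p) :
    TangentSpace 𝓘(ℝ, E) p :=
  coordCurvature (E := E) (chartMetric g p) (extChartAt 𝓘(ℝ, E) p p) u v w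

/-- The Ricci tensor at `p`. -/
def ricciAt (g : MetricField 𝓘(ℝ, E) M) (p : M) (v w : TangentSpace 𝓘(ℝ, E) p) : ℝ :=
  coordRicci (E := E) (chartMetric g p) (extChartAt 𝓘(ℝ, E) p p) v w

/-- The covariant derivative of the curvature tensor at `p`. -/
def nablaCurvatureAt (g : MetricField 𝓘(ℝ, E) M) (p : M) (z u v w : TangentSpace 𝓘(ℝ, E) p) :
    TangentSpace 𝓘(ℝ, E) p :=
  coordNablaCurvature (E := E) (chartMetric g p) (extChartAt 𝓘(ℝ, E) p p) z u v w

/-- Einstein metrics: `Ric = c g` for a real constant `c`. -/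
def IsEinstein (g : MetricField 𝓘(ℝ, E) M) : Prop :=
  ∃ c : ℝ, ∀ (p : M) (v w : TangentSpace 𝓘(ℝ, E) p), ricciAt g p v w = c * g p v w

/-- Conformally flat metrics: near every point there is a smooth function `f` for which the metric
`e^{2f} g` is flat, i.e. has vanishing curvature tensor. -/
def IsConformallyFlat (g : MetricField 𝓘(ℝ, E) M) : Prop :=
  ∀ p : M, ∃ (V : Set M) (f : M → ℝ), IsOpen V ∧ p ∈ V ∧ ContMDiffOn 𝓘(ℝ, E) 𝓘(ℝ, ℝ) ∞ f V ∧
    ∀ q ∈ V, ∀ u v w : TangentSpace 𝓘(ℝ, E) q,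
      curvatureAt (fun x => Real.exp (2 * f x) • g x) q u v w = 0

/-- Metrics with parallel curvature tensor, i.e. locally symmetric metrics. -/
def HasParallelCurvature (g : MetricField 𝓘(ℝ, E) M) : Prop :=
  ∀ (p : M) (z u v w : TangentSpace 𝓘(ℝ, E) p), nablaCurvatureAt g p z u v w = 0

/-- (Globally) symmetric metrics: every point `p` is fixed by an isometry of the whole manifold
whose differential at `p` is `-id`. -/
def IsRiemannianSymmetric (g : MetricField 𝓘(ℝ, E) M) : Prop :=
  ∀ p : M, ∃ s : M ≃ₘ^∞⟮𝓘(ℝ, E), 𝓘(ℝ, E)⟯ M,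
    (∀ (x : M) (u v : TangentSpace 𝓘(ℝ, E) x),
      g (s x) (mfderiv 𝓘(ℝ, E) 𝓘(ℝ, E) s x u) (mfderiv 𝓘(ℝ, E) 𝓘(ℝ, E) s x v) = g x u v) ∧
    s p = p ∧ ∀ v : E, (mfderiv 𝓘(ℝ, E) 𝓘(ℝ, E) s p : E →L[ℝ] E) v = -v

/-- The left-invariant metric on a Lie group that is given by `B` on the tangent space at `1`. -/
def leftInvariantMetric [Group M] (B : E →L[ℝ] E →L[ℝ] ℝ) : MetricField 𝓘(ℝ, E) M := fun x =>
  let A : E →L[ℝ] E := mfderiv 𝓘(ℝ, E) 𝓘(ℝ, E) (fun y : M => x⁻¹ * y) x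
  (B.bilinearComp A A : E →L[ℝ] E →L[ℝ] ℝ)

end Manifold

section Homothety

variable {E : Type*} [NormedAddCommGroup E] [NormedSpace ℝ E] {H : Type*} [TopologicalSpace H]
  {I : ModelWithCorners ℝ E H} {M : Type*} [TopologicalSpace M] [ChartedSpace H M]
  {F : Type*} [NormedAddCommGroup F] [NormedSpace ℝ F] {K : Type*} [TopologicalSpace K]
  {J : ModelWithCorners ℝ F K} {N : Type*} [TopologicalSpace N] [ChartedSpace K N]

/-- `(M, g)` and `(N, h)` are homothetic: there is a diffeomorphism `φ` of `M` onto `N` with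
`φ^* h = c g` for a constant `c > 0`. -/
def Homothetic (g : MetricField I M) (h : MetricField J N) : Prop :=
  ∃ c : ℝ, 0 < c ∧ ∃ φ : M ≃ₘ^∞⟮I, J⟯ N, ∀ (x : M) (u v : TangentSpace I x),
    h (φ x) (mfderiv I J φ x u) (mfderiv I J φ x v) = c * g x u v

/-- The product metric. -/
def prodMetric (g : MetricField I M) (h : MetricField J N) : MetricField (I.prod J) (M × N) :=
  fun x =>
    let B₁ : E →L[ℝ] E →L[ℝ] ℝ := g x.1
    let B₂ : F →L[ℝ] F →L[ℝ] ℝ := h x.2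
    (B₁.bilinearComp (.fst ℝ E F) (.fst ℝ E F) + B₂.bilinearComp (.snd ℝ E F) (.snd ℝ E F) :
      E × F →L[ℝ] E × F →L[ℝ] ℝ)

end Homothety

/-! ### The standard spaces -/

/-- The flat metric of the Euclidean space `ℝ^d`. -/
def euclideanMetric (d : ℕ) :
    MetricField 𝓘(ℝ, EuclideanSpace ℝ (Fin d)) (EuclideanSpace ℝ (Fin d)) :=
  fun _ => (innerSL ℝ : EuclideanSpace ℝ (Fin d) →L[ℝ] EuclideanSpace ℝ (Fin d) →L[ℝ] ℝ)

/-- The vector space that contains the upper half space model of `H^d`, `d ≥ 1`. -/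
abbrev HalfSpaceAmbient (d : ℕ) : Type := EuclideanSpace ℝ (Fin (d - 1)) × ℝ

/-- The hyperbolic space `H^d` (for `d ≥ 1`) as upper half space `{(x, t) : t > 0}`. -/
def hyperbolicSpace (d : ℕ) : Opens (HalfSpaceAmbient d) :=
  ⟨{x | 0 < x.2}, isOpen_lt continuous_const continuous_snd⟩

/-- The hyperbolic metric `(|dx|² + dt²) / t²`, of sectional curvature `-1`. -/
def hyperbolicMetric (d : ℕ) : MetricField 𝓘(ℝ, HalfSpaceAmbient d) (hyperbolicSpace d) :=
  fun x =>
    ((x.1.2 ^ 2)⁻¹ •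
      ((innerSL ℝ).bilinearComp (.fst ℝ (EuclideanSpace ℝ (Fin (d - 1))) ℝ) (.fst ℝ _ ℝ) +
        (innerSL ℝ).bilinearComp (.snd ℝ (EuclideanSpace ℝ (Fin (d - 1))) ℝ) (.snd ℝ _ ℝ)) :
      HalfSpaceAmbient d →L[ℝ] HalfSpaceAmbient d →L[ℝ] ℝ)

/-- The unit sphere `S^3` of `ℝ⁴`. -/
abbrev ThreeSphere : Type := Metric.sphere (0 : EuclideanSpace ℝ (Fin (3 + 1))) 1

/-- The metric of constant sectional curvature `k > 0` on `S^3`: `1 / k` times the metric that is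
induced by the inclusion in `ℝ⁴`. -/
def sphereMetric (k : ℝ) : MetricField (𝓡 3) ThreeSphere := fun x =>
  let A : EuclideanSpace ℝ (Fin 3) →L[ℝ] EuclideanSpace ℝ (Fin (3 + 1)) :=
    mfderiv (𝓡 3) 𝓘(ℝ, EuclideanSpace ℝ (Fin (3 + 1)))
      (fun y : ThreeSphere => (y : EuclideanSpace ℝ (Fin (3 + 1)))) x
  (k⁻¹ • (innerSL ℝ).bilinearComp A A :
    EuclideanSpace ℝ (Fin 3) →L[ℝ] EuclideanSpace ℝ (Fin 3) →L[ℝ] ℝ)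

/-- The form `(u, v) ↦ ∑ Re (u_l \bar v_l)` on `ℍ^d`. -/
def quatForm (d : ℕ) : (Fin d → ℍ) →L[ℝ] (Fin d → ℍ) →L[ℝ] ℝ :=
  ∑ l : Fin d, (innerSL ℝ).bilinearComp (.proj (R := ℝ) (φ := fun _ : Fin d => ℍ) l)
    (.proj (R := ℝ) (φ := fun _ : Fin d => ℍ) l)

/-- The quaternionic hyperbolic space `ℍH^d` as unit ball of `ℍ^d`. -/
def quatHyperbolicSpace (d : ℕ) : Opens (Fin d → ℍ) :=
  ⟨{z | quatForm d z z < 1},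
    isOpen_lt ((quatForm d).continuous.clm_apply continuous_id) continuous_const⟩

/-- `u ↦ ∑ \bar z_l u_l`, the standard Hermitian product with `z` on `ℍ^d`. -/
def quatHermitian (d : ℕ) (z : Fin d → ℍ) : (Fin d → ℍ) →L[ℝ] ℍ :=
  ∑ l : Fin d, ContinuousLinearMap.mul ℝ ℍ (star (z l)) ∘L
    (.proj (R := ℝ) (φ := fun _ : Fin d => ℍ) l)

/-- The metric of the quaternionic hyperbolic space in the ball,
`((1 - |z|²) |dz|² + |∑ \bar z_l dz_l|²) / (1 - |z|²)²`. -/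
def quatHyperbolicMetric (d : ℕ) : MetricField 𝓘(ℝ, Fin d → ℍ) (quatHyperbolicSpace d) :=
  fun z =>
    ((1 - quatForm d z z)⁻¹ • quatForm d +
      ((1 - quatForm d z z) ^ 2)⁻¹ •
        (innerSL ℝ : ℍ →L[ℝ] ℍ →L[ℝ] ℝ).bilinearComp (σ₁₃ := .id ℝ) (σ₂₃ := .id ℝ)
          (quatHermitian d z) (quatHermitian d z) :
      (Fin d → ℍ) →L[ℝ] (Fin d → ℍ) →L[ℝ] ℝ)

/-! ### Open subsets of vector spaces: derivatives and Lie brackets are the usual ones -/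

section OpensAux

open scoped Topology
open VectorField

variable {E : Type*} [NormedAddCommGroup E] [NormedSpace ℝ E] {U : Opens E}

lemma extChartAt_opens_coe (x : U) : (extChartAt 𝓘(ℝ, E) x : U → E) = Subtype.val := by
  ext y; simp [extChartAt, TopologicalSpace.Opens.chartAt_eq, chartAt_self_eq]

lemma extChartAt_opens_target (x : U) : (extChartAt 𝓘(ℝ, E) x).target = (U : Set E) := by
  ext y
  simp [extChartAt, TopologicalSpace.Opens.chartAt_eq, chartAt_self_eq,
    OpenPartialHomeomorph.subtypeRestr_def]

lemma extChartAt_opens_symm (x : U) {y : E} (hy : y ∈ U) :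
    (extChartAt 𝓘(ℝ, E) x).symm y = ⟨y, hy⟩ := by
  have h := (extChartAt 𝓘(ℝ, E) x).right_inv
    (show y ∈ (extChartAt 𝓘(ℝ, E) x).target by rw [extChartAt_opens_target]; exact hy)
  rw [extChartAt_opens_coe] at h
  exact Subtype.ext h

/-- The derivative of a map between open sets, in the manifold sense. -/
lemma hasMFDerivAt_opens {F : Type*} [NormedAddCommGroup F] [NormedSpace ℝ F] {V : Opens F}
    {f : U → V} {f' : E → F} {A : E →L[ℝ] F} (x : U) (hf : ∀ y : U, (f y : F) = f' y)
    (h : HasFDerivAt f' A x) : HasMFDerivAt 𝓘(ℝ, E) 𝓘(ℝ, F) f x A := by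
  refine ⟨?_, ?_⟩
  · rw [Topology.IsInducing.subtypeVal.continuousAt_iff]
    have h0 : (fun y : U => (f y : F)) = f' ∘ Subtype.val := funext hf
    change ContinuousAt (fun y : U => (f y : F)) x
    rw [h0]
    exact h.continuousAt.comp continuousAt_subtype_val
  · have h1 : HasFDerivAt (writtenInExtChartAt 𝓘(ℝ, E) 𝓘(ℝ, F) x f) A (x : E) := by
      refine h.congr_of_eventuallyEq ?_
      filter_upwards [U.isOpen.mem_nhds x.2] with y hy
      simp only [writtenInExtChartAt, Function.comp_apply, extChartAt_opens_coe,
        extChartAt_opens_symm _ hy, hf]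
    rw [extChartAt_opens_coe]
    exact h1.hasFDerivWithinAt

lemma hasMFDerivAt_opens_val (x : U) :
    HasMFDerivAt 𝓘(ℝ, E) 𝓘(ℝ, E) (extChartAt 𝓘(ℝ, E) x) x (ContinuousLinearMap.id ℝ E) := by
  rw [extChartAt_opens_coe]
  refine ⟨continuousAt_subtype_val, ?_⟩
  have h1 : HasFDerivAt (writtenInExtChartAt 𝓘(ℝ, E) 𝓘(ℝ, E) x (Subtype.val : U → E))
      (ContinuousLinearMap.id ℝ E) (x : E) := by
    refine (hasFDerivAt_id (x : E)).congr_of_eventuallyEq ?_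
    filter_upwards [U.isOpen.mem_nhds x.2] with y hy
    simp only [writtenInExtChartAt, Function.comp_apply, extChartAt_opens_symm _ hy,
      extChartAt_model_space_eq_id, PartialEquiv.refl_coe, id]
  rw [extChartAt_opens_coe]
  exact h1.hasFDerivWithinAt

lemma hasMFDerivAt_opens_symm (x : U) {y : E} (hy : y ∈ U) :
    HasMFDerivAt 𝓘(ℝ, E) 𝓘(ℝ, E) (extChartAt 𝓘(ℝ, E) x).symm y
      (ContinuousLinearMap.id ℝ E) := by
  refine ⟨continuousAt_extChartAt_symm'' (by rw [extChartAt_opens_target]; exact hy), ?_⟩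
  have h1 : HasFDerivAt (writtenInExtChartAt 𝓘(ℝ, E) 𝓘(ℝ, E) y (extChartAt 𝓘(ℝ, E) x).symm)
      (ContinuousLinearMap.id ℝ E) y := by
    refine (hasFDerivAt_id (y : E)).congr_of_eventuallyEq ?_
    filter_upwards [U.isOpen.mem_nhds hy] with z hz
    simp only [writtenInExtChartAt, Function.comp_apply, extChartAt_model_space_eq_id,
      PartialEquiv.refl_symm, PartialEquiv.refl_coe, id, extChartAt_opens_symm _ hz,
      extChartAt_opens_coe]
  exact h1.hasFDerivWithinAt

lemma mlieBracket_opens [CompleteSpace E] {V W : ∀ x : U, TangentSpace 𝓘(ℝ, E) x} {V' W' : E → E}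
    (hV : ∀ x : U, V x = V' x) (hW : ∀ x : U, W x = W' x) (x : U) :
    mlieBracket 𝓘(ℝ, E) V W x = lieBracket ℝ V' W' x := by
  have key : ∀ (Z : ∀ x : U, TangentSpace 𝓘(ℝ, E) x) (Z' : E → E), (∀ x : U, Z x = Z' x) →
      mpullbackWithin 𝓘(ℝ, E) 𝓘(ℝ, E) (extChartAt 𝓘(ℝ, E) x).symm Z
        (Set.range 𝓘(ℝ, E)) =ᶠ[𝓝 (x : E)] Z' := by
    intro Z Z' hZ
    filter_upwards [U.isOpen.mem_nhds x.2] with y hy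
    rw [mpullbackWithin_apply]
    simp only [ModelWithCorners.range_eq_univ, mfderivWithin_univ]
    rw [(hasMFDerivAt_opens_symm x hy).mfderiv, hZ, extChartAt_opens_symm x hy]
    exact congrArg (fun L : E →L[ℝ] E => L (Z' y)) ContinuousLinearMap.inverse_id
  have h2 := Filter.EventuallyEq.lieBracket_vectorField_eq (𝕜 := ℝ) (key V V' hV) (key W W' hW)
  have e1 : extChartAt 𝓘(ℝ, E) x x = (x : E) := by rw [extChartAt_opens_coe]
  have h3 : ∀ Z : E → E,
      (mpullback 𝓘(ℝ, E) 𝓘(ℝ, E) (extChartAt 𝓘(ℝ, E) x) Z x : E) = Z x := by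
    intro Z
    have h4 : (mpullback 𝓘(ℝ, E) 𝓘(ℝ, E) (extChartAt 𝓘(ℝ, E) x) Z x : E) =
      (mfderiv 𝓘(ℝ, E) 𝓘(ℝ, E) (extChartAt 𝓘(ℝ, E) x) x).inverse (Z (extChartAt 𝓘(ℝ, E) x x)) := rfl
    rw [h4, (hasMFDerivAt_opens_val x).mfderiv, e1]
    exact congrArg (fun L : E →L[ℝ] E => L (Z x)) ContinuousLinearMap.inverse_id
  refine (h3 _).trans (Eq.trans ?_ h2)
  simp only [modelWithCornersSelf_coe, Set.range_id, Set.preimage_univ, Set.univ_inter]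
  exact congrFun (lieBracketWithin_univ (𝕜 := ℝ) (E := E)) (x : E)

end OpensAux

end RiemGeom

/-! ## The models -/

namespace Submax

open RiemGeom

/-- The vector space `𝔪 = ℝ ⊕ Im ℍ ⊕ ℍ^m = ℍ ⊕ ℍ^m`, where `m = n - 1`. -/
abbrev ModelSpace (m : ℕ) : Type := ℍ × (Fin m → ℍ)

/-- The quaternion units. -/
def qi : ℍ := ⟨0, 1, 0, 0⟩
def qj : ℍ := ⟨0, 0, 1, 0⟩
def qk : ℍ := ⟨0, 0, 0, 1⟩

/-- `Θ(p, q) = ∑_{a = i, j, k} g(p a, q) a`, where `g(p, q) = ∑ Re (p_l \bar q_l)`. -/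
def theta {m : ℕ} (p q : Fin m → ℍ) : ℍ :=
  ⟨0, quatForm m (fun l => p l * qi) q, quatForm m (fun l => p l * qj) q,
    quatForm m (fun l => p l * qk) q⟩

/-- The parameters `(α, β₁, β₂, γ₁, γ₂)` of the invariant horizontal brackets. -/
structure BracketParams where
  α : ℝ
  β₁ : ℝ
  β₂ : ℝ
  γ₁ : ℝ
  γ₂ : ℝ

/-- The bracket `B = α Θ + β₁ Ψ₁ + β₂ Ψ₂ + γ₁ Υ₁ + γ₂ Υ₂` on `𝔪`, where for `r ∈ ℝ`, `v ∈ Im ℍ` and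
`q ∈ ℍ^m`: `Ψ₁(r, v) = r v`, `Ψ₂(r, q) = r q`, `Υ₁(v, w) = 2 Im (v w)`, `Υ₂(v, q) = q \bar v`. -/
def bracket (P : BracketParams) {m : ℕ} (x y : ModelSpace m) : ModelSpace m :=
  (P.α • theta x.2 y.2 + P.β₁ • (x.1.re • y.1.im - y.1.re • x.1.im)
      + P.γ₁ • ((2 : ℝ) • (x.1.im * y.1.im).im),
    P.β₂ • (x.1.re • y.2 - y.1.re • x.2)
      + P.γ₂ • ((fun l => y.2 l * star x.1.im) - (fun l => x.2 l * star y.1.im)))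

/-- The models `ℋ₁^±`, `ℋ₂`, `ℋ₃^β`, `ℋ₄`, `ℋ₅^β`. -/
inductive Model
  | H1 (ε : ℤˣ)
  | H2
  | H3 (β : ℝ)
  | H4
  | H5 (β : ℝ)

/-- The bracket parameters of the models. -/
def Model.params : Model → BracketParams
  | .H1 ε => ⟨((ε : ℤ) : ℝ), 2, 1, 0, 0⟩
  | .H2 => ⟨1, 0, 0, 0, 0⟩
  | .H3 β => ⟨0, 2, β, 0, 0⟩
  | .H4 => ⟨0, 0, 1, 0, 0⟩
  | .H5 β => ⟨0, 0, β, 1, 0⟩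

/-- The manifold underlying the simply connected Lie group of a model: it is realized on all of
`𝔪` in the solvable cases `ℋ₁` to `ℋ₄`, and on `(ℍ ∖ 0) × ℍ^m` for `ℋ₅`. -/
def Model.domain (m : ℕ) : Model → Opens (ModelSpace m)
  | .H5 _ => ⟨{x | x.1 ≠ 0}, isOpen_ne_fun continuous_fst continuous_const⟩
  | _ => ⊤

/-- The group law on `ℝ ⊕ Im ℍ ⊕ ℍ^m` of the semidirect product of `ℝ` with the nilpotent group
`Im ℍ × ℍ^m`, whose law is `(v, p) (w, q) = (v + w + ½ α Θ(p, q), p + q)`, for the action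
`r ↦ (e^{β₁ r}, e^{β₂ r})` of `ℝ`. -/
def solvMul (α β₁ β₂ : ℝ) {m : ℕ} (x y : ModelSpace m) : ModelSpace m :=
  (((x.1.re + y.1.re : ℝ) : ℍ) + (x.1.im + Real.exp (β₁ * x.1.re) • y.1.im
      + (α / 2) • theta x.2 (Real.exp (β₂ * x.1.re) • y.2)),
    x.2 + Real.exp (β₂ * x.1.re) • y.2)

/-- The inverse for this group law. -/
def solvInv (β₁ β₂ : ℝ) {m : ℕ} (x : ModelSpace m) : ModelSpace m :=
  (((-x.1.re : ℝ) : ℍ) - Real.exp (-(β₁ * x.1.re)) • x.1.im, -(Real.exp (-(β₂ * x.1.re)) • x.2))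

/-- The group law of a model. For `ℋ₅^β` it is that of the semidirect product of the multiplicative
group `ℍ ∖ 0` with `ℍ^m`, for the action `x ↦ |x|^β`. -/
def Model.mul {m : ℕ} : Model → ModelSpace m → ModelSpace m → ModelSpace m
  | .H1 ε => solvMul ((ε : ℤ) : ℝ) 2 1
  | .H2 => solvMul 1 0 0
  | .H3 β => solvMul 0 2 β
  | .H4 => solvMul 0 0 1
  | .H5 β => fun x y => (x.1 * y.1, x.2 + ‖x.1‖ ^ β • y.2)

/-- The inverse for the group law of a model. -/
def Model.inv {m : ℕ} : Model → ModelSpace m → ModelSpace m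
  | .H1 _ => solvInv 2 1
  | .H2 => solvInv 0 0
  | .H3 β => solvInv 2 β
  | .H4 => solvInv 0 1
  | .H5 β => fun x => (x.1⁻¹, -(‖x.1‖ ^ (-β) • x.2))

/-- The neutral element of the group of a model. -/
def Model.one {m : ℕ} : Model → ModelSpace m
  | .H5 _ => (1, 0)
  | _ => 0

lemma quatForm_apply {m : ℕ} (p q : Fin m → ℍ) :
    quatForm m p q = ∑ l, ((p l).re * (q l).re + (p l).imI * (q l).imI + (p l).imJ * (q l).imJ
      + (p l).imK * (q l).imK) := by
  simp [quatForm, Quaternion.inner_def]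

@[simp] lemma qi_re : qi.re = 0 := rfl
@[simp] lemma qi_imI : qi.imI = 1 := rfl
@[simp] lemma qi_imJ : qi.imJ = 0 := rfl
@[simp] lemma qi_imK : qi.imK = 0 := rfl
@[simp] lemma qj_re : qj.re = 0 := rfl
@[simp] lemma qj_imI : qj.imI = 0 := rfl
@[simp] lemma qj_imJ : qj.imJ = 1 := rfl
@[simp] lemma qj_imK : qj.imK = 0 := rfl
@[simp] lemma qk_re : qk.re = 0 := rfl
@[simp] lemma qk_imI : qk.imI = 0 := rfl
@[simp] lemma qk_imJ : qk.imJ = 0 := rfl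
@[simp] lemma qk_imK : qk.imK = 1 := rfl

@[simp] lemma theta_re {m : ℕ} (p q : Fin m → ℍ) : (theta p q).re = 0 := rfl
@[simp] lemma theta_imI {m : ℕ} (p q : Fin m → ℍ) :
    (theta p q).imI = quatForm m (fun l => p l * qi) q := rfl
@[simp] lemma theta_imJ {m : ℕ} (p q : Fin m → ℍ) :
    (theta p q).imJ = quatForm m (fun l => p l * qj) q := rfl
@[simp] lemma theta_imK {m : ℕ} (p q : Fin m → ℍ) :
    (theta p q).imK = quatForm m (fun l => p l * qk) q := rfl

lemma theta_add_left {m : ℕ} (p p' q : Fin m → ℍ) :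
    theta (p + p') q = theta p q + theta p' q := by
  have h : ∀ a : ℍ, (fun l => (p + p') l * a) = (fun l => p l * a) + fun l => p' l * a := by
    intro a; ext1 l; simp [add_mul]
  ext <;> simp only [theta_re, theta_imI, theta_imJ, theta_imK, h] <;> simp

lemma theta_smul_left {m : ℕ} (c : ℝ) (p q : Fin m → ℍ) :
    theta (c • p) q = c • theta p q := by
  have h : ∀ a : ℍ, (fun l => (c • p) l * a) = c • (fun l => p l * a) := by
    intro a; ext1 l; simp
  ext <;> simp only [theta_re, theta_imI, theta_imJ, theta_imK, h] <;> simp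

lemma theta_add_right {m : ℕ} (p q q' : Fin m → ℍ) :
    theta p (q + q') = theta p q + theta p q' := by
  ext <;> simp

lemma theta_smul_right {m : ℕ} (c : ℝ) (p q : Fin m → ℍ) :
    theta p (c • q) = c • theta p q := by
  ext <;> simp

lemma theta_self {m : ℕ} (p : Fin m → ℍ) : theta p p = 0 := by
  ext
  · simp
  all_goals
    simp only [theta_imI, theta_imJ, theta_imK, quatForm_apply]
    apply Finset.sum_eq_zero
    intros
    simp
    ring

lemma theta_zero_left {m : ℕ} (q : Fin m → ℍ) : theta 0 q = 0 := by
  simpa using theta_smul_left 0 0 q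

lemma solvMul_assoc {α β₁ β₂ : ℝ} (h : α = 0 ∨ β₁ = 2 * β₂) {m : ℕ} (x y z : ModelSpace m) :
    solvMul α β₁ β₂ (solvMul α β₁ β₂ x y) z = solvMul α β₁ β₂ x (solvMul α β₁ β₂ y z) := by
  have key : ∀ r : ℝ, α * Real.exp (β₁ * r) = α * (Real.exp (β₂ * r) * Real.exp (β₂ * r)) := by
    intro r
    rcases h with h | h
    · simp [h]
    · rw [← Real.exp_add, h]; congr 2; ring
  have k := key x.1.re
  ext l
  · simp [solvMul]; ring
  · simp [solvMul, theta_add_left, theta_smul_left, theta_add_right, theta_smul_right, mul_add,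
      Real.exp_add]
    linear_combination (-(1/2) * Real.exp (β₂ * y.1.re) * quatForm m (fun l => y.2 l * qi) z.2) * k
  · simp [solvMul, theta_add_left, theta_smul_left, theta_add_right, theta_smul_right, mul_add,
      Real.exp_add]
    linear_combination (-(1/2) * Real.exp (β₂ * y.1.re) * quatForm m (fun l => y.2 l * qj) z.2) * k
  · simp [solvMul, theta_add_left, theta_smul_left, theta_add_right, theta_smul_right, mul_add,
      Real.exp_add]
    linear_combination (-(1/2) * Real.exp (β₂ * y.1.re) * quatForm m (fun l => y.2 l * qk) z.2) * k
  all_goals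
    simp [solvMul, mul_add, Real.exp_add]
    ring

lemma solvMul_zero_left (α β₁ β₂ : ℝ) {m : ℕ} (x : ModelSpace m) :
    solvMul α β₁ β₂ 0 x = x := by
  ext <;> simp [solvMul, theta_zero_left]

lemma solvMul_zero_right (α β₁ β₂ : ℝ) {m : ℕ} (x : ModelSpace m) :
    solvMul α β₁ β₂ x 0 = x := by
  ext <;> simp [solvMul]

lemma solvInv_mul (α β₁ β₂ : ℝ) {m : ℕ} (x : ModelSpace m) :
    solvMul α β₁ β₂ (solvInv β₁ β₂ x) x = 0 := by
  have h : ∀ c d : ℝ, theta (-(c • x.2)) (d • x.2) = 0 := fun c d => by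
    rw [← neg_smul, theta_smul_left, theta_smul_right, theta_self]; simp
  ext <;> simp [solvMul, solvInv, h]

lemma Model.one_mem {m : ℕ} (X : Model) : (X.one : ModelSpace m) ∈ X.domain m := by
  cases X <;> simp [Model.one, Model.domain]

lemma Model.mul_mem {m : ℕ} (X : Model) {x y : ModelSpace m} (hx : x ∈ X.domain m)
    (hy : y ∈ X.domain m) : X.mul x y ∈ X.domain m := by
  cases X <;> simp_all [Model.mul, Model.domain]

lemma Model.inv_mem {m : ℕ} (X : Model) {x : ModelSpace m} (hx : x ∈ X.domain m) :
    X.inv x ∈ X.domain m := by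
  cases X <;> simp_all [Model.inv, Model.domain]

lemma Model.mul_assoc {m : ℕ} (X : Model) (x y z : ModelSpace m) :
    X.mul (X.mul x y) z = X.mul x (X.mul y z) := by
  cases X
  case H5 β =>
    simp [Model.mul, _root_.mul_assoc, add_assoc, Real.mul_rpow, mul_smul]
  all_goals exact solvMul_assoc (by simp) x y z

lemma Model.one_mul {m : ℕ} (X : Model) (x : ModelSpace m) : X.mul X.one x = x := by
  cases X
  case H5 => simp [Model.mul, Model.one]
  all_goals exact solvMul_zero_left _ _ _ x

lemma Model.mul_one {m : ℕ} (X : Model) (x : ModelSpace m) : X.mul x X.one = x := by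
  cases X
  case H5 => simp [Model.mul, Model.one]
  all_goals exact solvMul_zero_right _ _ _ x

lemma Model.inv_mul {m : ℕ} (X : Model) {x : ModelSpace m} (hx : x ∈ X.domain m) :
    X.mul (X.inv x) x = X.one := by
  cases X
  case H5 β =>
    have hx : x.1 ≠ 0 := hx
    simp [Model.mul, Model.one, Model.inv, hx, Real.inv_rpow, Real.rpow_neg]
  all_goals exact solvInv_mul _ _ _ x

/-- The Lie group of a model, as a manifold. -/
abbrev Model.LieGrp (X : Model) (m : ℕ) : Type := X.domain m

instance (X : Model) (m : ℕ) : Group (X.LieGrp m) where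
  mul x y := ⟨X.mul x.1 y.1, X.mul_mem x.2 y.2⟩
  one := ⟨X.one, X.one_mem⟩
  inv x := ⟨X.inv x.1, X.inv_mem x.2⟩
  mul_assoc x y z := Subtype.ext (X.mul_assoc x.1 y.1 z.1)
  one_mul x := Subtype.ext (X.one_mul x.1)
  mul_one x := Subtype.ext (X.mul_one x.1)
  inv_mul_cancel x := Subtype.ext (X.inv_mul x.2)

/-- The inner product `c₁ g_ℝ + c₁ g_{Im ℍ} + c₂ g_{ℍ^m}` on `𝔪`. -/
def modelForm (m : ℕ) (c₁ c₂ : ℝ) : ModelSpace m →L[ℝ] ModelSpace m →L[ℝ] ℝ :=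
  c₁ • (innerSL ℝ : ℍ →L[ℝ] ℍ →L[ℝ] ℝ).bilinearComp (σ₁₃ := .id ℝ) (σ₂₃ := .id ℝ)
      (.fst ℝ ℍ (Fin m → ℍ)) (.fst ℝ ℍ (Fin m → ℍ)) +
    c₂ • (quatForm m).bilinearComp (.snd ℝ ℍ (Fin m → ℍ)) (.snd ℝ ℍ (Fin m → ℍ))

/-- The left-invariant metric `g_{c₁, c₂}` on the Lie group of a model. -/
def Model.metric (X : Model) (m : ℕ) (c₁ c₂ : ℝ) : MetricField 𝓘(ℝ, ModelSpace m) (X.LieGrp m) :=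
  leftInvariantMetric (modelForm m c₁ c₂)

/-! ### The groups of the models are Lie groups with the prescribed Lie algebras -/

section LieStructure

open VectorField

lemma theta_neg_comm {m : ℕ} (p q : Fin m → ℍ) : theta p q = -theta q p := by
  have h := theta_self (p + q)
  rw [theta_add_left, theta_add_right, theta_add_right, theta_self, theta_self] at h
  rw [eq_neg_iff_add_eq_zero]; simpa using h

/-- The linear map `q ↦ Θ(p, q)`. -/
def thetaR {m : ℕ} (p : Fin m → ℍ) : (Fin m → ℍ) →L[ℝ] ℍ :=
  LinearMap.toContinuousLinearMap
    { toFun := theta p, map_add' := theta_add_right p, map_smul' := fun c => theta_smul_right c p }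

/-- The linear map `p ↦ Θ(p, q)`. -/
def thetaL {m : ℕ} (q : Fin m → ℍ) : (Fin m → ℍ) →L[ℝ] ℍ :=
  LinearMap.toContinuousLinearMap
    { toFun := fun p => theta p q, map_add' := fun p p' => theta_add_left p p' q,
      map_smul' := fun c p => theta_smul_left c p q }

/-- The linear map `a ↦ Im a`. -/
def quatIm : ℍ →L[ℝ] ℍ :=
  LinearMap.toContinuousLinearMap
    { toFun := fun a => a.im, map_add' := fun a b => by ext <;> simp,
      map_smul' := fun c a => by ext <;> simp }

/-- The linear map `a ↦ Re a`. -/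
def quatRe : ℍ →L[ℝ] ℝ :=
  LinearMap.toContinuousLinearMap
    { toFun := fun a => a.re, map_add' := fun a b => by simp,
      map_smul' := fun c a => by simp }

@[simp] lemma thetaR_apply {m : ℕ} (p q : Fin m → ℍ) : thetaR p q = theta p q := rfl
@[simp] lemma thetaL_apply {m : ℕ} (p q : Fin m → ℍ) : thetaL q p = theta p q := rfl
@[simp] lemma quatIm_apply (a : ℍ) : quatIm a = a.im := rfl
@[simp] lemma quatRe_apply (a : ℍ) : quatRe a = a.re := rfl

/-- The differential of the left translation by `x` for `solvMul`. -/
def solvDL (α β₁ β₂ : ℝ) {m : ℕ} (x : ModelSpace m) : ModelSpace m →L[ℝ] ModelSpace m :=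
  (ContinuousLinearMap.smulRight (quatRe ∘L .fst ℝ ℍ (Fin m → ℍ)) (1 : ℍ) +
      Real.exp (β₁ * x.1.re) • (quatIm ∘L .fst ℝ ℍ (Fin m → ℍ)) +
      (α / 2 * Real.exp (β₂ * x.1.re)) • (thetaR x.2 ∘L .snd ℝ ℍ (Fin m → ℍ))).prod
    (Real.exp (β₂ * x.1.re) • .snd ℝ ℍ (Fin m → ℍ))

/-- The differential of the left translation by `x` in the group of a model. -/
def Model.dL {m : ℕ} : Model → ModelSpace m → ModelSpace m →L[ℝ] ModelSpace m
  | .H1 ε => solvDL ((ε : ℤ) : ℝ) 2 1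
  | .H2 => solvDL 1 0 0
  | .H3 β => solvDL 0 2 β
  | .H4 => solvDL 0 0 1
  | .H5 β => fun x => (ContinuousLinearMap.mul ℝ ℍ x.1 ∘L .fst ℝ ℍ (Fin m → ℍ)).prod
      (‖x.1‖ ^ β • .snd ℝ ℍ (Fin m → ℍ))

lemma solvMul_eq (α β₁ β₂ : ℝ) {m : ℕ} (x y : ModelSpace m) :
    solvMul α β₁ β₂ x y = solvMul α β₁ β₂ x 0 + solvDL α β₁ β₂ x y := by
  ext <;> simp [solvMul, solvDL, theta_smul_right] <;> ring

lemma Model.mul_eq {m : ℕ} (X : Model) (x y : ModelSpace m) :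
    X.mul x y = X.mul x 0 + X.dL x y := by
  cases X
  case H5 β => simp [Model.mul, Model.dL]
  all_goals exact solvMul_eq _ _ _ x y

lemma Model.hasFDerivAt_mul {m : ℕ} (X : Model) (x y : ModelSpace m) :
    HasFDerivAt (X.mul x) (X.dL x) y := by
  have h : X.mul x = fun y => X.mul x 0 + X.dL x y := funext (X.mul_eq x)
  rw [h]
  exact (X.dL x).hasFDerivAt.const_add _

lemma Model.hasMFDerivAt_mul {m : ℕ} (X : Model) (x y : X.LieGrp m) :
    HasMFDerivAt 𝓘(ℝ, ModelSpace m) 𝓘(ℝ, ModelSpace m) (fun y : X.LieGrp m => x * y) y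
      (X.dL x.1) :=
  hasMFDerivAt_opens y (fun _ => rfl) (X.hasFDerivAt_mul x.1 y.1)

lemma hasFDerivAt_solvDL (α β₁ β₂ : ℝ) {m : ℕ} (v : ModelSpace m) :
    HasFDerivAt (fun x : ModelSpace m => solvDL α β₁ β₂ x v)
      (((ContinuousLinearMap.smulRight (β₁ • (quatRe ∘L .fst ℝ ℍ (Fin m → ℍ))) v.1.im) +
        (α / 2) • (thetaL v.2 ∘L .snd ℝ ℍ (Fin m → ℍ))).prod
        (ContinuousLinearMap.smulRight (β₂ • (quatRe ∘L .fst ℝ ℍ (Fin m → ℍ))) v.2)) 0 := by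
  have hr : HasFDerivAt (fun x : ModelSpace m => x.1.re) (quatRe ∘L .fst ℝ ℍ (Fin m → ℍ)) 0 :=
    (quatRe ∘L .fst ℝ ℍ (Fin m → ℍ)).hasFDerivAt
  have h1 := (hr.const_mul β₁).exp
  have h2 := (hr.const_mul β₂).exp
  have h3 : HasFDerivAt (fun x : ModelSpace m => theta x.2 v.2)
      (thetaL v.2 ∘L .snd ℝ ℍ (Fin m → ℍ)) 0 :=
    (thetaL v.2 ∘L .snd ℝ ℍ (Fin m → ℍ)).hasFDerivAt
  have h := (((h1.smul_const v.1.im).const_add ((v.1.re : ℝ) • (1 : ℍ))).add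
    ((h2.const_mul (α / 2)).smul h3)).prodMk (h2.smul_const v.2)
  refine h.congr_fderiv ?_
  ext <;> simp [theta_zero_left]

lemma solvDL_zero (α β₁ β₂ : ℝ) {m : ℕ} (v : ModelSpace m) : solvDL α β₁ β₂ 0 v = v := by
  ext <;> simp [solvDL, theta_zero_left]

lemma solv_lieBracket (α β₁ β₂ : ℝ) {m : ℕ} (u v : ModelSpace m) :
    lieBracket ℝ (fun x : ModelSpace m => solvDL α β₁ β₂ x u) (fun x => solvDL α β₁ β₂ x v) 0 =
      bracket ⟨α, β₁, β₂, 0, 0⟩ u v := by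
  rw [lieBracket, (hasFDerivAt_solvDL α β₁ β₂ u).fderiv, (hasFDerivAt_solvDL α β₁ β₂ v).fderiv]
  simp only [solvDL_zero]
  have h := theta_neg_comm v.2 u.2
  refine Prod.ext ?_ ?_
  · simp [bracket, h]
    module
  · simp [bracket]
    module

lemma hasFDerivAt_dL_H5 (β : ℝ) {m : ℕ} (v : ModelSpace m) :
    HasFDerivAt (fun x : ModelSpace m => (Model.H5 β).dL x v)
      (((ContinuousLinearMap.mul ℝ ℍ).flip v.1 ∘L .fst ℝ ℍ (Fin m → ℍ)).prod
        (ContinuousLinearMap.smulRight (β • (quatRe ∘L .fst ℝ ℍ (Fin m → ℍ))) v.2)) (1, 0) := by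
  have hr : HasFDerivAt (fun x : ModelSpace m => ‖x.1‖ ^ β)
      (β • (quatRe ∘L .fst ℝ ℍ (Fin m → ℍ))) (1, 0) := by
    have h0 : HasFDerivAt (fun a : ℍ => ‖a‖ ^ 2) (2 • innerSL ℝ (1 : ℍ)) (1 : ℍ) :=
      (hasStrictFDerivAt_norm_sq (1 : ℍ)).hasFDerivAt
    have h1 := h0.rpow_const (p := β / 2) (Or.inl (by simp))
    have h2 : HasFDerivAt (fun a : ℍ => ‖a‖ ^ β) (β • quatRe) (1 : ℍ) := by
      refine (h1.congr_fderiv ?_).congr_of_eventuallyEq ?_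
      · ext a; simp [Quaternion.inner_def]; ring
      · refine Filter.Eventually.of_forall fun a => ?_
        simp only
        rw [← Real.rpow_natCast, ← Real.rpow_mul (norm_nonneg a)]
        congr 1; push_cast; ring
    exact HasFDerivAt.comp (g := fun a : ℍ => ‖a‖ ^ β) (f := fun x : ModelSpace m => x.1)
      ((1, 0) : ModelSpace m) h2 (ContinuousLinearMap.fst ℝ ℍ (Fin m → ℍ)).hasFDerivAt
  have h4 : HasFDerivAt (fun x : ModelSpace m => x.1 * v.1)
      ((ContinuousLinearMap.mul ℝ ℍ).flip v.1 ∘L .fst ℝ ℍ (Fin m → ℍ)) (1, 0) :=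
    ((ContinuousLinearMap.mul ℝ ℍ).flip v.1 ∘L .fst ℝ ℍ (Fin m → ℍ)).hasFDerivAt
  exact h4.prodMk (hr.smul_const v.2)

lemma H5_lieBracket (β : ℝ) {m : ℕ} (u v : ModelSpace m) :
    lieBracket ℝ (fun x : ModelSpace m => (Model.H5 β).dL x u) (fun x => (Model.H5 β).dL x v)
      (1, 0) = bracket ⟨0, 0, β, 1, 0⟩ u v := by
  rw [lieBracket, (hasFDerivAt_dL_H5 β u).fderiv, (hasFDerivAt_dL_H5 β v).fderiv]
  refine Prod.ext ?_ ?_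
  · ext <;> simp [bracket, Model.dL] <;> ring
  · simp [bracket, Model.dL]
    module

/-- The Lie algebra of the group of a model is `𝔪` with the bracket given by the parameters of the
model. -/
theorem Model.groupLieAlgebra_bracket (X : Model) (m : ℕ)
    (u v : GroupLieAlgebra 𝓘(ℝ, ModelSpace m) (X.LieGrp m)) :
    (⁅u, v⁆ : GroupLieAlgebra 𝓘(ℝ, ModelSpace m) (X.LieGrp m)) =
      bracket (m := m) X.params u v := by
  have h : ∀ (u : ModelSpace m) (x : X.domain m),
      mulInvariantVectorField (I := 𝓘(ℝ, ModelSpace m)) (G := X.LieGrp m) u x =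
        (fun x : ModelSpace m => X.dL x u) x.1 :=
    fun u x => congrArg (fun L : ModelSpace m →L[ℝ] ModelSpace m => L u)
      (X.hasMFDerivAt_mul x 1).mfderiv
  rw [GroupLieAlgebra.bracket_def, mlieBracket_opens (U := X.domain m)
    (V' := fun x => X.dL x u) (W' := fun x => X.dL x v) (h u) (h v)]
  cases X
  case H5 β => exact H5_lieBracket β (m := m) u v
  all_goals exact solv_lieBracket _ _ _ (m := m) u v

lemma contDiff_theta {m : ℕ} :
    ContDiff ℝ ∞ fun x : (Fin m → ℍ) × (Fin m → ℍ) => theta x.1 x.2 := by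
  have e : ∀ p q : Fin m → ℍ, theta p q = quatForm m (fun l => p l * qi) q • qi +
      quatForm m (fun l => p l * qj) q • qj + quatForm m (fun l => p l * qk) q • qk := by
    intro p q; ext <;> simp
  have h : ∀ a : ℍ, ContDiff ℝ ∞ fun x : (Fin m → ℍ) × (Fin m → ℍ) =>
      quatForm m (fun l => x.1 l * a) x.2 • a := by
    intro a
    have h1 : ContDiff ℝ ∞ fun x : (Fin m → ℍ) × (Fin m → ℍ) => (fun l => x.1 l * a) :=
      contDiff_pi.2 fun l => by fun_prop
    exact (((quatForm m).contDiff.comp h1).clm_apply contDiff_snd).smul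
      (contDiff_const (c := a))
  simp only [e]
  exact ((h _).add (h _)).add (h _)

lemma contDiff_solvMul (α β₁ β₂ : ℝ) {m : ℕ} :
    ContDiff ℝ ∞ fun x : ModelSpace m × ModelSpace m => solvMul α β₁ β₂ x.1 x.2 := by
  have hr : ContDiff ℝ ∞ fun x : ModelSpace m × ModelSpace m => x.1.1.re :=
    (quatRe ∘L .fst ℝ ℍ (Fin m → ℍ) ∘L .fst ℝ (ModelSpace m) (ModelSpace m)).contDiff
  have hq : ContDiff ℝ ∞ fun x : ModelSpace m × ModelSpace m =>
      Real.exp (β₂ * x.1.1.re) • x.2.2 := by fun_prop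
  have h1 : ContDiff ℝ ∞ fun x : ModelSpace m × ModelSpace m => ((x.1.1.re + x.2.1.re : ℝ) : ℍ) := by
    have hr' : ContDiff ℝ ∞ fun x : ModelSpace m × ModelSpace m => x.2.1.re :=
      (quatRe ∘L .fst ℝ ℍ (Fin m → ℍ) ∘L .snd ℝ (ModelSpace m) (ModelSpace m)).contDiff
    convert (hr.add hr').smul (contDiff_const (c := (1 : ℍ))) using 2 with x
    ext <;> simp
  have h2 : ContDiff ℝ ∞ fun x : ModelSpace m × ModelSpace m => x.1.1.im :=
    (quatIm ∘L .fst ℝ ℍ (Fin m → ℍ) ∘L .fst ℝ (ModelSpace m) (ModelSpace m)).contDiff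
  have h3 : ContDiff ℝ ∞ fun x : ModelSpace m × ModelSpace m => x.2.1.im :=
    (quatIm ∘L .fst ℝ ℍ (Fin m → ℍ) ∘L .snd ℝ (ModelSpace m) (ModelSpace m)).contDiff
  have h4 := contDiff_theta.comp (f := fun x : ModelSpace m × ModelSpace m =>
    (x.1.2, Real.exp (β₂ * x.1.1.re) • x.2.2)) (ContDiff.prodMk (by fun_prop) hq)
  have h5 : ContDiff ℝ ∞ fun x : ModelSpace m × ModelSpace m => Real.exp (β₁ * x.1.1.re) := by
    fun_prop
  have h6 : ContDiff ℝ ∞ fun x : ModelSpace m × ModelSpace m => x.1.2 := by fun_prop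
  exact (h1.add ((h2.add (h5.smul h3)).add ((contDiff_const (c := α / 2)).smul h4))).prodMk (h6.add hq)

lemma contDiff_solvInv (β₁ β₂ : ℝ) {m : ℕ} :
    ContDiff ℝ ∞ fun x : ModelSpace m => solvInv β₁ β₂ x := by
  have hr : ContDiff ℝ ∞ fun x : ModelSpace m => x.1.re :=
    (quatRe ∘L .fst ℝ ℍ (Fin m → ℍ)).contDiff
  have h1 : ContDiff ℝ ∞ fun x : ModelSpace m => ((-x.1.re : ℝ) : ℍ) := by
    convert hr.neg.smul (contDiff_const (c := (1 : ℍ))) using 2 with x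
    ext <;> simp
  have h2 : ContDiff ℝ ∞ fun x : ModelSpace m => x.1.im :=
    (quatIm ∘L .fst ℝ ℍ (Fin m → ℍ)).contDiff
  have h5 : ContDiff ℝ ∞ fun x : ModelSpace m => Real.exp (-(β₁ * x.1.re)) := by fun_prop
  have h6 : ContDiff ℝ ∞ fun x : ModelSpace m => -(Real.exp (-(β₂ * x.1.re)) • x.2) := by fun_prop
  exact (h1.sub (h5.smul h2)).prodMk h6

lemma contDiffAt_norm_rpow (β : ℝ) {a : ℍ} (ha : a ≠ 0) :
    ContDiffAt ℝ ∞ (fun a : ℍ => ‖a‖ ^ β) a :=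
  (contDiffAt_norm ℝ ha).rpow_const_of_ne (norm_ne_zero_iff.2 ha)

lemma Model.contDiffAt_mul {m : ℕ} (X : Model) {x y : ModelSpace m} (hx : x ∈ X.domain m) :
    ContDiffAt ℝ ∞ (fun z : ModelSpace m × ModelSpace m => X.mul z.1 z.2) (x, y) := by
  cases X
  case H5 β =>
    have h := (contDiffAt_norm_rpow β (show x.1 ≠ 0 from hx)).comp
      (f := fun z : ModelSpace m × ModelSpace m => z.1.1) (x, y) (by fun_prop)
    refine ContDiffAt.prodMk (by fun_prop) (ContDiffAt.add (by fun_prop)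
      (ContDiffAt.smul h (by fun_prop)))
  all_goals exact (contDiff_solvMul _ _ _).contDiffAt

lemma Model.contDiffAt_inv {m : ℕ} (X : Model) {x : ModelSpace m} (hx : x ∈ X.domain m) :
    ContDiffAt ℝ ∞ (fun z : ModelSpace m => X.inv z) x := by
  cases X
  case H5 β =>
    have hx : x.1 ≠ 0 := hx
    have h := (contDiffAt_norm_rpow (-β) hx).comp (f := fun z : ModelSpace m => z.1) x
      (by fun_prop)
    have h' : ContDiffAt ℝ ∞ (fun a : ℍ => a⁻¹) x.1 := by
      simpa using contDiffAt_ringInverse ℝ (Units.mk0 x.1 hx)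
    exact (h'.comp (f := fun z : ModelSpace m => z.1) x (by fun_prop)).prodMk
      (ContDiffAt.neg (ContDiffAt.smul h (by fun_prop)))
  all_goals exact (contDiff_solvInv _ _).contDiffAt

instance (X : Model) (m : ℕ) : LieGroup 𝓘(ℝ, ModelSpace m) ∞ (X.LieGrp m) where
  contMDiff_mul := by
    rw [← ContMDiff.subtypeVal_comp_iff]
    intro p
    have h : ContMDiffAt (𝓘(ℝ, ModelSpace m).prod 𝓘(ℝ, ModelSpace m))
        𝓘(ℝ, ModelSpace m × ModelSpace m) ∞
        (fun p : X.LieGrp m × X.LieGrp m => (p.1.1, p.2.1)) p :=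
      ((contMDiff_subtype_val.comp contMDiff_fst).prodMk_space
        (contMDiff_subtype_val.comp contMDiff_snd)) p
    exact ContMDiffAt.comp (g := fun z : ModelSpace m × ModelSpace m => X.mul z.1 z.2)
      (f := fun p : X.LieGrp m × X.LieGrp m => (p.1.1, p.2.1)) p
      (X.contDiffAt_mul (y := p.2.1) p.1.2).contMDiffAt h
  contMDiff_inv := by
    rw [← ContMDiff.subtypeVal_comp_iff]
    intro p
    exact ContMDiffAt.comp (g := fun z : ModelSpace m => X.inv z)
      (f := fun p : X.LieGrp m => p.1) p (X.contDiffAt_inv p.2).contMDiffAt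
      contMDiff_subtype_val.contMDiffAt

end LieStructure

end Submax

end

/-! The group of a model is an open subset of `𝔪` whose left translations are affine, so its metric
is the constant form `modelForm` pulled back by the Maurer-Cartan coframe. The Levi-Civita
connection is then an algebraic product `conn` on `𝔪`, and curvature, Ricci tensor and `∇R` become
polynomials in it (`IsCoframe.curvature`, `IsCoframe.ricci`, `IsCoframe.nablaCurvature`). The
calculus behind this is a single fact about soldering forms, `IsSoldered.curvature`; applied to the
differential of a map instead of a coframe, it yields naturality under local isometries.

Einstein condition: the Ricci form is a multiple of the standard inner product on each of the
summands `ℝ`, `Im ℍ`, `ℍ^m` (`trace_algCurvature`), which leaves two equations in the parameters.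

Conformal flatness: a conformal change does not affect `g(R(u, v) w, z)` on pairwise orthogonal
vectors, up to the factor from the metric (`IsMetricOn.conformal_orthogonal`). Two quadruples of
such vectors give `α = 0` if `γ₁ = 0`, and `(β₁ - β₂)² = γ₁²` if `α = 0`; only `ℋ₃^2` and `ℋ₅^{±1}`
survive. For these a conformal factor and a flattening map are explicit.

Local symmetry: the equivalences are proved in a circle. One component of `∇R` for each of `ℋ₁`,
`ℋ₂`, `ℋ₃` excludes every model that is not on the list. Each model on the list is mapped
homothetically onto its standard space. That space has a point symmetry at the image of the neutral
element, which pulls back to the group and is spread by left translations. Finally, an isometry with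
differential `-id` forces `∇R = 0`.

Homotheties: apart from `ℋ₁` and `ℋ₂`, the metrics are multiply warped products, and one of
`e^{2r}`, `e^r`, `|x|^β` serves as height in the upper half space (for `ℋ₅^0`, `log |x|` is one more
flat coordinate). For `ℋ₁` with `c₁ = 2 c₂`, the group is sent to the Siegel domain `Re ζ > |q|² /
2` and from there to the ball by the Cayley transform (`ballForm_cayley`). -/

noncomputable section

/-! ### Coordinate calculus: Levi-Civita connection, curvature and soldering forms. -/

namespace RiemGeom

open scoped Topology

set_option maxSynthPendingDepth 10

section Calculus

variable {E : Type*} [NormedAddCommGroup E] [NormedSpace ℝ E]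
  {F : Type*} [NormedAddCommGroup F] [NormedSpace ℝ F]

/-! ### Metrics and Christoffel symbols -/

/-- A Riemannian (or pseudo-Riemannian) metric on an open set `U`. -/
structure IsMetricOn (G : E → E →L[ℝ] E →L[ℝ] ℝ) (U : Set E) : Prop where
  isOpen : IsOpen U
  contDiffOn : ContDiffOn ℝ ∞ G U
  symm : ∀ y ∈ U, ∀ u v, G y u v = G y v u
  inv : ∀ y ∈ U, (G y).IsInvertible

/-- Uniqueness of the Levi-Civita connection: for a symmetric and compatible `Γ` the Koszul
combination of derivatives collapses to `2 G(Γ(u, v), ·)`. The Christoffel symbols needed below are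
guessed and then verified through these two properties. -/
lemma christoffel_eq {G : E → E →L[ℝ] E →L[ℝ] ℝ} {y : E} (hinv : (G y).IsInvertible)
    (hsymm : ∀ u v, G y u v = G y v u) {Γ : E → E → E} (hΓ : ∀ u v, Γ u v = Γ v u)
    (hc : ∀ u v w, fderiv ℝ G y u v w = G y (Γ u v) w + G y v (Γ u w)) (u v : E) :
    christoffel G y u v = Γ u v := by
  rw [christoffel_apply, hinv.inverse_apply_eq]
  ext w
  simp only [smul_apply, add_apply,
    sub_apply, ContinuousLinearMap.flip_apply, hc, smul_eq_mul]
  rw [hΓ v u, hΓ w u, hΓ w v, hsymm (Γ u w) v, hsymm u]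
  ring

lemma IsMetricOn.contDiffAt {G : E → E →L[ℝ] E →L[ℝ] ℝ} {U : Set E} (h : IsMetricOn G U) {y : E}
    (hy : y ∈ U) : ContDiffAt ℝ ∞ G y :=
  (h.contDiffOn y hy).contDiffAt (h.isOpen.mem_nhds hy)

lemma IsMetricOn.fderiv_symm {G : E → E →L[ℝ] E →L[ℝ] ℝ} {U : Set E} (h : IsMetricOn G U) {y : E}
    (hy : y ∈ U) (u v w : E) : fderiv ℝ G y u v w = fderiv ℝ G y u w v := by
  have hd : HasFDerivAt G (fderiv ℝ G y) y :=
    ((h.contDiffAt hy).differentiableAt (by simp)).hasFDerivAt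
  have h1 := (hd.clm_apply (hasFDerivAt_const v y)).clm_apply (hasFDerivAt_const w y)
  have h2 := (hd.clm_apply (hasFDerivAt_const w y)).clm_apply (hasFDerivAt_const v y)
  have h3 := h2.congr_of_eventuallyEq (f₁ := fun y => G y v w)
    (by filter_upwards [h.isOpen.mem_nhds hy] with z hz using h.symm z hz v w)
  simpa using congrArg (fun L : E →L[ℝ] ℝ => L u) (h1.unique h3)

lemma IsMetricOn.christoffel_symm {G : E → E →L[ℝ] E →L[ℝ] ℝ} {U : Set E} (h : IsMetricOn G U)
    {y : E} (hy : y ∈ U) (u v : E) : christoffel G y u v = christoffel G y v u := by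
  rw [christoffel_apply, christoffel_apply]
  congr 2
  ext w
  simp only [add_apply,
    sub_apply, ContinuousLinearMap.flip_apply]
  rw [h.fderiv_symm hy w u v]; ring

/-- Existence half of the Levi-Civita theorem. It is needed for the target of a local isometry and
for conformal changes. -/
lemma IsMetricOn.christoffel_compat {G : E → E →L[ℝ] E →L[ℝ] ℝ} {U : Set E} (h : IsMetricOn G U)
    {y : E} (hy : y ∈ U) (u v w : E) :
    fderiv ℝ G y u v w = G y (christoffel G y u v) w + G y v (christoffel G y u w) := by
  rw [h.symm y hy v, christoffel_apply, christoffel_apply, (h.inv y hy).self_apply_inverse,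
    (h.inv y hy).self_apply_inverse]
  simp only [smul_apply, add_apply,
    sub_apply, ContinuousLinearMap.flip_apply, smul_eq_mul]
  rw [h.fderiv_symm hy u w v, h.fderiv_symm hy v u w, h.fderiv_symm hy w u v]
  ring

lemma IsMetricOn.contDiffOn_christoffel [CompleteSpace E] {G : E → E →L[ℝ] E →L[ℝ] ℝ} {U : Set E}
    (h : IsMetricOn G U) : ContDiffOn ℝ ∞ (christoffel G) U := by
  have hD : ContDiffOn ℝ ∞ (fderiv ℝ G) U := h.contDiffOn.fderiv_of_isOpen h.isOpen (by simp)
  have hI : ContDiffOn ℝ ∞ (fun y => (G y).inverse) U := fun y hy =>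
    ((h.inv y hy).contDiffAt_map_inverse.comp y (h.contDiffAt hy)).contDiffWithinAt
  have hs : ContDiffOn ℝ ∞ (fun y => ContinuousLinearMap.compL ℝ E (E →L[ℝ] ℝ) E (G y).inverse) U :=
    (ContinuousLinearMap.compL ℝ E (E →L[ℝ] ℝ) E).contDiff.comp_contDiffOn hI
  have hT := hs.clm_comp hD
  have hfl : ContDiffOn ℝ ∞ (fun y => (fderiv ℝ G y).flip) U :=
    (ContinuousLinearMap.flipₗᵢ ℝ E E (E →L[ℝ] ℝ)).contDiff.comp_contDiffOn hD
  have hTf := (ContinuousLinearMap.flipₗᵢ ℝ E E E).contDiff.comp_contDiffOn hT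
  have hS := hs.clm_comp ((contDiffOn_const (s := U) (n := ∞)
    (c := (ContinuousLinearMap.flipₗᵢ ℝ E E ℝ).toContinuousLinearEquiv.toContinuousLinearMap)).clm_comp hfl)
  exact ((hT.add hTf).sub hS).const_smul (1 / 2 : ℝ)

/-- The curvature tensor as a continuous trilinear map. -/
def curvatureCLM (G : E → E →L[ℝ] E →L[ℝ] ℝ) (y : E) : E →L[ℝ] E →L[ℝ] E →L[ℝ] E :=
  let D : E →L[ℝ] E →L[ℝ] E →L[ℝ] E := fderiv ℝ (christoffel G) y
  let C : E →L[ℝ] E →L[ℝ] E →L[ℝ] E :=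
    (ContinuousLinearMap.compL ℝ E E E).bilinearComp (christoffel G y) (christoffel G y)
  D - D.flip + C - C.flip

lemma curvatureCLM_apply (G : E → E →L[ℝ] E →L[ℝ] ℝ) (y u v w : E) :
    curvatureCLM G y u v w = coordCurvature G y u v w := rfl

lemma IsMetricOn.contDiffOn_curvatureCLM [CompleteSpace E] {G : E → E →L[ℝ] E →L[ℝ] ℝ} {U : Set E}
    (h : IsMetricOn G U) : ContDiffOn ℝ ∞ (curvatureCLM G) U := by
  have hΓ := h.contDiffOn_christoffel
  have hD : ContDiffOn ℝ ∞ (fderiv ℝ (christoffel G)) U := hΓ.fderiv_of_isOpen h.isOpen (by simp)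
  have hDf := (ContinuousLinearMap.flipₗᵢ ℝ E E (E →L[ℝ] E)).contDiff.comp_contDiffOn hD
  have hC : ContDiffOn ℝ ∞ (fun y => (ContinuousLinearMap.compL ℝ E E E).bilinearComp
      (christoffel G y) (christoffel G y)) U := by
    have h1 : ContDiffOn ℝ ∞ (fun y => (ContinuousLinearMap.compL ℝ E E E) ∘L
      (christoffel G y)) U := contDiffOn_const.clm_comp hΓ
    have h2 := (ContinuousLinearMap.flipₗᵢ ℝ E (E →L[ℝ] E) (E →L[ℝ] E)).contDiff.comp_contDiffOn h1
    have h3 := h2.clm_comp hΓ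
    exact (ContinuousLinearMap.flipₗᵢ ℝ E E (E →L[ℝ] E)).contDiff.comp_contDiffOn h3
  have hCf := (ContinuousLinearMap.flipₗᵢ ℝ E E (E →L[ℝ] E)).contDiff.comp_contDiffOn hC
  exact ((hD.sub hDf).add hC).sub hCf

/-! ### Dependence on the germ of the metric -/

lemma christoffel_congr {G G' : E → E →L[ℝ] E →L[ℝ] ℝ} {y : E} (h : G =ᶠ[𝓝 y] G') :
    christoffel G =ᶠ[𝓝 y] christoffel G' := by
  filter_upwards [h.eventuallyEq_nhds] with z hz
  simp only [christoffel, hz.fderiv_eq, hz.eq_of_nhds]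

lemma coordCurvature_congr {G G' : E → E →L[ℝ] E →L[ℝ] ℝ} {y : E} (h : G =ᶠ[𝓝 y] G') :
    coordCurvature G y = coordCurvature G' y := by
  have := christoffel_congr h
  ext u v w
  simp only [coordCurvature, this.fderiv_eq, this.eq_of_nhds]

lemma coordRicci_congr {G G' : E → E →L[ℝ] E →L[ℝ] ℝ} {y : E} (h : G =ᶠ[𝓝 y] G') :
    coordRicci G y = coordRicci G' y := by
  have := coordCurvature_congr h
  ext v w
  simp only [coordRicci, this]

lemma coordNablaCurvature_congr {G G' : E → E →L[ℝ] E →L[ℝ] ℝ} {y : E} (h : G =ᶠ[𝓝 y] G') :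
    coordNablaCurvature G y = coordNablaCurvature G' y := by
  have h1 := christoffel_congr h
  have h2 := coordCurvature_congr h
  have h3 : ∀ u v w, (fun z => coordCurvature G z u v w) =ᶠ[𝓝 y]
      fun z => coordCurvature G' z u v w := by
    intro u v w
    filter_upwards [h.eventuallyEq_nhds] with z hz
    rw [coordCurvature_congr hz]
  ext z u v w
  simp only [coordNablaCurvature, h1.eq_of_nhds, h2, (h3 u v w).fderiv_eq]

/-! ### Change of frame -/

/-- The curvature form of the connection form `Ω`. -/
def formCurvature (Ω : E → E →L[ℝ] F →L[ℝ] F) (y u v : E) (a : F) : F :=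
  fderiv ℝ Ω y u v a - fderiv ℝ Ω y v u a + Ω y u (Ω y v a) - Ω y v (Ω y u a)

/-- A metric `G` that is the pullback of the fibre metric `K` with connection `Ω` under the
soldering form `P`, for which `Ω` is metric and torsion free. -/
structure IsSoldered (G : E → E →L[ℝ] E →L[ℝ] ℝ) (U : Set E) (P : E → E →L[ℝ] F)
    (K : E → F →L[ℝ] F →L[ℝ] ℝ) (Ω : E → E →L[ℝ] F →L[ℝ] F) : Prop where
  metric : IsMetricOn G U
  contDiffOn_P : ContDiffOn ℝ ∞ P U
  contDiffOn_K : ContDiffOn ℝ ∞ K U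
  contDiffOn_form : ContDiffOn ℝ ∞ Ω U
  inv : ∀ y ∈ U, (P y).IsInvertible
  pullback : ∀ y ∈ U, ∀ u v, G y u v = K y (P y u) (P y v)
  compat : ∀ y ∈ U, ∀ u a b, fderiv ℝ K y u a b = K y (Ω y u a) b + K y a (Ω y u b)
  torsion : ∀ y ∈ U, ∀ u v,
    fderiv ℝ P y u v + Ω y u (P y v) = fderiv ℝ P y v u + Ω y v (P y u)

section Soldered

variable {G : E → E →L[ℝ] E →L[ℝ] ℝ} {U : Set E} {P : E → E →L[ℝ] F}
    {K : E → F →L[ℝ] F →L[ℝ] ℝ} {Ω : E → E →L[ℝ] F →L[ℝ] F}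

lemma IsMetricOn.hasFDerivAt_of_contDiffOn (h : IsMetricOn G U) {f : E → F}
    (hf : ContDiffOn ℝ ∞ f U) {y : E} (hy : y ∈ U) : HasFDerivAt f (fderiv ℝ f y) y :=
  (((hf y hy).contDiffAt (h.isOpen.mem_nhds hy)).differentiableAt (by simp)).hasFDerivAt

/-- Transported by `P⁻¹`, the right side is symmetric because `Ω` has no torsion, and compatible
with `G` because `Ω` is metric for `K`; uniqueness identifies it. In other words, `P` is parallel.
-/
lemma IsSoldered.christoffel (h : IsSoldered G U P K Ω) {y : E} (hy : y ∈ U) (u v : E) :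
    P y (christoffel G y u v) = fderiv ℝ P y u v + Ω y u (P y v) := by
  have key := christoffel_eq (h.metric.inv y hy) (h.metric.symm y hy)
    (Γ := fun u v => (P y).inverse (fderiv ℝ P y u v + Ω y u (P y v)))
    (fun u v => by simp only [h.torsion y hy u v]) ?_ u v
  · rw [key, (h.inv y hy).self_apply_inverse]
  -- Compatibility comes from differentiating `G = K(P ·, P ·)` in the direction `u`.
  · intro u v w
    simp only [h.pullback y hy, (h.inv y hy).self_apply_inverse]
    have dP := h.metric.hasFDerivAt_of_contDiffOn h.contDiffOn_P hy
    have dK := h.metric.hasFDerivAt_of_contDiffOn h.contDiffOn_K hy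
    have dG := h.metric.hasFDerivAt_of_contDiffOn h.metric.contDiffOn hy
    have h1 := (dG.clm_apply (hasFDerivAt_const v y)).clm_apply (hasFDerivAt_const w y)
    have h2 := (dK.clm_apply (dP.clm_apply (hasFDerivAt_const v y))).clm_apply
      (dP.clm_apply (hasFDerivAt_const w y))
    have h3 := h2.congr_of_eventuallyEq (f₁ := fun y => G y v w)
      (by filter_upwards [h.metric.isOpen.mem_nhds hy] with z hz using h.pullback z hz v w)
    have h4 := congrArg (fun L : E →L[ℝ] ℝ => L u) (h1.unique h3)
    simp [h.compat y hy] at h4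
    rw [h4]
    simp
    ring

/-- A parallel isomorphism intertwines curvatures: differentiate `P Γ(v, w) = ∂ᵥP w + Ω(v) P w` in
the direction `u` and antisymmetrise in `u, v`. The second derivatives of `P` and the mixed terms `Ω
∂P` drop out by symmetry. -/
lemma IsSoldered.curvature [CompleteSpace E] (h : IsSoldered G U P K Ω) {y : E} (hy : y ∈ U)
    (u v w : E) :
    P y (coordCurvature G y u v w) = formCurvature Ω y u v (P y w) := by
  have dP := h.metric.hasFDerivAt_of_contDiffOn h.contDiffOn_P hy
  have dO := h.metric.hasFDerivAt_of_contDiffOn h.contDiffOn_form hy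
  have dΓ := h.metric.hasFDerivAt_of_contDiffOn h.metric.contDiffOn_christoffel hy
  have dDP := h.metric.hasFDerivAt_of_contDiffOn
    (h.contDiffOn_P.fderiv_of_isOpen h.metric.isOpen (m := ∞) (by simp)) hy
  have hs : ∀ u v, fderiv ℝ (fderiv ℝ P) y u v = fderiv ℝ (fderiv ℝ P) y v u :=
    fun u v => ((h.contDiffOn_P y hy).contDiffAt (h.metric.isOpen.mem_nhds hy)).isSymmSndFDerivAt
      (by simpa using ENat.LEInfty.out) u v
  have key : ∀ u v, P y (fderiv ℝ (RiemGeom.christoffel G) y u v w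
        + RiemGeom.christoffel G y u (RiemGeom.christoffel G y v w)) =
      fderiv ℝ (fderiv ℝ P) y u v w + fderiv ℝ Ω y u v (P y w) + Ω y v (fderiv ℝ P y u w)
        + Ω y u (fderiv ℝ P y v w) + Ω y u (Ω y v (P y w)) := by
    intro u v
    have h1 := dP.clm_apply ((dΓ.clm_apply (hasFDerivAt_const v y)).clm_apply
      (hasFDerivAt_const w y))
    have h2 := ((dDP.clm_apply (hasFDerivAt_const v y)).clm_apply (hasFDerivAt_const w y)).add
      ((dO.clm_apply (hasFDerivAt_const v y)).clm_apply (dP.clm_apply (hasFDerivAt_const w y)))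
    have h3 := h2.congr_of_eventuallyEq (f₁ := fun y => P y (RiemGeom.christoffel G y v w))
      (by filter_upwards [h.metric.isOpen.mem_nhds hy] with z hz using h.christoffel hz v w)
    have h4 := congrArg (fun L : E →L[ℝ] F => L u) (h1.unique h3)
    simp at h4
    have h5 := h.christoffel hy u (RiemGeom.christoffel G y v w)
    rw [h.christoffel hy v w, map_add] at h5
    rw [map_add, h5, eq_sub_of_add_eq h4]
    abel
  have e : coordCurvature G y u v w =
      (fderiv ℝ (RiemGeom.christoffel G) y u v w
        + RiemGeom.christoffel G y u (RiemGeom.christoffel G y v w)) -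
      (fderiv ℝ (RiemGeom.christoffel G) y v u w
        + RiemGeom.christoffel G y v (RiemGeom.christoffel G y u w)) := by
    simp only [coordCurvature]; abel
  rw [e, map_sub, key, key, hs u v, formCurvature]
  abel

/-- Here `T` is the curvature read in the fibre: a constant tensor for a coframe, the curvature of
the target for a local isometry. The formula follows by differentiating `P R(u, v) w = T(Pu, Pv,
Pw)` and using that `P` is parallel. -/
lemma IsSoldered.nablaCurvature [CompleteSpace E] (h : IsSoldered G U P K Ω)
    {T : E → F →L[ℝ] F →L[ℝ] F →L[ℝ] F} (hT : ContDiffOn ℝ ∞ T U)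
    (hTc : ∀ y ∈ U, ∀ u v w, P y (coordCurvature G y u v w) = T y (P y u) (P y v) (P y w))
    {y : E} (hy : y ∈ U) (z u v w : E) :
    P y (coordNablaCurvature G y z u v w) =
      fderiv ℝ T y z (P y u) (P y v) (P y w) + Ω y z (T y (P y u) (P y v) (P y w))
        - T y (Ω y z (P y u)) (P y v) (P y w) - T y (P y u) (Ω y z (P y v)) (P y w)
        - T y (P y u) (P y v) (Ω y z (P y w)) := by
  have dP := h.metric.hasFDerivAt_of_contDiffOn h.contDiffOn_P hy
  have dT := h.metric.hasFDerivAt_of_contDiffOn hT hy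
  have dR := h.metric.hasFDerivAt_of_contDiffOn h.metric.contDiffOn_curvatureCLM hy
  have dR' := ((dR.clm_apply (hasFDerivAt_const u y)).clm_apply (hasFDerivAt_const v y)).clm_apply
      (hasFDerivAt_const w y)
  have h1 := dP.clm_apply dR'
  have h2 := ((dT.clm_apply (dP.clm_apply (hasFDerivAt_const u y))).clm_apply
      (dP.clm_apply (hasFDerivAt_const v y))).clm_apply (dP.clm_apply (hasFDerivAt_const w y))
  have h3 := h2.congr_of_eventuallyEq (f₁ := fun y => P y (curvatureCLM G y u v w))
      (by filter_upwards [h.metric.isOpen.mem_nhds hy] with z hz using hTc z hz u v w)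
  have h4 := congrArg (fun L : E →L[ℝ] F => L z) (h1.unique h3)
  have e : fderiv ℝ (fun y' => coordCurvature G y' u v w) y z =
      fderiv ℝ (curvatureCLM G) y z u v w := by
    have := dR'.fderiv
    simp only [curvatureCLM_apply] at this
    rw [this]; simp
  simp [curvatureCLM_apply] at h4
  simp only [coordNablaCurvature, e, map_add, map_sub, hTc y hy, h.christoffel hy,
    add_apply]
  rw [eq_sub_of_add_eq h4]
  abel

end Soldered

end Calculus

end RiemGeom

/-! ### Left-invariant metrics, local isometries and conformal changes. -/

namespace RiemGeom

open scoped Topology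

set_option maxSynthPendingDepth 10

section Calculus

variable {E : Type*} [NormedAddCommGroup E] [NormedSpace ℝ E]
  {F : Type*} [NormedAddCommGroup F] [NormedSpace ℝ F]

lemma isInvertible_of_pos [FiniteDimensional ℝ E] {B : E →L[ℝ] E →L[ℝ] ℝ}
    (hB : ∀ u, u ≠ 0 → 0 < B u u) : B.IsInvertible := by
  have hinj : Function.Injective (B : E →ₗ[ℝ] E →L[ℝ] ℝ) := by
    rw [← LinearMap.ker_eq_bot, LinearMap.ker_eq_bot']
    intro u hu
    by_contra h
    have h1 := hB u h
    have h2 : B u = 0 := hu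
    simp [h2] at h1
  have hd : Module.finrank ℝ E = Module.finrank ℝ (E →L[ℝ] ℝ) := by
    rw [← LinearEquiv.finrank_eq (LinearMap.toContinuousLinearMap (𝕜 := ℝ) (E := E) (F' := ℝ))]
    exact (Subspace.dual_finrank_eq (K := ℝ) (V := E)).symm
  exact ⟨(LinearEquiv.ofInjectiveOfFinrankEq (B : E →ₗ[ℝ] E →L[ℝ] ℝ) hinj hd).toContinuousLinearEquiv,
    by ext; rfl⟩

lemma contDiffOn_bilinearComp {U : Set E} {K : E → F →L[ℝ] F →L[ℝ] ℝ} {P : E → E →L[ℝ] F}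
    (hK : ContDiffOn ℝ ∞ K U) (hP : ContDiffOn ℝ ∞ P U) :
    ContDiffOn ℝ ∞ (fun y => (K y).bilinearComp (P y) (P y)) U := by
  have h2 := (ContinuousLinearMap.flipₗᵢ ℝ E F ℝ).contDiff.comp_contDiffOn (hK.clm_comp hP)
  exact (ContinuousLinearMap.flipₗᵢ ℝ E E ℝ).contDiff.comp_contDiffOn (h2.clm_comp hP)

lemma isMetricOn_of_pos [FiniteDimensional ℝ E] {U : Set E} (hU : IsOpen U)
    {K : E → F →L[ℝ] F →L[ℝ] ℝ} {P : E → E →L[ℝ] F}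
    (hK : ContDiffOn ℝ ∞ K U) (hP : ContDiffOn ℝ ∞ P U) (hs : ∀ y ∈ U, ∀ u v, K y u v = K y v u)
    (hpos : ∀ y ∈ U, ∀ u, u ≠ 0 → 0 < K y u u) (hinj : ∀ y ∈ U, Function.Injective (P y)) :
    IsMetricOn (fun y => (K y).bilinearComp (P y) (P y)) U where
  isOpen := hU
  contDiffOn := contDiffOn_bilinearComp hK hP
  symm y hy _ _ := hs y hy _ _
  inv y hy := isInvertible_of_pos fun _ hu =>
    hpos y hy _ fun h => hu (hinj y hy (h.trans (map_zero _).symm))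

/-! ### Left-invariant metrics -/

/-- The curvature tensor of the invariant connection `N` with torsion free bracket
`[a, b] = N a b - N b a`. -/
def algCurvature (N : F →L[ℝ] F →L[ℝ] F) : F →L[ℝ] F →L[ℝ] F →L[ℝ] F :=
  let C : F →L[ℝ] F →L[ℝ] F →L[ℝ] F := (ContinuousLinearMap.compL ℝ F F F).bilinearComp N N
  let D : F →L[ℝ] F →L[ℝ] F →L[ℝ] F :=
    (ContinuousLinearMap.compL ℝ F F (F →L[ℝ] F) N) ∘L (N - N.flip)
  C - C.flip - D

lemma algCurvature_apply (N : F →L[ℝ] F →L[ℝ] F) (a b c : F) :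
    algCurvature N a b c = N a (N b c) - N b (N a c) - N (N a b - N b a) c := rfl

/-- The covariant derivative of `algCurvature`. -/
def algNablaCurvature (N : F →L[ℝ] F →L[ℝ] F) (d a b c : F) : F :=
  N d (algCurvature N a b c) - algCurvature N (N d a) b c - algCurvature N a (N d b) c
    - algCurvature N a b (N d c)

/-- `A` is the Maurer-Cartan form on `U` for the bracket `N a b - N b a`, and `N` is metric
for `B`. -/
structure IsCoframe (A : E → E →L[ℝ] F) (U : Set E) (B : F →L[ℝ] F →L[ℝ] ℝ)
    (N : F →L[ℝ] F →L[ℝ] F) : Prop where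
  isOpen : IsOpen U
  contDiffOn : ContDiffOn ℝ ∞ A U
  inv : ∀ y ∈ U, (A y).IsInvertible
  symm : ∀ a b, B a b = B b a
  pos : ∀ a, a ≠ 0 → 0 < B a a
  skew : ∀ a b c, B (N a b) c + B b (N a c) = 0
  maurerCartan : ∀ y ∈ U, ∀ u v, fderiv ℝ A y u v + N (A y u) (A y v) =
    fderiv ℝ A y v u + N (A y v) (A y u)

section Coframe

variable [FiniteDimensional ℝ E] {A : E → E →L[ℝ] F} {U : Set E} {B : F →L[ℝ] F →L[ℝ] ℝ}
  {N : F →L[ℝ] F →L[ℝ] F}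

lemma IsCoframe.isMetricOn (h : IsCoframe A U B N) :
    IsMetricOn (fun y => B.bilinearComp (A y) (A y)) U :=
  isMetricOn_of_pos h.isOpen contDiffOn_const h.contDiffOn (fun _ _ => h.symm) (fun _ _ => h.pos)
    fun y hy => (h.inv y hy).injective

/-- The fibre bundle is trivial with constant metric `B` and connection form `N ∘ A`. Metricity is
the skewness of `N`; vanishing torsion is the Maurer-Cartan equation. -/
lemma IsCoframe.isSoldered (h : IsCoframe A U B N) :
    IsSoldered (fun y => B.bilinearComp (A y) (A y)) U A (fun _ => B) (fun y => N ∘L A y) where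
  metric := h.isMetricOn
  contDiffOn_P := h.contDiffOn
  contDiffOn_K := contDiffOn_const
  contDiffOn_form := contDiffOn_const.clm_comp h.contDiffOn
  inv := h.inv
  pullback _ _ _ _ := rfl
  compat y hy u a b := by simpa using (h.skew (A y u) a b).symm
  torsion y hy u v := h.maurerCartan y hy u v

/-- In the curvature of the form `N ∘ A` the derivative terms are `N` applied to the exterior
derivative of `A`; by Maurer-Cartan this is minus the bracket of `A u` and `A v`, the last term of
`algCurvature`. -/
lemma IsCoframe.curvature (h : IsCoframe A U B N) {y : E} (hy : y ∈ U) (u v w : E) :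
    A y (coordCurvature (fun y => B.bilinearComp (A y) (A y)) y u v w) =
      algCurvature N (A y u) (A y v) (A y w) := by
  have := FiniteDimensional.complete ℝ E
  rw [h.isSoldered.curvature hy, formCurvature, algCurvature_apply]
  have dA := h.isMetricOn.hasFDerivAt_of_contDiffOn h.contDiffOn hy
  have hd : ∀ u v, fderiv ℝ (fun y => N ∘L A y) y u v = N (fderiv ℝ A y u v) := by
    intro u v
    rw [((hasFDerivAt_const N y).clm_comp dA).fderiv]
    simp
  have hm : N (A y u) (A y v) - N (A y v) (A y u) = fderiv ℝ A y v u - fderiv ℝ A y u v := by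
    rw [sub_eq_sub_iff_add_eq_add, add_comm, h.maurerCartan y hy u v, add_comm]
  rw [hm, hd, hd, map_sub, sub_apply]
  simp only [ContinuousLinearMap.comp_apply]
  abel

lemma IsCoframe.nablaCurvature (h : IsCoframe A U B N) {y : E} (hy : y ∈ U) (z u v w : E) :
    A y (coordNablaCurvature (fun y => B.bilinearComp (A y) (A y)) y z u v w) =
      algNablaCurvature N (A y z) (A y u) (A y v) (A y w) := by
  have := FiniteDimensional.complete ℝ E
  rw [h.isSoldered.nablaCurvature (T := fun _ => algCurvature N) contDiffOn_const
    (fun y hy => h.curvature hy) hy]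
  simp [algNablaCurvature]

lemma IsCoframe.ricci {A : E → E →L[ℝ] E} {B : E →L[ℝ] E →L[ℝ] ℝ} {N : E →L[ℝ] E →L[ℝ] E}
    (h : IsCoframe A U B N) {y : E} (hy : y ∈ U) (v w : E) :
    coordRicci (fun y => B.bilinearComp (A y) (A y)) y v w =
      LinearMap.trace ℝ E ((algCurvature N).flip (A y v) |>.flip (A y w)) := by
  -- `A y` conjugates `u ↦ R(u, v) w` to the algebraic endomorphism, and the trace is invariant
  -- under conjugation.
  obtain ⟨e, he⟩ := h.inv y hy
  rw [coordRicci, ← LinearMap.trace_conj' _ e.toLinearEquiv]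
  congr 1
  ext u
  have h1 : ∀ x, e x = A y x := fun x => by rw [← he]; rfl
  simp only [LinearEquiv.conj_apply, LinearMap.comp_apply, LinearMap.coe_mk, AddHom.coe_mk,
    LinearEquiv.coe_coe, ContinuousLinearMap.coe_coe, ContinuousLinearMap.flip_apply]
  have h2 := h.curvature hy (e.symm u) v w
  rw [← h1 (e.symm u), e.apply_symm_apply, ← h1] at h2
  exact h2

end Coframe

/-! ### Naturality -/

/-- `s` is a local isometry from `(U, G)` to `(V, H)`. -/
structure IsLocalIsometry (s : E → F) (G : E → E →L[ℝ] E →L[ℝ] ℝ) (U : Set E)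
    (H : F → F →L[ℝ] F →L[ℝ] ℝ) (V : Set F) : Prop where
  source : IsMetricOn G U
  target : IsMetricOn H V
  mapsTo : Set.MapsTo s U V
  contDiffOn : ContDiffOn ℝ ∞ s U
  inv : ∀ y ∈ U, (fderiv ℝ s y).IsInvertible
  pullback : ∀ y ∈ U, ∀ u v, G y u v = H (s y) (fderiv ℝ s y u) (fderiv ℝ s y v)

section LocalIsometry

variable {s : E → F} {G : E → E →L[ℝ] E →L[ℝ] ℝ} {U : Set E} {H : F → F →L[ℝ] F →L[ℝ] ℝ} {V : Set F}

lemma IsLocalIsometry.hasFDerivAt (h : IsLocalIsometry s G U H V) {y : E} (hy : y ∈ U) :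
    HasFDerivAt s (fderiv ℝ s y) y :=
  h.source.hasFDerivAt_of_contDiffOn h.contDiffOn hy

lemma IsLocalIsometry.symm_fderiv (h : IsLocalIsometry s G U H V) {y : E} (hy : y ∈ U) (u v : E) :
    fderiv ℝ (fderiv ℝ s) y u v = fderiv ℝ (fderiv ℝ s) y v u :=
  ((h.contDiffOn y hy).contDiffAt (h.source.isOpen.mem_nhds hy)).isSymmSndFDerivAt
    (by simpa using ENat.LEInfty.out) u v

/-- The differential `ds` solders to the pulled-back tangent bundle of the target with its
pulled-back Levi-Civita connection. Torsion vanishes because second derivatives and Christoffel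
symbols are symmetric. -/
lemma IsLocalIsometry.isSoldered [CompleteSpace F] (h : IsLocalIsometry s G U H V) :
    IsSoldered G U (fderiv ℝ s) (fun y => H (s y))
      (fun y => christoffel H (s y) ∘L fderiv ℝ s y) where
  metric := h.source
  contDiffOn_P := h.contDiffOn.fderiv_of_isOpen h.source.isOpen (by simp)
  contDiffOn_K := h.target.contDiffOn.comp h.contDiffOn h.mapsTo
  contDiffOn_form := (h.target.contDiffOn_christoffel.comp h.contDiffOn h.mapsTo).clm_comp
    (h.contDiffOn.fderiv_of_isOpen h.source.isOpen (by simp))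
  inv := h.inv
  pullback := h.pullback
  compat y hy u a b := by
    have h1 := (h.target.hasFDerivAt_of_contDiffOn h.target.contDiffOn (h.mapsTo hy)).comp y
      (h.hasFDerivAt hy)
    have h2 : fderiv ℝ (fun y => H (s y)) y = _ := h1.fderiv
    rw [h2]
    exact h.target.christoffel_compat (h.mapsTo hy) _ a b
  torsion y hy u v := by
    rw [h.symm_fderiv hy u v]
    simp only [ContinuousLinearMap.comp_apply]
    rw [h.target.christoffel_symm (h.mapsTo hy)]

lemma IsLocalIsometry.curvature [CompleteSpace E] [CompleteSpace F]
    (h : IsLocalIsometry s G U H V) {y : E} (hy : y ∈ U) (u v w : E) :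
    fderiv ℝ s y (coordCurvature G y u v w) =
      coordCurvature H (s y) (fderiv ℝ s y u) (fderiv ℝ s y v) (fderiv ℝ s y w) := by
  have hd : ∀ u v, fderiv ℝ (fun y => christoffel H (s y) ∘L fderiv ℝ s y) y u v =
      fderiv ℝ (christoffel H) (s y) (fderiv ℝ s y u) (fderiv ℝ s y v) +
        christoffel H (s y) (fderiv ℝ (fderiv ℝ s) y u v) := by
    intro u v
    have h1 := (h.target.hasFDerivAt_of_contDiffOn h.target.contDiffOn_christoffel
      (h.mapsTo hy)).comp y (h.hasFDerivAt hy)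
    have h2 := h.source.hasFDerivAt_of_contDiffOn
      (h.contDiffOn.fderiv_of_isOpen h.source.isOpen (m := ∞) (by simp)) hy
    have h3 : fderiv ℝ (fun y => christoffel H (s y) ∘L fderiv ℝ s y) y = _ := (h1.clm_comp h2).fderiv
    rw [h3]
    simp
    abel
  rw [h.isSoldered.curvature hy, formCurvature, hd, hd, h.symm_fderiv hy u v, coordCurvature]
  simp only [ContinuousLinearMap.comp_apply, add_apply]
  abel

lemma IsLocalIsometry.nablaCurvature [CompleteSpace E] [CompleteSpace F]
    (h : IsLocalIsometry s G U H V) {y : E} (hy : y ∈ U) (z u v w : E) :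
    fderiv ℝ s y (coordNablaCurvature G y z u v w) =
      coordNablaCurvature H (s y) (fderiv ℝ s y z) (fderiv ℝ s y u) (fderiv ℝ s y v)
        (fderiv ℝ s y w) := by
  have hT := h.target.contDiffOn_curvatureCLM.comp h.contDiffOn h.mapsTo
  have dR := h.target.hasFDerivAt_of_contDiffOn h.target.contDiffOn_curvatureCLM (h.mapsTo hy)
  rw [h.isSoldered.nablaCurvature hT (fun y hy => h.curvature hy) hy,
    (dR.comp y (h.hasFDerivAt hy)).fderiv]
  have e : ∀ u v w, fderiv ℝ (fun x => coordCurvature H x u v w) (s y) (fderiv ℝ s y z) =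
      fderiv ℝ (curvatureCLM H) (s y) (fderiv ℝ s y z) u v w := by
    intro u v w
    have := ((dR.clm_apply (hasFDerivAt_const u (s y))).clm_apply
      (hasFDerivAt_const v (s y))).clm_apply (hasFDerivAt_const w (s y))
    simp only [curvatureCLM_apply] at this
    rw [this.fderiv]; simp
  rw [coordNablaCurvature, e]
  simp only [ContinuousLinearMap.comp_apply, Function.comp_apply, curvatureCLM_apply]

end LocalIsometry

lemma isMetricOn_const [FiniteDimensional ℝ E] {B : E →L[ℝ] E →L[ℝ] ℝ} (hs : ∀ u v, B u v = B v u)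
    (hB : ∀ u, u ≠ 0 → 0 < B u u) : IsMetricOn (fun _ : E => B) Set.univ where
  isOpen := isOpen_univ
  contDiffOn := contDiffOn_const
  symm _ _ := hs
  inv _ _ := isInvertible_of_pos hB

lemma coordCurvature_const (B : E →L[ℝ] E →L[ℝ] ℝ) (y u v w : E) :
    coordCurvature (fun _ : E => B) y u v w = 0 := by
  have h : christoffel (fun _ : E => B) = fun _ => 0 := by
    ext y u v
    rw [christoffel_apply]
    simp
  simp [coordCurvature, h]

/-! ### Conformal changes -/

/-- On pairwise orthogonal vectors only the Weyl part of the curvature is visible, and that part is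
conformally invariant. Concretely, the terms that `f` adds to `R(u, v) w` are multiples of `u`, `v`,
`w`, or carry a scalar product of two of these vectors as factor, or cancel; nothing remains after
pairing with `z`. -/
lemma IsMetricOn.conformal_orthogonal [CompleteSpace E] {G : E → E →L[ℝ] E →L[ℝ] ℝ} {U : Set E}
    (h : IsMetricOn G U) {f : E → ℝ} (hf : ContDiffOn ℝ ∞ f U) {y : E} (hy : y ∈ U) {u v w z : E}
    (h0 : coordCurvature (fun y => Real.exp (2 * f y) • G y) y u v w = 0)
    (huv : G y u v = 0) (huw : G y u w = 0) (huz : G y u z = 0) (hvw : G y v w = 0)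
    (hvz : G y v z = 0) (hwz : G y w z = 0) : G y (coordCurvature G y u v w) z = 0 := by
  -- The gradient of `f` with respect to `G`.
  set ξ : E → E := fun y => (G y).inverse (fderiv ℝ f y)
  have hdf : ContDiffOn ℝ ∞ (fderiv ℝ f) U := hf.fderiv_of_isOpen h.isOpen (by simp)
  have hξ : ContDiffOn ℝ ∞ ξ U := by
    refine ContDiffOn.clm_apply (fun y hy => ?_) hdf
    exact ((h.inv y hy).contDiffAt_map_inverse.comp y (h.contDiffAt hy)).contDiffWithinAt
  have hGξ : ∀ y ∈ U, ∀ v, G y v (ξ y) = fderiv ℝ f y v := fun y hy v => by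
    rw [h.symm y hy, (h.inv y hy).self_apply_inverse]
  have hG' : IsMetricOn (fun y => Real.exp (2 * f y) • G y) U := by
    refine ⟨h.isOpen, ((contDiffOn_const.mul hf).exp).smul h.contDiffOn, fun y hy u v => ?_,
      fun y hy => ?_⟩
    · simp [h.symm y hy u v]
    · obtain ⟨e, he⟩ := h.inv y hy
      refine ⟨e.trans (ContinuousLinearEquiv.smulLeft (Units.mk0 _ (Real.exp_ne_zero (2 * f y)))), ?_⟩
      ext; simp [← he]
  -- The classical formula for the Levi-Civita connection of `e^{2f} G`, confirmed by uniqueness.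
  have key : ∀ y ∈ U, ∀ u v, christoffel (fun y => Real.exp (2 * f y) • G y) y u v =
      christoffel G y u v + fderiv ℝ f y u • v + fderiv ℝ f y v • u - G y u v • ξ y := by
    intro y hy
    refine christoffel_eq (hG'.inv y hy) (hG'.symm y hy) (fun u v => ?_) fun u v w => ?_
    · rw [h.christoffel_symm hy u v, h.symm y hy u v]; abel
    · have d1 := ((h.hasFDerivAt_of_contDiffOn hf hy).const_mul 2).exp.smul
        (h.hasFDerivAt_of_contDiffOn h.contDiffOn hy)
      have d2 : fderiv ℝ (fun y => Real.exp (2 * f y) • G y) y = _ := d1.fderiv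
      rw [d2]
      have e1 := hGξ y hy
      have e2 := h.symm y hy (ξ y)
      simp only [add_apply, smul_apply, ContinuousLinearMap.smulRight_apply, smul_eq_mul,
        map_add, map_sub, map_smul, sub_apply, h.christoffel_compat hy, e1, e2]
      rw [h.symm y hy u v]
      ring
  have dΓ := h.hasFDerivAt_of_contDiffOn h.contDiffOn_christoffel hy
  have dΓ' := h.hasFDerivAt_of_contDiffOn hG'.contDiffOn_christoffel hy
  have dG := h.hasFDerivAt_of_contDiffOn h.contDiffOn hy
  have ddf := h.hasFDerivAt_of_contDiffOn hdf hy
  have dξ := h.hasFDerivAt_of_contDiffOn hξ hy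
  have dkey : ∀ u v, fderiv ℝ (christoffel (fun y => Real.exp (2 * f y) • G y)) y u v w =
      fderiv ℝ (christoffel G) y u v w + fderiv ℝ (fderiv ℝ f) y u v • w +
        fderiv ℝ (fderiv ℝ f) y u w • v - fderiv ℝ G y u v w • ξ y
        - G y v w • fderiv ℝ ξ y u := by
    intro u v
    have cv := hasFDerivAt_const (𝕜 := ℝ) v y
    have cw := hasFDerivAt_const (𝕜 := ℝ) w y
    have h1 := (dΓ'.clm_apply cv).clm_apply cw
    have h2 := ((((dΓ.clm_apply cv).clm_apply cw).add ((ddf.clm_apply cv).smul cw)).add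
      ((ddf.clm_apply cw).smul cv)).sub (((dG.clm_apply cv).clm_apply cw).smul dξ)
    have h3 := h2.congr_of_eventuallyEq
      (f₁ := fun x => christoffel (fun y => Real.exp (2 * f y) • G y) x v w)
      (by filter_upwards [h.isOpen.mem_nhds hy] with x hx using key x hx v w)
    have h4 := congrArg (fun L : E →L[ℝ] E => L u) (h1.unique h3)
    simp at h4
    rw [h4]
    abel
  have h5 := congrArg (fun x => G y x z) h0
  have e1 := h.symm y hy (ξ y)
  -- The scalar product `G(v, w)` vanishes at `y`, but its derivative along `u` need not.
  -- Compatibility rewrites such derivatives with Christoffel symbols, which cancel against the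
  -- products of the two connections.
  have c1 := h.christoffel_compat hy u v w
  have c2 := h.christoffel_compat hy v u w
  rw [h.christoffel_symm hy v u] at c2
  have s1 := h.symm y hy v u
  have s2 := h.symm y hy (christoffel G y v w) u
  simp only [coordCurvature, dkey, key y hy, map_add, map_sub, map_smul, add_apply, sub_apply,
    smul_apply, smul_eq_mul, hGξ y hy, huv, huw, huz, hvw, hvz, hwz, e1, map_zero, zero_apply,
    s1, zero_smul, c1, c2] at h5
  rw [h.christoffel_symm hy v u] at h5
  simp only [coordCurvature, map_add, map_sub, add_apply, sub_apply]
  linear_combination h5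

end Calculus

end RiemGeom

/-! ### Point symmetries, and the passage from open submanifolds to coordinates. -/

namespace RiemGeom

open scoped Topology

set_option maxSynthPendingDepth 10

/-! ### Symmetries at a point -/

section Symmetric

variable {E : Type*} [NormedAddCommGroup E] [NormedSpace ℝ E] {H : Type*} [TopologicalSpace H]
  {I : ModelWithCorners ℝ E H} {M : Type*} [TopologicalSpace M] [ChartedSpace H M]
  {F : Type*} [NormedAddCommGroup F] [NormedSpace ℝ F] {K : Type*} [TopologicalSpace K]
  {J : ModelWithCorners ℝ F K} {N : Type*} [TopologicalSpace N] [ChartedSpace K N]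

/-- There is an isometry that fixes `p` and whose differential at `p` is `-id`. -/
def IsSymmetricAt (g : MetricField I M) (p : M) : Prop :=
  ∃ s : M ≃ₘ^∞⟮I, I⟯ M,
    (∀ (x : M) (u v : TangentSpace I x),
      g (s x) (mfderiv I I s x u) (mfderiv I I s x v) = g x u v) ∧
    s p = p ∧ ∀ v : E, (mfderiv I I s p : E →L[ℝ] E) v = -v

/-- The symmetry `σ` at `φ p` is conjugated by `φ`; the constant factor `c` cancels in the isometry
condition. -/
lemma IsSymmetricAt.of_homothety {g : MetricField I M} {h : MetricField J N} {c : ℝ} (hc : c ≠ 0)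
    (φ : M ≃ₘ^∞⟮I, J⟯ N) (hφ : ∀ (x : M) (u v : TangentSpace I x),
      h (φ x) (mfderiv I J φ x u) (mfderiv I J φ x v) = c * g x u v) {p : M}
    (hs : IsSymmetricAt h (φ p)) : IsSymmetricAt g p := by
  obtain ⟨σ, hσ, hp, hd⟩ := hs
  set s : M ≃ₘ^∞⟮I, I⟯ M := (φ.trans σ).trans φ.symm with hsdef
  have hsx : ∀ x, φ (s x) = σ (φ x) := fun x => by simp [hsdef]
  have hsp : s p = p := by simp [hsdef, hp]
  have d1 : ∀ x, MDifferentiableAt I J φ x := φ.mdifferentiable (by simp)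
  have d2 : ∀ x, MDifferentiableAt I I s x := s.mdifferentiable (by simp)
  have d3 : ∀ x, MDifferentiableAt J J σ x := σ.mdifferentiable (by simp)
  -- Differentials and metrics are recorded with values in the fixed spaces `E` and `F`, so that
  -- equal base points can be exchanged without disturbing the types of tangent vectors.
  obtain ⟨dφ, hdφ⟩ : ∃ dφ : M → E →L[ℝ] F, dφ = fun x => mfderiv I J φ x := ⟨_, rfl⟩
  obtain ⟨ds, hds⟩ : ∃ ds : M → E →L[ℝ] E, ds = fun x => mfderiv I I s x := ⟨_, rfl⟩
  obtain ⟨dσ, hdσ⟩ : ∃ dσ : N → F →L[ℝ] F, dσ = fun x => mfderiv J J σ x := ⟨_, rfl⟩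
  obtain ⟨h', hh'⟩ : ∃ h' : N → F →L[ℝ] F →L[ℝ] ℝ, h' = h := ⟨_, rfl⟩
  obtain ⟨g', hg'⟩ : ∃ g' : M → E →L[ℝ] E →L[ℝ] ℝ, g' = g := ⟨_, rfl⟩
  have hφ' : ∀ x u v, h' (φ x) (dφ x u) (dφ x v) = c * g' x u v := by
    rw [hdφ, hh', hg']; exact hφ
  have hσ' : ∀ x u v, h' (σ x) (dσ x u) (dσ x v) = h' x u v := by
    rw [hdσ, hh']; exact hσ
  have hd' : ∀ v, dσ (φ p) v = -v := by rw [hdσ]; exact hd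
  have key : ∀ x : M, ∀ u : E, dφ (s x) (ds x u) = dσ (φ x) (dφ x u) := by
    intro x u
    have h1 := mfderiv_comp x (d1 (s x)) (d2 x)
    have h2 := mfderiv_comp x (d3 (φ x)) (d1 x)
    have h3 : (φ ∘ s : M → N) = σ ∘ φ := funext hsx
    rw [h3] at h1
    rw [hdφ, hds, hdσ]
    exact congrArg (fun L : E →L[ℝ] F => L u) (h1.symm.trans h2)
  have hinj : Function.Injective (dφ p) := by
    rw [hdφ]
    exact (φ.mfderivToContinuousLinearEquiv (by simp) p).injective
  have r1 : ∀ x u v, g' (s x) (ds x u) (ds x v) = g' x u v := by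
    intro x u v
    apply mul_left_cancel₀ hc
    rw [← hφ', key, key, hsx, hσ', hφ']
  have r2 : ∀ v, ds p v = -v := by
    intro v
    have h1 := key p v
    rw [hd', hsp, ← map_neg] at h1
    exact hinj h1
  rw [hds, hg'] at r1
  rw [hds] at r2
  exact ⟨s, r1, hsp, r2⟩

lemma IsSymmetricAt.prod {g : MetricField I M} {h : MetricField J N} {p : M} {q : N}
    (hg : IsSymmetricAt g p) (hh : IsSymmetricAt h q) :
    IsSymmetricAt (prodMetric g h) (p, q) := by
  obtain ⟨s, hs, hp, hd⟩ := hg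
  obtain ⟨t, ht, hq, he⟩ := hh
  have dst : ∀ x : M × N, mfderiv (I.prod J) (I.prod J) (s.prodCongr t) x =
      (mfderiv I I s x.1).prodMap (mfderiv J J t x.2) := fun x =>
    mfderiv_prodMap (s.mdifferentiable (by simp) x.1) (t.mdifferentiable (by simp) x.2)
  refine ⟨s.prodCongr t, fun x u v => ?_, ?_, fun v => ?_⟩
  · rw [dst]
    exact congrArg₂ (· + ·) (hs x.1 (u : E × F).1 (v : E × F).1) (ht x.2 (u : E × F).2 (v : E × F).2)
  · exact Prod.ext hp hq
  · rw [dst]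
    exact Prod.ext (hd v.1) (he v.2)

end Symmetric

section LeftInvariant

variable {E : Type*} [NormedAddCommGroup E] [NormedSpace ℝ E] {M : Type*} [TopologicalSpace M]
  [ChartedSpace E M] [Group M] [LieGroup 𝓘(ℝ, E) ∞ M]

/-- Left translation as a diffeomorphism. -/
def leftTranslation (a : M) : M ≃ₘ^∞⟮𝓘(ℝ, E), 𝓘(ℝ, E)⟯ M where
  toEquiv := Equiv.mulLeft a
  contMDiff_toFun := contMDiff_mul_left
  contMDiff_invFun := contMDiff_mul_left

lemma leftInvariantMetric_leftTranslation (B : E →L[ℝ] E →L[ℝ] ℝ) (a x : M)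
    (u v : TangentSpace 𝓘(ℝ, E) x) :
    leftInvariantMetric B (leftTranslation (E := E) a x)
      (mfderiv 𝓘(ℝ, E) 𝓘(ℝ, E) (leftTranslation (E := E) a) x u)
      (mfderiv 𝓘(ℝ, E) 𝓘(ℝ, E) (leftTranslation (E := E) a) x v) = leftInvariantMetric B x u v := by
  have key : ∀ u : E, (mfderiv 𝓘(ℝ, E) 𝓘(ℝ, E) (fun y : M => (a * x)⁻¹ * y) (a * x) : E →L[ℝ] E)
      ((mfderiv 𝓘(ℝ, E) 𝓘(ℝ, E) (leftTranslation (E := E) a) x : E →L[ℝ] E) u) =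
      (mfderiv 𝓘(ℝ, E) 𝓘(ℝ, E) (fun y : M => x⁻¹ * y) x : E →L[ℝ] E) u := by
    intro u
    have h1 := mfderiv_comp (I := 𝓘(ℝ, E)) (I' := 𝓘(ℝ, E)) (I'' := 𝓘(ℝ, E)) x
      (g := fun y : M => (a * x)⁻¹ * y) (f := leftTranslation (E := E) a)
      (((leftTranslation (E := E) (a * x)⁻¹).mdifferentiable (by simp)) _)
      (((leftTranslation (E := E) a).mdifferentiable (by simp)) _)
    have h2 : ((fun y : M => (a * x)⁻¹ * y) ∘ leftTranslation (E := E) a) = fun y : M => x⁻¹ * y := by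
      ext y
      change (a * x)⁻¹ * (a * y) = _
      group
    rw [h2] at h1
    exact (congrArg (fun L : E →L[ℝ] E => L u) h1).symm
  exact congrArg₂ (fun a b : E => B a b) (key u) (key v)

/-- Left translations are isometries, so a symmetry at `1` is conjugate to one at every other point.
-/
lemma isRiemannianSymmetric_of_one {B : E →L[ℝ] E →L[ℝ] ℝ}
    (h : IsSymmetricAt (I := 𝓘(ℝ, E)) (leftInvariantMetric B) (1 : M)) :
    IsRiemannianSymmetric (M := M) (leftInvariantMetric B) := by
  intro p
  refine IsSymmetricAt.of_homothety one_ne_zero (leftTranslation p⁻¹) (fun x u v => ?_)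
    (p := p) (h := leftInvariantMetric B) ?_
  · rw [leftInvariantMetric_leftTranslation, one_mul]
  · have : leftTranslation (E := E) p⁻¹ p = 1 := inv_mul_cancel p
    rwa [this]

end LeftInvariant

/-! ### Open subsets of vector spaces -/

section OpensMetric

variable {E : Type*} [NormedAddCommGroup E] [NormedSpace ℝ E] {U : Opens E}
  {g : MetricField 𝓘(ℝ, E) U} {G : E → E →L[ℝ] E →L[ℝ] ℝ}

/-- The metric `g` on the open set `U` is the restriction of the field `G` of bilinear forms. -/
def IsRestriction (g : MetricField 𝓘(ℝ, E) U) (G : E → E →L[ℝ] E →L[ℝ] ℝ) : Prop :=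
  ∀ (x : U) (u v : E), (show E →L[ℝ] E →L[ℝ] ℝ from g x) u v = G x u v

lemma IsRestriction.eq (hg : IsRestriction g G) (x : U) :
    (show E →L[ℝ] E →L[ℝ] ℝ from g x) = G x := by
  ext u v; exact hg x u v

/-- The preferred chart of an open subset is the inclusion. Equality holds only near `p`, which
suffices because the curvature tensors depend on the germ of the metric. -/
lemma IsRestriction.chartMetric (hg : IsRestriction g G) (p : U) :
    chartMetric g p =ᶠ[𝓝 (p : E)] G := by
  filter_upwards [U.isOpen.mem_nhds p.2] with y hy
  have h1 := (hasMFDerivAt_opens_symm p hy).mfderiv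
  have h3 : RiemGeom.chartMetric g p y =
      (show E →L[ℝ] E →L[ℝ] ℝ from g ((extChartAt 𝓘(ℝ, E) p).symm y)).bilinearComp
        (.id ℝ E) (.id ℝ E) := by
    rw [← h1]; rfl
  rw [h3, extChartAt_opens_symm p hy, hg.eq]
  rfl

lemma extChartAt_opens_self (p : U) : extChartAt 𝓘(ℝ, E) p p = (p : E) := by
  rw [extChartAt_opens_coe]

lemma IsRestriction.curvatureAt (hg : IsRestriction g G) (p : U) (u v w : E) :
    curvatureAt g p u v w = coordCurvature G p u v w := by
  change coordCurvature (RiemGeom.chartMetric g p) (extChartAt 𝓘(ℝ, E) p p) u v w = _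
  rw [extChartAt_opens_self, coordCurvature_congr (hg.chartMetric p)]

lemma IsRestriction.ricciAt (hg : IsRestriction g G) (p : U) (v w : E) :
    ricciAt g p v w = coordRicci G p v w := by
  change coordRicci (RiemGeom.chartMetric g p) (extChartAt 𝓘(ℝ, E) p p) v w = _
  rw [extChartAt_opens_self, coordRicci_congr (hg.chartMetric p)]

lemma IsRestriction.nablaCurvatureAt (hg : IsRestriction g G) (p : U) (z u v w : E) :
    nablaCurvatureAt g p z u v w = coordNablaCurvature G p z u v w := by
  change coordNablaCurvature (RiemGeom.chartMetric g p) (extChartAt 𝓘(ℝ, E) p p) z u v w = _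
  rw [extChartAt_opens_self, coordNablaCurvature_congr (hg.chartMetric p)]

lemma IsRestriction.conformal (hg : IsRestriction g G) {f : U → ℝ} {f' : E → ℝ}
    (hf : ∀ x : U, f' x = f x) : IsRestriction (fun x => Real.exp (2 * f x) • g x)
      (fun y => Real.exp (2 * f' y) • G y) := by
  intro x u v
  change Real.exp (2 * f x) * (show E →L[ℝ] E →L[ℝ] ℝ from g x) u v = Real.exp (2 * f' x) * G x u v
  rw [hf, hg]

lemma contDiffOn_opens_symm {F : Type*} [NormedAddCommGroup F] [NormedSpace ℝ F] {f : U → F}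
    (p : U) {V : Set U} (hf : ContMDiffOn 𝓘(ℝ, E) 𝓘(ℝ, F) ∞ f V) :
    ContDiffOn ℝ ∞ (fun y => f ((extChartAt 𝓘(ℝ, E) p).symm y)) (Subtype.val '' V) := by
  rw [← contMDiffOn_iff_contDiffOn]
  have h1 := contMDiffOn_extChartAt_symm (I := 𝓘(ℝ, E)) (n := ∞) p
  rw [extChartAt_opens_target] at h1
  refine hf.comp (h1.mono ?_) ?_
  · rintro _ ⟨x, _, rfl⟩; exact x.2
  · rintro _ ⟨x, hx, rfl⟩
    rw [Set.mem_preimage, extChartAt_opens_symm p x.2]; exact hx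

lemma IsConformallyFlat.orthogonal [CompleteSpace E] (h : IsConformallyFlat g)
    (hg : IsRestriction g G) (hG : IsMetricOn G U) (p : U) {u v w z : E}
    (huv : G p u v = 0) (huw : G p u w = 0) (huz : G p u z = 0) (hvw : G p v w = 0)
    (hvz : G p v z = 0) (hwz : G p w z = 0) : G p (coordCurvature G p u v w) z = 0 := by
  obtain ⟨V, f, hV, hp, hf, hR⟩ := h p
  have hVo : IsOpen (Subtype.val '' V : Set E) := U.isOpen.isOpenMap_subtype_val V hV
  have hsub : (Subtype.val '' V : Set E) ⊆ U := by rintro _ ⟨x, _, rfl⟩; exact x.2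
  -- The conformal factor is smooth on `V` only, so the metric is restricted to `V`.
  have hG' : IsMetricOn G (Subtype.val '' V) := ⟨hVo, hG.contDiffOn.mono hsub,
    fun y hy => hG.symm y (hsub hy), fun y hy => hG.inv y (hsub hy)⟩
  refine hG'.conformal_orthogonal (contDiffOn_opens_symm p hf) ⟨p, hp, rfl⟩ ?_ huv huw huz hvw hvz hwz
  have h2 := hg.conformal (f := f) (f' := fun y => f ((extChartAt 𝓘(ℝ, E) p).symm y))
    (fun x => by rw [extChartAt_opens_symm p x.2])
  exact (h2.curvatureAt p u v w).symm.trans (hR p hp u v w)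

lemma IsRestriction.isConformallyFlat {F : Type*} [NormedAddCommGroup F] [NormedSpace ℝ F]
    [CompleteSpace E] [CompleteSpace F] (hg : IsRestriction g G) {f : E → ℝ}
    (hf : ContDiffOn ℝ ∞ f U) {s : E → F} {B : F →L[ℝ] F →L[ℝ] ℝ}
    (hs : IsLocalIsometry s (fun y => Real.exp (2 * f y) • G y) U (fun _ => B) Set.univ) :
    IsConformallyFlat g := by
  intro p
  refine ⟨Set.univ, fun x => f x, isOpen_univ, trivial, ?_, fun q _ u v w => ?_⟩
  · rw [contMDiffOn_univ]
    intro x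
    have h1 := ((hf x x.2).contDiffAt (U.isOpen.mem_nhds x.2)).contMDiffAt
    exact h1.comp x contMDiff_subtype_val.contMDiffAt
  · refine ((hg.conformal (f := fun x => f x) (fun _ => rfl)).curvatureAt q u v w).trans ?_
    have h1 := hs.curvature q.2 u v w
    rw [coordCurvature_const] at h1
    exact (hs.inv q q.2).injective (h1.trans (map_zero _).symm)

/-- Parity: by naturality, the differential `-id` multiplies the value of `∇R` by `-1`, while the
signs of its four arguments cancel. -/
lemma IsSymmetricAt.nablaCurvatureAt_eq_zero [FiniteDimensional ℝ E] {p : U}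
    (h : IsSymmetricAt g p) (hg : IsRestriction g G) (hG : IsMetricOn G U)
    (z u v w : E) : nablaCurvatureAt g p z u v w = 0 := by
  have := FiniteDimensional.complete ℝ E
  obtain ⟨s, hs, hp, hd⟩ := h
  set s' : E → E := fun y => (s ((extChartAt 𝓘(ℝ, E) p).symm y) : E)
  have hsx : ∀ x : U, (s x : E) = s' x := fun x => by simp only [s', extChartAt_opens_symm p x.2]
  have hs' : ContDiffOn ℝ ∞ s' U := by
    have h1 : ContMDiff 𝓘(ℝ, E) 𝓘(ℝ, E) ∞ (fun x : U => (s x : E)) :=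
      contMDiff_subtype_val.comp s.contMDiff
    have h2 := contDiffOn_opens_symm p h1.contMDiffOn (V := Set.univ)
    rwa [Set.image_univ, Subtype.range_coe] at h2
  have hds : ∀ x : U, (mfderiv 𝓘(ℝ, E) 𝓘(ℝ, E) s x : E →L[ℝ] E) = fderiv ℝ s' x := fun x =>
    (hasMFDerivAt_opens (f := s) x hsx (hG.hasFDerivAt_of_contDiffOn hs' x.2)).mfderiv
  have hpull : ∀ y ∈ (U : Set E), ∀ u v, G y u v = G (s' y) (fderiv ℝ s' y u) (fderiv ℝ s' y v) := by
    intro y hy u v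
    have h1 := hs ⟨y, hy⟩ u v
    rw [← hsx ⟨y, hy⟩, ← hds ⟨y, hy⟩]
    exact ((hg ⟨y, hy⟩ u v).symm.trans h1.symm).trans (hg _ _ _)
  have hiso : IsLocalIsometry s' G U G U := by
    refine ⟨hG, hG, fun y hy => ?_, hs', fun y hy => ?_, hpull⟩
    · rw [← hsx ⟨y, hy⟩]; exact (s ⟨y, hy⟩).2
    -- A vector killed by the differential lies in the kernel of `G`, by the pullback identity.
    · have hinj : Function.Injective (fderiv ℝ s' y : E →ₗ[ℝ] E) := by
        rw [← LinearMap.ker_eq_bot, LinearMap.ker_eq_bot']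
        intro u hu
        apply (hG.inv y hy).injective
        ext v
        have hu' : fderiv ℝ s' y u = 0 := hu
        rw [hpull y hy, hu']
        simp
      exact ⟨(LinearEquiv.ofInjectiveEndo _ hinj).toContinuousLinearEquiv, by ext; rfl⟩
  have h1 := hiso.nablaCurvature p.2 z u v w
  have hneg : ∀ v, fderiv ℝ s' p v = -v := fun v => by rw [← hds p]; exact hd v
  have hsp : s' p = p := by rw [← hsx p, hp]
  rw [hsp] at h1
  simp only [hneg] at h1
  have h2 : coordNablaCurvature G p (-z) (-u) (-v) (-w) = coordNablaCurvature G p z u v w := by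
    have dR := hG.hasFDerivAt_of_contDiffOn hG.contDiffOn_curvatureCLM p.2
    have e : ∀ u v w z, fderiv ℝ (fun x => coordCurvature G x u v w) p z =
        fderiv ℝ (curvatureCLM G) p z u v w := by
      intro u v w z
      have h3 := ((dR.clm_apply (hasFDerivAt_const u (p : E))).clm_apply
        (hasFDerivAt_const v (p : E))).clm_apply (hasFDerivAt_const w (p : E))
      simp only [curvatureCLM_apply] at h3
      rw [h3.fderiv]; simp
    simp only [coordNablaCurvature, e]
    simp only [← curvatureCLM_apply, map_neg, neg_apply, neg_neg]
  rw [h2, neg_eq_iff_add_eq_zero, ← two_smul ℝ, smul_eq_zero] at h1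
  exact (hg.nablaCurvatureAt p z u v w).trans (h1.resolve_left two_ne_zero)

end OpensMetric

end RiemGeom

/-! ### The Levi-Civita connection and the Maurer-Cartan form of the models. -/

namespace RiemGeom

lemma isInvertible_of_injective {E : Type*} [NormedAddCommGroup E] [NormedSpace ℝ E]
    [FiniteDimensional ℝ E] {L : E →L[ℝ] E} (h : Function.Injective L) : L.IsInvertible :=
  ⟨(LinearEquiv.ofInjectiveEndo (L : E →ₗ[ℝ] E) h).toContinuousLinearEquiv, by ext; rfl⟩

end RiemGeom

namespace Submax

open RiemGeom
open scoped Topology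

variable {m : ℕ}

lemma modelForm_apply (c₁ c₂ : ℝ) (x y : ModelSpace m) :
    modelForm m c₁ c₂ x y = c₁ * (x.1.re * y.1.re + x.1.imI * y.1.imI + x.1.imJ * y.1.imJ
      + x.1.imK * y.1.imK) + c₂ * quatForm m x.2 y.2 := by
  change c₁ * inner ℝ x.1 y.1 + c₂ * quatForm m x.2 y.2 = _
  rw [Quaternion.inner_def]
  simp

lemma quatForm_comm (p q : Fin m → ℍ) : quatForm m p q = quatForm m q p := by
  simp only [quatForm_apply]
  exact Finset.sum_congr rfl fun _ _ => by ring

lemma quatForm_self (p : Fin m → ℍ) : quatForm m p p = ∑ l, ‖p l‖ ^ 2 := by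
  rw [quatForm_apply]
  refine Finset.sum_congr rfl fun l _ => ?_
  have h : Quaternion.normSq (p l) = ‖p l‖ * ‖p l‖ := Quaternion.normSq_eq_norm_mul_self (p l)
  rw [pow_two, ← h, Quaternion.normSq_def']
  ring

lemma quatForm_self_nonneg (p : Fin m → ℍ) : 0 ≤ quatForm m p p := by
  rw [quatForm_self]
  positivity

lemma quatForm_self_eq_zero {p : Fin m → ℍ} : quatForm m p p = 0 ↔ p = 0 := by
  rw [quatForm_self, Finset.sum_eq_zero_iff_of_nonneg fun _ _ => by positivity]
  simp [funext_iff]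

lemma modelForm_comm (c₁ c₂ : ℝ) (x y : ModelSpace m) :
    modelForm m c₁ c₂ x y = modelForm m c₁ c₂ y x := by
  rw [modelForm_apply, modelForm_apply, quatForm_comm]; ring

lemma modelForm_pos {c₁ c₂ : ℝ} (hc₁ : 0 < c₁) (hc₂ : 0 < c₂) (x : ModelSpace m) (hx : x ≠ 0) :
    0 < modelForm m c₁ c₂ x x := by
  rw [modelForm_apply]
  have h2 := quatForm_self_nonneg x.2
  have e : x.1.re * x.1.re + x.1.imI * x.1.imI + x.1.imJ * x.1.imJ + x.1.imK * x.1.imK =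
      Quaternion.normSq x.1 := by rw [Quaternion.normSq_def']; ring
  rw [e]
  have h1 : 0 ≤ Quaternion.normSq x.1 := Quaternion.normSq_nonneg
  by_cases h : x.2 = 0
  · have h3 : x.1 ≠ 0 := fun h' => hx (Prod.ext h' h)
    have h4 : 0 < Quaternion.normSq x.1 := lt_of_le_of_ne h1 (Ne.symm (by simpa using h3))
    positivity
  · have h4 : 0 < quatForm m x.2 x.2 :=
      lt_of_le_of_ne h2 fun h' => h (quatForm_self_eq_zero.1 h'.symm)
    positivity

/-! ### The Levi-Civita connection on left-invariant fields -/

/-- A bilinear map on the model space, as continuous bilinear map. -/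
def bilin (f : ModelSpace m →ₗ[ℝ] ModelSpace m →ₗ[ℝ] ModelSpace m) :
    ModelSpace m →L[ℝ] ModelSpace m →L[ℝ] ModelSpace m :=
  LinearMap.toContinuousLinearMap ((LinearMap.toContinuousLinearMap (𝕜 := ℝ) (E := ModelSpace m)
    (F' := ModelSpace m)).toLinearMap ∘ₗ f)

/-- The quaternion with the given components. -/
def quat (a b c d : ℝ) : ℍ := ⟨a, b, c, d⟩

@[simp] lemma quat_re (a b c d : ℝ) : (quat a b c d).re = a := rfl
@[simp] lemma quat_imI (a b c d : ℝ) : (quat a b c d).imI = b := rfl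
@[simp] lemma quat_imJ (a b c d : ℝ) : (quat a b c d).imJ = c := rfl
@[simp] lemma quat_imK (a b c d : ℝ) : (quat a b c d).imK = d := rfl

/-- The formula for the Levi-Civita connection of `modelForm m c₁ c₂` on left-invariant fields. -/
def connFun (P : BracketParams) (c₁ c₂ : ℝ) (x y : ModelSpace m) : ModelSpace m :=
  (quat (P.β₁ * (x.1.imI * y.1.imI + x.1.imJ * y.1.imJ + x.1.imK * y.1.imK)
      + P.β₂ * (c₂ / c₁) * quatForm m x.2 y.2)
    (-(P.β₁ * y.1.re * x.1.imI) + P.α / 2 * quatForm m (fun l => x.2 l * qi) y.2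
      + P.γ₁ * (x.1.imJ * y.1.imK - x.1.imK * y.1.imJ))
    (-(P.β₁ * y.1.re * x.1.imJ) + P.α / 2 * quatForm m (fun l => x.2 l * qj) y.2
      + P.γ₁ * (x.1.imK * y.1.imI - x.1.imI * y.1.imK))
    (-(P.β₁ * y.1.re * x.1.imK) + P.α / 2 * quatForm m (fun l => x.2 l * qk) y.2
      + P.γ₁ * (x.1.imI * y.1.imJ - x.1.imJ * y.1.imI)),
    fun l => -((P.β₂ * y.1.re) • x.2 l)
      - (P.α * c₁ / (2 * c₂)) • (y.2 l * x.1.im + x.2 l * y.1.im))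

lemma quatForm_mul_add (p p' q : Fin m → ℍ) (a : ℍ) : quatForm m (fun l => (p + p') l * a) q =
    quatForm m (fun l => p l * a) q + quatForm m (fun l => p' l * a) q := by
  have h : (fun l => (p + p') l * a) = (fun l => p l * a) + fun l => p' l * a := by
    ext1 l; simp [add_mul]
  rw [h, map_add]; rfl

lemma quatForm_mul_smul (c : ℝ) (p q : Fin m → ℍ) (a : ℍ) : quatForm m (fun l => (c • p) l * a) q =
    c * quatForm m (fun l => p l * a) q := by
  have h : (fun l => (c • p) l * a) = c • (fun l => p l * a) := by
    ext1 l; simp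
  rw [h, map_smul]; rfl

section ConnFun

variable (P : BracketParams) (c₁ c₂ : ℝ)

lemma connFun_add_left (x x' y : ModelSpace m) :
    connFun P c₁ c₂ (x + x') y = connFun P c₁ c₂ x y + connFun P c₁ c₂ x' y := by
  refine Prod.ext ?_ (funext fun l => ?_)
  · ext <;> simp [connFun, quatForm_mul_add, -Pi.add_apply] <;> ring
  · simp only [connFun, Prod.fst_add, Prod.snd_add, Pi.add_apply, Quaternion.im_add, mul_add, add_mul,
      smul_add]
    abel

lemma connFun_smul_left (c : ℝ) (x y : ModelSpace m) :
    connFun P c₁ c₂ (c • x) y = c • connFun P c₁ c₂ x y := by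
  refine Prod.ext ?_ (funext fun l => ?_)
  · ext <;> simp [connFun, quatForm_mul_smul, -Pi.smul_apply] <;> ring
  · simp only [connFun, Prod.smul_fst, Prod.smul_snd, Pi.smul_apply, Quaternion.im_smul,
      mul_smul_comm, smul_mul_assoc]
    module

lemma connFun_add_right (x y y' : ModelSpace m) :
    connFun P c₁ c₂ x (y + y') = connFun P c₁ c₂ x y + connFun P c₁ c₂ x y' := by
  refine Prod.ext ?_ (funext fun l => ?_)
  · ext <;> simp [connFun] <;> ring
  · simp only [connFun, Prod.fst_add, Prod.snd_add, Pi.add_apply, Quaternion.im_add, mul_add, add_mul,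
      smul_add, Quaternion.re_add, add_smul]
    abel

lemma connFun_smul_right (c : ℝ) (x y : ModelSpace m) :
    connFun P c₁ c₂ x (c • y) = c • connFun P c₁ c₂ x y := by
  refine Prod.ext ?_ (funext fun l => ?_)
  · ext <;> simp [connFun] <;> ring
  · simp only [connFun, Prod.smul_fst, Prod.smul_snd, Pi.smul_apply, Quaternion.im_smul,
      mul_smul_comm, smul_mul_assoc, Quaternion.re_smul]
    module

end ConnFun

/-- The Levi-Civita connection of `modelForm m c₁ c₂` on left-invariant fields. -/
def conn (P : BracketParams) (m : ℕ) (c₁ c₂ : ℝ) :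
    ModelSpace m →L[ℝ] ModelSpace m →L[ℝ] ModelSpace m :=
  bilin (LinearMap.mk₂ ℝ (connFun P c₁ c₂) (connFun_add_left P c₁ c₂) (connFun_smul_left P c₁ c₂)
    (connFun_add_right P c₁ c₂) (connFun_smul_right P c₁ c₂))

lemma conn_apply (P : BracketParams) (c₁ c₂ : ℝ) (x y : ModelSpace m) :
    conn P m c₁ c₂ x y = connFun P c₁ c₂ x y := rfl

/-- Vanishing torsion. The formula for the connection contains no `γ₂`, so this parameter must be
zero, as it is for every model. The rest is the skewness of `Θ` and the symmetry of the form. -/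
lemma conn_sub_conn (P : BracketParams) (hP : P.γ₂ = 0) (c₁ c₂ : ℝ) (x y : ModelSpace m) :
    conn P m c₁ c₂ x y - conn P m c₁ c₂ y x = bracket P x y := by
  rw [conn_apply, conn_apply]
  have h := theta_neg_comm y.2 x.2
  have h' := quatForm_comm y.2 x.2
  have hi : quatForm m (fun l => y.2 l * qi) x.2 = _ := congrArg (·.imI) h
  have hj : quatForm m (fun l => y.2 l * qj) x.2 = _ := congrArg (·.imJ) h
  have hk : quatForm m (fun l => y.2 l * qk) x.2 = _ := congrArg (·.imK) h
  ext <;> simp [connFun, bracket, hP, hi, hj, hk, h'] <;> ring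

/-- `Θ` is adjoint to right multiplication by imaginary quaternions. Together with the skewness of
this multiplication (`quatForm_mul_im`), this cancels the terms in `α` when `conn` is shown to be
metric. -/
lemma modelForm_theta (x : ℍ) (p q : Fin m → ℍ) :
    x.imI * quatForm m (fun l => p l * qi) q + x.imJ * quatForm m (fun l => p l * qj) q
      + x.imK * quatForm m (fun l => p l * qk) q = quatForm m (fun l => p l * x.im) q := by
  simp only [quatForm_apply, Finset.mul_sum, ← Finset.sum_add_distrib]
  refine Finset.sum_congr rfl fun l _ => ?_
  simp
  ring

lemma quatForm_mul_im (x : ℍ) (p q : Fin m → ℍ) :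
    quatForm m (fun l => p l * x.im) q = -quatForm m (fun l => q l * x.im) p := by
  simp only [quatForm_apply, ← Finset.sum_neg_distrib]
  refine Finset.sum_congr rfl fun l _ => ?_
  simp
  ring

lemma modelForm_conn (P : BracketParams) {c₁ c₂ : ℝ} (hc₁ : c₁ ≠ 0) (hc₂ : c₂ ≠ 0)
    (x y z : ModelSpace m) :
    modelForm m c₁ c₂ (conn P m c₁ c₂ x y) z + modelForm m c₁ c₂ y (conn P m c₁ c₂ x z) = 0 := by
  rw [modelForm_comm _ _ y]
  simp only [modelForm_apply, conn_apply]
  have h1 := modelForm_theta z.1 x.2 y.2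
  have h2 := modelForm_theta y.1 x.2 z.2
  have h3 := quatForm_mul_im x.1 y.2 z.2
  have h4 := quatForm_comm x.2 y.2
  have h5 := quatForm_comm x.2 z.2
  have e : ∀ y : ModelSpace m, (connFun P c₁ c₂ x y).2 = -((P.β₂ * y.1.re) • x.2)
      - (P.α * c₁ / (2 * c₂)) • ((fun l => y.2 l * x.1.im) + fun l => x.2 l * y.1.im) := fun y => rfl
  rw [e, e]
  simp [connFun]
  field_simp
  linear_combination P.α * c₁ * h1 + P.α * c₁ * h2 - P.α * c₁ * h3

/-! ### The Maurer-Cartan form of the group of a model -/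

namespace Model

variable (X : Model)

/-- `dL x` is the linear part of the affine map `y ↦ x y`; compare the linear parts in the
associative law. -/
lemma dL_mul (x y : ModelSpace m) : X.dL (X.mul x y) = X.dL x ∘L X.dL y := by
  refine ContinuousLinearMap.ext fun z => ?_
  have h := X.mul_assoc x y z
  have h0 := X.mul_assoc x y 0
  rw [X.mul_eq (X.mul x y) z, X.mul_eq x (X.mul y z), X.mul_eq y z, map_add] at h
  rw [X.mul_eq x (X.mul y 0)] at h0
  rw [h0, ← add_assoc] at h
  exact add_left_cancel h

lemma dL_one : X.dL (X.one : ModelSpace m) = .id ℝ _ := by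
  refine ContinuousLinearMap.ext fun z => ?_
  have h := X.one_mul z
  have h0 := X.one_mul (0 : ModelSpace m)
  rw [X.mul_eq, h0, zero_add] at h
  exact h

lemma dL_inv_dL {x : ModelSpace m} (hx : x ∈ X.domain m) (u : ModelSpace m) :
    X.dL (X.inv x) (X.dL x u) = u := by
  have h := X.dL_mul (X.inv x) x
  rw [X.inv_mul hx, X.dL_one] at h
  exact (congrArg (fun L : ModelSpace m →L[ℝ] ModelSpace m => L u) h).symm

lemma isInvertible_dL {x : ModelSpace m} (hx : x ∈ X.domain m) : (X.dL x).IsInvertible :=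
  isInvertible_of_injective (Function.LeftInverse.injective (X.dL_inv_dL hx))

lemma contDiffAt_dL {x : ModelSpace m} (hx : x ∈ X.domain m) (u : ModelSpace m) :
    ContDiffAt ℝ ∞ (fun x : ModelSpace m => X.dL x u) x := by
  have h : (fun x : ModelSpace m => X.dL x u) = fun x => X.mul x u - X.mul x 0 := by
    ext1 x; rw [X.mul_eq x u]; abel
  rw [h]
  have hc : ∀ u : ModelSpace m, ContDiffAt ℝ ∞ (fun x : ModelSpace m => X.mul x u) x := fun u =>
    (X.contDiffAt_mul (y := u) hx).comp (f := fun x : ModelSpace m => (x, u)) x (by fun_prop)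
  exact (hc u).sub (hc 0)

lemma contDiffOn_dL_inv :
    ContDiffOn ℝ ∞ (fun y : ModelSpace m => X.dL (X.inv y)) (X.domain m) := by
  rw [contDiffOn_clm_apply]
  intro u y hy
  exact ((X.contDiffAt_dL (X.inv_mem hy) u).comp y (X.contDiffAt_inv hy)).contDiffWithinAt

lemma lieBracket_one (u v : ModelSpace m) :
    fderiv ℝ (fun x : ModelSpace m => X.dL x v) X.one u -
      fderiv ℝ (fun x : ModelSpace m => X.dL x u) X.one v = bracket X.params u v := by
  have h : VectorField.lieBracket ℝ (fun x : ModelSpace m => X.dL x u) (fun x => X.dL x v) X.one =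
      bracket X.params u v := by
    cases X
    case H5 β => exact H5_lieBracket β u v
    all_goals exact solv_lieBracket _ _ _ u v
  rw [← h, VectorField.lieBracket, X.dL_one]
  rfl

/-- Invariance of the fields `x ↦ dL x w`: differentiate `dL (x z) w = dL x (dL z w)` with respect
to `z` at the neutral element. -/
lemma fderiv_dL {x : ModelSpace m} (hx : x ∈ X.domain m) (u w : ModelSpace m) :
    fderiv ℝ (fun x : ModelSpace m => X.dL x w) x (X.dL x u) =
      X.dL x (fderiv ℝ (fun x : ModelSpace m => X.dL x w) X.one u) := by
  have h1 : HasFDerivAt (fun x : ModelSpace m => X.dL x w) (fderiv ℝ (fun x => X.dL x w) x)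
      (X.mul x X.one) := by
    rw [X.mul_one]
    exact ((X.contDiffAt_dL hx w).differentiableAt (by simp)).hasFDerivAt
  have h2 := h1.comp X.one (X.hasFDerivAt_mul x X.one)
  have h3 := (X.dL x).hasFDerivAt.comp X.one
    ((X.contDiffAt_dL X.one_mem w).differentiableAt (by simp)).hasFDerivAt
  have h4 : ((fun x : ModelSpace m => X.dL x w) ∘ X.mul x) = X.dL x ∘ fun x => X.dL x w := by
    ext1 z; simp [X.dL_mul]
  rw [h4] at h2
  exact congrArg (fun L : ModelSpace m →L[ℝ] ModelSpace m => L u) (h2.unique h3)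

/-- Obtained by differentiating `dL (inv y) (dL y w) = w`. It reduces derivatives of the
Maurer-Cartan form to derivatives of invariant fields at the neutral element. -/
lemma fderiv_dL_inv {x : ModelSpace m} (hx : x ∈ X.domain m) (u w : ModelSpace m) :
    fderiv ℝ (fun y : ModelSpace m => X.dL (X.inv y)) x (X.dL x u) (X.dL x w) =
      -fderiv ℝ (fun x : ModelSpace m => X.dL x w) X.one u := by
  have h1 : HasFDerivAt (fun y : ModelSpace m => X.dL (X.inv y))
      (fderiv ℝ (fun y : ModelSpace m => X.dL (X.inv y)) x) x :=
    (((X.contDiffOn_dL_inv x hx).contDiffAt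
      ((X.domain m).isOpen.mem_nhds hx)).differentiableAt (by simp)).hasFDerivAt
  have h2 := h1.clm_apply ((X.contDiffAt_dL hx w).differentiableAt (by simp)).hasFDerivAt
  have h3 := (hasFDerivAt_const (𝕜 := ℝ) w x).congr_of_eventuallyEq
    (f₁ := fun y : ModelSpace m => X.dL (X.inv y) (X.dL y w))
    (by filter_upwards [(X.domain m).isOpen.mem_nhds hx] with y hy using X.dL_inv_dL hy w)
  have h4 := congrArg (fun L : ModelSpace m →L[ℝ] ModelSpace m => L (X.dL x u)) (h2.unique h3)
  simp [X.fderiv_dL hx, X.dL_inv_dL hx] at h4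
  rw [eq_neg_iff_add_eq_zero, add_comm]
  exact h4

lemma params_γ₂ : X.params.γ₂ = 0 := by cases X <;> rfl

/-- The metric of a model on the open set that underlies its group. -/
def ambientMetric (m : ℕ) (c₁ c₂ : ℝ) (y : ModelSpace m) :
    ModelSpace m →L[ℝ] ModelSpace m →L[ℝ] ℝ :=
  (modelForm m c₁ c₂).bilinearComp (X.dL (X.inv y)) (X.dL (X.inv y))

lemma isCoframe {c₁ c₂ : ℝ} (hc₁ : 0 < c₁) (hc₂ : 0 < c₂) :
    IsCoframe (fun y : ModelSpace m => X.dL (X.inv y)) (X.domain m) (modelForm m c₁ c₂)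
      (conn X.params m c₁ c₂) where
  isOpen := (X.domain m).isOpen
  contDiffOn := X.contDiffOn_dL_inv
  inv _ hy := X.isInvertible_dL (X.inv_mem hy)
  symm := modelForm_comm c₁ c₂
  pos := modelForm_pos hc₁ hc₂
  skew := modelForm_conn _ hc₁.ne' hc₂.ne'
  maurerCartan y hy u v := by
    -- Every vector at `y` is the value of an invariant field. On such values the Maurer-Cartan
    -- equation says that the bracket at the neutral element is `N u v - N v u`.
    obtain ⟨u, rfl⟩ := (X.isInvertible_dL hy).surjective u
    obtain ⟨v, rfl⟩ := (X.isInvertible_dL hy).surjective v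
    rw [X.fderiv_dL_inv hy, X.fderiv_dL_inv hy, X.dL_inv_dL hy, X.dL_inv_dL hy]
    have h1 := conn_sub_conn X.params X.params_γ₂ c₁ c₂ u v
    rw [← X.lieBracket_one, sub_eq_sub_iff_add_eq_add] at h1
    rw [neg_add_eq_iff_eq_add, ← add_assoc, ← sub_eq_add_neg, ← add_sub_right_comm,
      eq_sub_iff_add_eq, h1]

lemma isRestriction (c₁ c₂ : ℝ) :
    IsRestriction (X.metric m c₁ c₂) (X.ambientMetric m c₁ c₂) := by
  intro x u v
  have hi : (x⁻¹).1 = X.inv x.1 := rfl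
  have h : (mfderiv 𝓘(ℝ, ModelSpace m) 𝓘(ℝ, ModelSpace m) (fun y : X.LieGrp m => x⁻¹ * y) x :
      ModelSpace m →L[ℝ] ModelSpace m) = X.dL (X.inv x.1) := by
    rw [← hi]; exact (X.hasMFDerivAt_mul x⁻¹ x).mfderiv
  rw [ambientMetric, ← h]
  rfl

lemma isMetricOn {c₁ c₂ : ℝ} (hc₁ : 0 < c₁) (hc₂ : 0 < c₂) :
    IsMetricOn (X.ambientMetric m c₁ c₂) (X.domain m) := (X.isCoframe hc₁ hc₂).isMetricOn

lemma ricciAt {c₁ c₂ : ℝ} (hc₁ : 0 < c₁) (hc₂ : 0 < c₂) (p : X.LieGrp m) (v w : ModelSpace m) :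
    ricciAt (X.metric m c₁ c₂) p v w = LinearMap.trace ℝ (ModelSpace m)
      ((algCurvature (conn X.params m c₁ c₂)).flip (X.dL (X.inv p) v) |>.flip
        (X.dL (X.inv p) w)) :=
  ((X.isRestriction c₁ c₂).ricciAt p v w).trans ((X.isCoframe hc₁ hc₂).ricci p.2 v w)

lemma inv_one : X.inv (X.one : ModelSpace m) = X.one := by
  rw [← X.mul_one (X.inv X.one), X.inv_mul X.one_mem]

lemma metric_one (c₁ c₂ : ℝ) : X.ambientMetric m c₁ c₂ X.one = modelForm m c₁ c₂ := by
  rw [ambientMetric, inv_one, dL_one]; rfl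

lemma curvature_one {c₁ c₂ : ℝ} (hc₁ : 0 < c₁) (hc₂ : 0 < c₂) (u v w : ModelSpace m) :
    coordCurvature (X.ambientMetric m c₁ c₂) X.one u v w =
      algCurvature (conn X.params m c₁ c₂) u v w := by
  have h := (X.isCoframe hc₁ hc₂).curvature X.one_mem u v w
  simp only [X.inv_one, X.dL_one, ContinuousLinearMap.id_apply] at h
  exact h

lemma nablaCurvature_one {c₁ c₂ : ℝ} (hc₁ : 0 < c₁) (hc₂ : 0 < c₂) (z u v w : ModelSpace m) :
    nablaCurvatureAt (X.metric m c₁ c₂) 1 z u v w =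
      algNablaCurvature (conn X.params m c₁ c₂) z u v w := by
  refine ((X.isRestriction c₁ c₂).nablaCurvatureAt 1 z u v w).trans ?_
  have h := (X.isCoframe hc₁ hc₂).nablaCurvature X.one_mem z u v w
  simp only [X.inv_one, X.dL_one, ContinuousLinearMap.id_apply] at h
  exact h

end Model

end Submax

/-! ### Obstructions to conformal flatness and to parallel curvature. -/

namespace Submax

open RiemGeom

variable {m : ℕ}

/-! ### Curvature on the quaternionic plane of a coordinate -/

/-- The vector of the model space with the given components on `ℍ` and on the coordinate `l`
of `ℍ^m`, and zero on the other coordinates. -/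
def pt (l : Fin m) (a b : ℍ) : ModelSpace m := (a, Pi.single l b)

lemma quatForm_single (l : Fin m) (p q : ℍ) (u : ℍ) :
    quatForm m (fun k => (Pi.single l p : Fin m → ℍ) k * u) (Pi.single l q) =
      (p * u).re * q.re + (p * u).imI * q.imI + (p * u).imJ * q.imJ + (p * u).imK * q.imK := by
  rw [quatForm_apply, Finset.sum_eq_single l]
  · simp
  · intro k _ hk
    simp [Pi.single_eq_of_ne hk]
  · simp

lemma quatForm_single' (l : Fin m) (p q : ℍ) :
    quatForm m (Pi.single l p) (Pi.single l q) =
      p.re * q.re + p.imI * q.imI + p.imJ * q.imJ + p.imK * q.imK := by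
  simpa using quatForm_single l p q 1

lemma modelForm_pt (c₁ c₂ : ℝ) (l : Fin m) (a b a' b' : ℍ) :
    modelForm m c₁ c₂ (pt l a b) (pt l a' b') =
      c₁ * (a.re * a'.re + a.imI * a'.imI + a.imJ * a'.imJ + a.imK * a'.imK) +
      c₂ * (b.re * b'.re + b.imI * b'.imI + b.imJ * b'.imJ + b.imK * b'.imK) := by
  rw [modelForm_apply]
  simp only [pt, quatForm_single']

/-- The subspace `ℍ ⊕ ℍ e_l` is closed under the connection, hence under curvature and `∇R`. All
obstructions are evaluated there, in eight real coordinates. -/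
lemma conn_pt (P : BracketParams) (c₁ c₂ : ℝ) (l : Fin m) (x₀ x₁ x₂ x₃ p₀ p₁ p₂ p₃ y₀ y₁ y₂ y₃
    q₀ q₁ q₂ q₃ : ℝ) :
    conn P m c₁ c₂ (pt l (quat x₀ x₁ x₂ x₃) (quat p₀ p₁ p₂ p₃))
      (pt l (quat y₀ y₁ y₂ y₃) (quat q₀ q₁ q₂ q₃)) =
    pt l (quat
      (P.β₁ * (x₁ * y₁ + x₂ * y₂ + x₃ * y₃)
        + P.β₂ * (c₂ / c₁) * (p₀ * q₀ + p₁ * q₁ + p₂ * q₂ + p₃ * q₃))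
      (-(P.β₁ * y₀ * x₁) + P.α / 2 * (-p₁ * q₀ + p₀ * q₁ + p₃ * q₂ - p₂ * q₃)
        + P.γ₁ * (x₂ * y₃ - x₃ * y₂))
      (-(P.β₁ * y₀ * x₂) + P.α / 2 * (-p₂ * q₀ - p₃ * q₁ + p₀ * q₂ + p₁ * q₃)
        + P.γ₁ * (x₃ * y₁ - x₁ * y₃))
      (-(P.β₁ * y₀ * x₃) + P.α / 2 * (-p₃ * q₀ + p₂ * q₁ - p₁ * q₂ + p₀ * q₃)
        + P.γ₁ * (x₁ * y₂ - x₂ * y₁)))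
    (quat
      (-(P.β₂ * y₀ * p₀) - P.α * c₁ / (2 * c₂) * (-q₁ * x₁ - q₂ * x₂ - q₃ * x₃
        + (-p₁ * y₁ - p₂ * y₂ - p₃ * y₃)))
      (-(P.β₂ * y₀ * p₁) - P.α * c₁ / (2 * c₂) * (q₀ * x₁ + q₂ * x₃ - q₃ * x₂
        + (p₀ * y₁ + p₂ * y₃ - p₃ * y₂)))
      (-(P.β₂ * y₀ * p₂) - P.α * c₁ / (2 * c₂) * (q₀ * x₂ - q₁ * x₃ + q₃ * x₁
        + (p₀ * y₂ - p₁ * y₃ + p₃ * y₁)))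
      (-(P.β₂ * y₀ * p₃) - P.α * c₁ / (2 * c₂) * (q₀ * x₃ + q₁ * x₂ - q₂ * x₁
        + (p₀ * y₃ + p₁ * y₂ - p₂ * y₁)))) := by
  rw [conn_apply]
  refine Prod.ext ?_ (funext fun k => ?_)
  · simp only [connFun, pt, quatForm_single, quatForm_single']
    ext <;> simp [-mul_eq_mul_left_iff] <;> ring
  · rcases eq_or_ne k l with rfl | hk
    · simp only [connFun, pt, Pi.single_eq_same]
      ext <;> simp <;> ring
    · simp [connFun, pt, Pi.single_eq_of_ne hk]

lemma pt_sub (l : Fin m) (x₀ x₁ x₂ x₃ p₀ p₁ p₂ p₃ y₀ y₁ y₂ y₃ q₀ q₁ q₂ q₃ : ℝ) :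
    pt l (quat x₀ x₁ x₂ x₃) (quat p₀ p₁ p₂ p₃) - pt l (quat y₀ y₁ y₂ y₃) (quat q₀ q₁ q₂ q₃) =
    pt l (quat (x₀ - y₀) (x₁ - y₁) (x₂ - y₂) (x₃ - y₃))
      (quat (p₀ - q₀) (p₁ - q₁) (p₂ - q₂) (p₃ - q₃)) := by
  rw [pt, pt, Prod.mk_sub_mk, ← Pi.single_sub]
  rfl

namespace Model

variable (X : Model)

lemma conformal_one [NeZero m] {c₁ c₂ : ℝ} (hc₁ : 0 < c₁) (hc₂ : 0 < c₂)
    (h : IsConformallyFlat (X.metric m c₁ c₂)) {u v w z : ModelSpace m}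
    (huv : modelForm m c₁ c₂ u v = 0) (huw : modelForm m c₁ c₂ u w = 0)
    (huz : modelForm m c₁ c₂ u z = 0) (hvw : modelForm m c₁ c₂ v w = 0)
    (hvz : modelForm m c₁ c₂ v z = 0) (hwz : modelForm m c₁ c₂ w z = 0) :
    modelForm m c₁ c₂ (algCurvature (conn X.params m c₁ c₂) u v w) z = 0 := by
  have h1 := h.orthogonal (X.isRestriction c₁ c₂) (X.isMetricOn hc₁ hc₂) (1 : X.LieGrp m)
    (u := u) (v := v) (w := w) (z := z)
  change X.ambientMetric m c₁ c₂ X.one u v = 0 → X.ambientMetric m c₁ c₂ X.one u w = 0 →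
    X.ambientMetric m c₁ c₂ X.one u z = 0 → X.ambientMetric m c₁ c₂ X.one v w = 0 →
    X.ambientMetric m c₁ c₂ X.one v z = 0 → X.ambientMetric m c₁ c₂ X.one w z = 0 →
    X.ambientMetric m c₁ c₂ X.one
      (coordCurvature (X.ambientMetric m c₁ c₂) X.one u v w) z = 0 at h1
  rw [X.curvature_one hc₁ hc₂, X.metric_one] at h1
  exact h1 huv huw huz hvw hvz hwz

/-- Let `λ = α c₁ / (2 c₂)`. For `γ₁ = 0` the vectors `i, j` of `Im ℍ` commute in the Lie algebra,
and `R(i, j)` acts on `ℍ^m` as `λ²` times a commutator of right multiplications, `q ↦ -2 λ² q k`.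
Its value at `q = 1` is therefore not orthogonal to `k` unless `α = 0`. -/
lemma α_eq_zero_of_isConformallyFlat [NeZero m] {c₁ c₂ : ℝ} (hc₁ : 0 < c₁) (hc₂ : 0 < c₂)
    (h : IsConformallyFlat (X.metric m c₁ c₂)) (hγ : X.params.γ₁ = 0) : X.params.α = 0 := by
  have h1 := X.conformal_one hc₁ hc₂ h (u := pt 0 (quat 0 1 0 0) (quat 0 0 0 0))
    (v := pt 0 (quat 0 0 1 0) (quat 0 0 0 0)) (w := pt 0 (quat 0 0 0 0) (quat 1 0 0 0))
    (z := pt 0 (quat 0 0 0 0) (quat 0 0 0 1)) (by simp [modelForm_pt]) (by simp [modelForm_pt])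
    (by simp [modelForm_pt]) (by simp [modelForm_pt]) (by simp [modelForm_pt])
    (by simp [modelForm_pt])
  simp only [algCurvature_apply, conn_pt, pt_sub, modelForm_pt, hγ] at h1
  by_contra hα
  simp at h1
  field_simp at h1
  have := hc₁.ne'
  have := hc₂.ne'
  norm_num at h1
  simp_all

/-- The vectors are `e ± f` and `e' ± f'` with `e, e'` in `Im ℍ` and `f, f'` in `ℍ^m`. For `α = 0`
the vanishing curvature component says `K(e, e') + K(f, f') = K(e, f') + K(f, e')`, and up to the
factor `1 / c₁` these sectional curvatures are `γ₁² - β₁²`, `-β₂²` and twice `-β₁ β₂`. -/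
lemma eq_of_isConformallyFlat [NeZero m] {c₁ c₂ : ℝ} (hc₁ : 0 < c₁) (hc₂ : 0 < c₂)
    (h : IsConformallyFlat (X.metric m c₁ c₂)) (hα : X.params.α = 0) :
    (X.params.β₁ - X.params.β₂) ^ 2 = X.params.γ₁ ^ 2 := by
  have s₁ := Real.mul_self_sqrt hc₁.le
  have s₂ := Real.mul_self_sqrt hc₂.le
  have e₁ := Real.sqrt_pos.2 hc₁
  have e₂ := Real.sqrt_pos.2 hc₂
  -- With these coefficients all of `e, f, e', f'` have squared length `c₁ c₂`, so that `e + f` is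
  -- orthogonal to `e - f`.
  set a := √c₁
  set b := √c₂
  have h1 := X.conformal_one hc₁ hc₂ h (u := pt 0 (quat 0 b 0 0) (quat a 0 0 0))
    (v := pt 0 (quat 0 0 b 0) (quat 0 a 0 0)) (w := pt 0 (quat 0 b 0 0) (quat (-a) 0 0 0))
    (z := pt 0 (quat 0 0 b 0) (quat 0 (-a) 0 0)) (by simp [modelForm_pt])
    (by simp [modelForm_pt, ← s₁, ← s₂]; ring)
    (by simp [modelForm_pt]) (by simp [modelForm_pt]) (by simp [modelForm_pt, ← s₁, ← s₂]; ring)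
    (by simp [modelForm_pt])
  simp only [algCurvature_apply, conn_pt, pt_sub, modelForm_pt, hα] at h1
  simp [← s₁, ← s₂] at h1
  field_simp at h1
  linear_combination (mul_eq_zero.1 h1).resolve_left (by positivity)

lemma nabla_one_eq_zero {c₁ c₂ : ℝ} (hc₁ : 0 < c₁) (hc₂ : 0 < c₂)
    (h : HasParallelCurvature (X.metric m c₁ c₂)) (z u v w : ModelSpace m) :
    algNablaCurvature (conn X.params m c₁ c₂) z u v w = 0 :=
  (X.nablaCurvature_one hc₁ hc₂ z u v w).symm.trans (h 1 z u v w)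

/-- The tested component of `(∇_i R)(1, q) i`, with `1` in `ℝ` and `q = 1` in `ℍ^m`, is `2 (1 - λ²)`
for `λ = ε c₁ / (2 c₂)`. -/
lemma parallel_H1 [NeZero m] {c₁ c₂ : ℝ} (hc₁ : 0 < c₁) (hc₂ : 0 < c₂) {ε : ℤˣ}
    (h : HasParallelCurvature ((H1 ε).metric m c₁ c₂)) : c₁ = 2 * c₂ := by
  have h1 := (H1 ε).nabla_one_eq_zero hc₁ hc₂ h (pt 0 (quat 0 1 0 0) (quat 0 0 0 0))
    (pt 0 (quat 1 0 0 0) (quat 0 0 0 0)) (pt 0 (quat 0 0 0 0) (quat 1 0 0 0))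
    (pt 0 (quat 0 1 0 0) (quat 0 0 0 0))
  simp only [algNablaCurvature, algCurvature_apply, conn_pt, pt_sub] at h1
  have h2 := congrArg (fun x : ModelSpace m => (x.2 0).re) h1
  have hε : ((ε : ℤ) : ℝ) ^ 2 = 1 := by
    rcases Int.units_eq_one_or ε with rfl | rfl <;> simp
  clear h1
  simp [pt, Model.params] at h2
  field_simp at h2
  have h3 : c₁ ^ 2 = (2 * c₂) ^ 2 := by
    rw [hε] at h2
    linarith
  nlinarith

/-- Here `(∇_i R)(i, j) q = 4 λ³ q j` with `λ = c₁ / (2 c₂)`, which never vanishes for `q = 1`. -/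
lemma not_parallel_H2 [NeZero m] {c₁ c₂ : ℝ} (hc₁ : 0 < c₁) (hc₂ : 0 < c₂) :
    ¬ HasParallelCurvature (H2.metric m c₁ c₂) := by
  intro h
  have h1 := H2.nabla_one_eq_zero hc₁ hc₂ h (pt 0 (quat 0 1 0 0) (quat 0 0 0 0))
    (pt 0 (quat 0 1 0 0) (quat 0 0 0 0)) (pt 0 (quat 0 0 1 0) (quat 0 0 0 0))
    (pt 0 (quat 0 0 0 0) (quat 1 0 0 0))
  simp only [algNablaCurvature, algCurvature_apply, conn_pt, pt_sub] at h1
  have h2 := congrArg (fun x : ModelSpace m => (x.2 0).imJ) h1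
  clear h1
  simp [pt, Model.params] at h2
  field_simp at h2
  norm_num at h2
  exact hc₁.ne' h2

/-- The tested component of `(∇_q R)(1, i) i` is `2 β (2 - β)`. -/
lemma parallel_H3 [NeZero m] {c₁ c₂ : ℝ} (hc₁ : 0 < c₁) (hc₂ : 0 < c₂) {β : ℝ}
    (h : HasParallelCurvature ((H3 β).metric m c₁ c₂)) : β = 0 ∨ β = 2 := by
  have h1 := (H3 β).nabla_one_eq_zero hc₁ hc₂ h (pt 0 (quat 0 0 0 0) (quat 1 0 0 0))
    (pt 0 (quat 1 0 0 0) (quat 0 0 0 0)) (pt 0 (quat 0 1 0 0) (quat 0 0 0 0))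
    (pt 0 (quat 0 1 0 0) (quat 0 0 0 0))
  simp only [algNablaCurvature, algCurvature_apply, conn_pt, pt_sub] at h1
  have h2 := congrArg (fun x : ModelSpace m => (x.2 0).re) h1
  clear h1
  simp [pt, Model.params] at h2
  have h3 : β * (β - 2) = 0 := by linarith
  rcases mul_eq_zero.1 h3 with h | h
  · exact Or.inl h
  · exact Or.inr (by linarith)

end Model

end Submax

/-! ### Ricci curvature and the Einstein condition. -/

namespace Submax

open RiemGeom

variable {m : ℕ}

/-! ### The Ricci tensor of the models -/

lemma trace_modelSpace (T : ModelSpace m →ₗ[ℝ] ModelSpace m) :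
    LinearMap.trace ℝ _ T = (T (quat 1 0 0 0, 0)).1.re + (T (quat 0 1 0 0, 0)).1.imI +
      (T (quat 0 0 1 0, 0)).1.imJ + (T (quat 0 0 0 1, 0)).1.imK +
      ∑ l, (((T (0, Pi.single l (quat 1 0 0 0))).2 l).re +
        ((T (0, Pi.single l (quat 0 1 0 0))).2 l).imI +
        ((T (0, Pi.single l (quat 0 0 1 0))).2 l).imJ +
        ((T (0, Pi.single l (quat 0 0 0 1))).2 l).imK) := by
  let b : Module.Basis (Fin 4) ℝ ℍ := QuaternionAlgebra.basisOneIJK (-1 : ℝ) 0 (-1)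
  have hb : ∀ a, b.repr a = ![a.re, a.imI, a.imJ, a.imK] := fun a => rfl
  have b0 : b 0 = quat 1 0 0 0 := by
    apply b.repr.injective; ext i; rw [b.repr_self, hb]; fin_cases i <;> simp
  have b1 : b 1 = quat 0 1 0 0 := by
    apply b.repr.injective; ext i; rw [b.repr_self, hb]; fin_cases i <;> simp
  have b2 : b 2 = quat 0 0 1 0 := by
    apply b.repr.injective; ext i; rw [b.repr_self, hb]; fin_cases i <;> simp
  have b3 : b 3 = quat 0 0 0 1 := by
    apply b.repr.injective; ext i; rw [b.repr_self, hb]; fin_cases i <;> simp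
  rw [LinearMap.trace_eq_matrix_trace ℝ (b.prod (Pi.basis fun _ : Fin m => b)), Matrix.trace,
    Fintype.sum_sum_type, Fintype.sum_sigma]
  simp [LinearMap.toMatrix_apply, Fin.sum_univ_four, b0, b1, b2, b3, hb]

lemma quatForm_mul_right (p q : Fin m → ℍ) (a : ℍ) :
    quatForm m p (fun l => q l * a) = a.re * quatForm m p q -
      a.imI * quatForm m (fun l => p l * qi) q - a.imJ * quatForm m (fun l => p l * qj) q -
      a.imK * quatForm m (fun l => p l * qk) q := by
  simp only [quatForm_apply, Finset.mul_sum, ← Finset.sum_sub_distrib]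
  refine Finset.sum_congr rfl fun l _ => ?_
  simp
  ring

lemma quatForm_single_left (l : Fin m) (p : ℍ) (u : ℍ) (q : Fin m → ℍ) :
    quatForm m (fun k => (Pi.single l p : Fin m → ℍ) k * u) q =
      (p * u).re * (q l).re + (p * u).imI * (q l).imI + (p * u).imJ * (q l).imJ
        + (p * u).imK * (q l).imK := by
  rw [quatForm_apply, Finset.sum_eq_single l]
  · simp
  · intro k _ hk
    simp [Pi.single_eq_of_ne hk]
  · simp

lemma quatForm_single_right (l : Fin m) (p : Fin m → ℍ) (q : ℍ) :
    quatForm m p (Pi.single l q) =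
      (p l).re * q.re + (p l).imI * q.imI + (p l).imJ * q.imJ + (p l).imK * q.imK := by
  rw [quatForm_apply, Finset.sum_eq_single l]
  · simp
  · intro k _ hk
    simp [Pi.single_eq_of_ne hk]
  · simp

section Components

variable (P : BracketParams) (c₁ c₂ : ℝ) (x y : ModelSpace m)

lemma conn_snd : (conn P m c₁ c₂ x y).2 = -((P.β₂ * y.1.re) • x.2)
    - (P.α * c₁ / (2 * c₂)) • ((fun l => y.2 l * x.1.im) + fun l => x.2 l * y.1.im) := rfl

lemma conn_re : (conn P m c₁ c₂ x y).1.re =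
    P.β₁ * (x.1.imI * y.1.imI + x.1.imJ * y.1.imJ + x.1.imK * y.1.imK)
      + P.β₂ * (c₂ / c₁) * quatForm m x.2 y.2 := rfl

lemma conn_imI : (conn P m c₁ c₂ x y).1.imI = -(P.β₁ * y.1.re * x.1.imI)
    + P.α / 2 * quatForm m (fun l => x.2 l * qi) y.2
    + P.γ₁ * (x.1.imJ * y.1.imK - x.1.imK * y.1.imJ) := rfl

lemma conn_imJ : (conn P m c₁ c₂ x y).1.imJ = -(P.β₁ * y.1.re * x.1.imJ)
    + P.α / 2 * quatForm m (fun l => x.2 l * qj) y.2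
    + P.γ₁ * (x.1.imK * y.1.imI - x.1.imI * y.1.imK) := rfl

lemma conn_imK : (conn P m c₁ c₂ x y).1.imK = -(P.β₁ * y.1.re * x.1.imK)
    + P.α / 2 * quatForm m (fun l => x.2 l * qk) y.2
    + P.γ₁ * (x.1.imI * y.1.imJ - x.1.imJ * y.1.imI) := rfl

end Components

lemma bracket_left (P : BracketParams) (hP : P.γ₂ = 0) (a : ℍ) (y : ModelSpace m) :
    bracket P (a, 0) y = (P.β₁ • (a.re • y.1.im - y.1.re • a.im)
      + P.γ₁ • ((2 : ℝ) • (a.im * y.1.im).im), (P.β₂ * a.re) • y.2) := by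
  simp [bracket, hP, theta_zero_left, mul_smul]

lemma quatForm_zero_mul (q : Fin m → ℍ) (a : ℍ) :
    quatForm m (fun l => (0 : Fin m → ℍ) l * a) q = 0 := by
  simp [quatForm_apply]

lemma quatForm_mul_unit (p q : Fin m → ℍ) {a : ℍ} (ha : a * a = -1) :
    quatForm m (fun l => p l * a * a) q = -quatForm m p q := by
  have h : (fun l => p l * a * a) = -p := by ext1 l; rw [_root_.mul_assoc, ha]; simp
  rw [h, map_neg, neg_apply]

lemma qi_mul_qi : qi * qi = -1 := by ext <;> simp
lemma qj_mul_qj : qj * qj = -1 := by ext <;> simp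
lemma qk_mul_qk : qk * qk = -1 := by ext <;> simp

/-- The contribution of `ℍ` to the Ricci trace. Since the first argument has no component in `ℍ^m`,
its bracket with `y` involves no `Θ`. -/
lemma trace_fst (P : BracketParams) (hP : P.γ₂ = 0) (c₁ c₂ : ℝ) (y z : ModelSpace m) :
    (algCurvature (conn P m c₁ c₂) (quat 1 0 0 0, 0) y z).1.re +
      (algCurvature (conn P m c₁ c₂) (quat 0 1 0 0, 0) y z).1.imI +
      (algCurvature (conn P m c₁ c₂) (quat 0 0 1 0, 0) y z).1.imJ +
      (algCurvature (conn P m c₁ c₂) (quat 0 0 0 1, 0) y z).1.imK =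
    -(3 * P.β₁ ^ 2) * (y.1.re * z.1.re) + (2 * P.γ₁ ^ 2 - 3 * P.β₁ ^ 2) *
      (y.1.imI * z.1.imI + y.1.imJ * z.1.imJ + y.1.imK * z.1.imK) +
      (-(P.β₂ * (3 * P.β₁ + P.β₂)) * (c₂ / c₁) + 3 / 4 * P.α ^ 2 * (c₁ / c₂)) *
        quatForm m y.2 z.2 := by
  have h0 : ∀ q, quatForm m (fun _ => 0) q = 0 := fun q => by simp [quatForm_apply]
  simp only [algCurvature_apply, conn_sub_conn P hP, bracket_left P hP, Prod.fst_sub,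
    Quaternion.re_sub, Quaternion.imI_sub, Quaternion.imJ_sub, Quaternion.imK_sub,
    conn_re, conn_imI, conn_imJ, conn_imK, conn_snd, quatForm_zero_mul, map_sub, map_neg, map_smul,
    map_add, quatForm_mul_right, quatForm_mul_smul, smul_zero,
    zero_apply, map_zero, smul_apply, smul_eq_mul]
  simp [h0, quatForm_mul_unit _ _ qi_mul_qi, quatForm_mul_unit _ _ qj_mul_qj,
    quatForm_mul_unit _ _ qk_mul_qk]
  ring

/-- The contribution of the coordinate `l` to the Ricci trace. The last summand sees only this
coordinate and adds up to a multiple of `quatForm` over all `l`; the others are independent of `l`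
and get multiplied by `m`. -/
lemma trace_snd (P : BracketParams) (c₁ c₂ : ℝ) (y z : ModelSpace m)
    (l : Fin m) :
    ((algCurvature (conn P m c₁ c₂) (0, Pi.single l (quat 1 0 0 0)) y z).2 l).re +
      ((algCurvature (conn P m c₁ c₂) (0, Pi.single l (quat 0 1 0 0)) y z).2 l).imI +
      ((algCurvature (conn P m c₁ c₂) (0, Pi.single l (quat 0 0 1 0)) y z).2 l).imJ +
      ((algCurvature (conn P m c₁ c₂) (0, Pi.single l (quat 0 0 0 1)) y z).2 l).imK =
    (-(4 * P.β₂ ^ 2) * (y.1.re * z.1.re) + ((P.α * (c₁ / c₂)) ^ 2 - 4 * P.β₁ * P.β₂) *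
      (y.1.imI * z.1.imI + y.1.imJ * z.1.imJ + y.1.imK * z.1.imK) -
      4 * P.β₂ ^ 2 * (c₂ / c₁) * quatForm m y.2 z.2) +
    (P.β₂ ^ 2 * (c₂ / c₁) - 9 / 4 * P.α ^ 2 * (c₁ / c₂)) *
      ((y.2 l).re * (z.2 l).re + (y.2 l).imI * (z.2 l).imI + (y.2 l).imJ * (z.2 l).imJ +
        (y.2 l).imK * (z.2 l).imK) := by
  simp only [algCurvature_apply, Prod.snd_sub, Pi.sub_apply,
    Quaternion.re_sub, Quaternion.imI_sub, Quaternion.imJ_sub, Quaternion.imK_sub,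
    conn_re, conn_snd, Pi.neg_apply, Pi.smul_apply, Pi.add_apply, Pi.single_eq_same]
  simp [conn_imI, conn_imJ, conn_imK, quatForm_single_left, quatForm_single_right,
    quatForm_comm (Pi.single l _) z.2]
  ring

/-- The Ricci tensor of a model on left-invariant vector fields. -/
lemma trace_algCurvature (P : BracketParams) (hP : P.γ₂ = 0) (c₁ c₂ : ℝ) (y z : ModelSpace m) :
    LinearMap.trace ℝ (ModelSpace m) ((algCurvature (conn P m c₁ c₂)).flip y |>.flip z) =
    -(3 * P.β₁ ^ 2 + 4 * m * P.β₂ ^ 2) * (y.1.re * z.1.re) +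
      (2 * P.γ₁ ^ 2 - P.β₁ * (3 * P.β₁ + 4 * m * P.β₂) + m * (P.α * (c₁ / c₂)) ^ 2) *
      (y.1.imI * z.1.imI + y.1.imJ * z.1.imJ + y.1.imK * z.1.imK) +
      (-(P.β₂ * (3 * P.β₁ + 4 * m * P.β₂)) * (c₂ / c₁) - 3 / 2 * P.α ^ 2 * (c₁ / c₂)) *
        quatForm m y.2 z.2 := by
  rw [trace_modelSpace]
  simp only [ContinuousLinearMap.coe_coe, ContinuousLinearMap.flip_apply]
  rw [trace_fst P hP]
  simp only [trace_snd]
  rw [Finset.sum_add_distrib, ← Finset.mul_sum, ← quatForm_apply]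
  simp
  ring

namespace Model

variable (X : Model)

/-- Both forms are diagonal on the three summands. The equations compare the Ricci factor on `ℝ`
with that on `Im ℍ`, and with that on `ℍ^m` after clearing the weights `c₁`, `c₂`. -/
lemma isEinstein_iff [NeZero m] {c₁ c₂ : ℝ} (hc₁ : 0 < c₁) (hc₂ : 0 < c₂) :
    IsEinstein (X.metric m c₁ c₂) ↔
      -(3 * X.params.β₁ ^ 2 + 4 * m * X.params.β₂ ^ 2) = 2 * X.params.γ₁ ^ 2 -
        X.params.β₁ * (3 * X.params.β₁ + 4 * m * X.params.β₂) +
        m * (X.params.α * (c₁ / c₂)) ^ 2 ∧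
      (-(X.params.β₂ * (3 * X.params.β₁ + 4 * m * X.params.β₂)) * (c₂ / c₁) -
        3 / 2 * X.params.α ^ 2 * (c₁ / c₂)) * c₁ =
        -(3 * X.params.β₁ ^ 2 + 4 * m * X.params.β₂ ^ 2) * c₂ := by
  constructor
  · rintro ⟨c, h⟩
    have h0 : ∀ v w : ModelSpace m, LinearMap.trace ℝ (ModelSpace m)
        ((algCurvature (conn X.params m c₁ c₂)).flip v |>.flip w) = c * modelForm m c₁ c₂ v w := by
      intro v w
      have h1 := ((X.ricciAt hc₁ hc₂ 1 v w).symm.trans (h 1 v w)).trans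
        (congrArg (c * ·) (X.isRestriction c₁ c₂ 1 v w))
      change LinearMap.trace ℝ (ModelSpace m) ((algCurvature (conn X.params m c₁ c₂)).flip
        (X.dL (X.inv X.one) v) |>.flip (X.dL (X.inv X.one) w)) =
        c * X.ambientMetric m c₁ c₂ X.one v w at h1
      rwa [X.inv_one, X.dL_one, X.metric_one] at h1
    -- One unit vector of each summand recovers the three factors.
    have e0 := h0 (pt 0 (quat 1 0 0 0) (quat 0 0 0 0)) (pt 0 (quat 1 0 0 0) (quat 0 0 0 0))
    have e1 := h0 (pt 0 (quat 0 1 0 0) (quat 0 0 0 0)) (pt 0 (quat 0 1 0 0) (quat 0 0 0 0))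
    have e2 := h0 (pt 0 (quat 0 0 0 0) (quat 1 0 0 0)) (pt 0 (quat 0 0 0 0) (quat 1 0 0 0))
    rw [trace_algCurvature _ X.params_γ₂, modelForm_pt] at e0 e1 e2
    simp only [pt, quatForm_single', quat_re, quat_imI, quat_imJ, quat_imK] at e0 e1 e2
    constructor
    · linarith
    · linear_combination c₁ * e2 - c₂ * e0
  · rintro ⟨h1, h2⟩
    -- The Einstein constant is read off from the direction `ℝ`.
    refine ⟨-(3 * X.params.β₁ ^ 2 + 4 * m * X.params.β₂ ^ 2) / c₁, fun p v w => ?_⟩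
    refine ((X.ricciAt hc₁ hc₂ p v w).trans ?_).trans
      (congrArg (_ * ·) (X.isRestriction c₁ c₂ p v w).symm)
    change _ = _ * modelForm m c₁ c₂ (X.dL (X.inv p) v) (X.dL (X.inv p) w)
    rw [trace_algCurvature _ X.params_γ₂, modelForm_apply, ← h1]
    have h3 := eq_div_of_mul_eq hc₁.ne' h2
    rw [h3]
    field_simp
    ring

lemma isEinstein_iff_eq [NeZero m] {c₁ c₂ : ℝ} (hc₁ : 0 < c₁) (hc₂ : 0 < c₂) :
    IsEinstein (X.metric m c₁ c₂) ↔ ((∃ ε : ℤˣ, X = H1 ε) ∧ c₁ = 2 * c₂) ∨ X = H3 2 := by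
  have hm : (0 : ℝ) < m := Nat.cast_pos.2 (Nat.pos_of_neZero m)
  have hd : c₁ / c₂ * c₂ = c₁ := div_mul_cancel₀ _ hc₂.ne'
  have hd' : c₂ / c₁ * c₁ = c₂ := div_mul_cancel₀ _ hc₁.ne'
  have hp : 0 < c₁ / c₂ := div_pos hc₁ hc₂
  rw [X.isEinstein_iff hc₁ hc₂]
  cases X with
  | H1 ε =>
    have hε : ((ε : ℤ) : ℝ) ^ 2 = 1 := by
      rcases Int.units_eq_one_or ε with rfl | rfl <;> simp
    simp only [params, mul_pow, hε, H1.injEq, exists_eq', true_and, reduceCtorEq, or_false]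
    constructor
    -- Comparing `ℝ` with `Im ℍ` gives `m (c₁ / c₂)² = 4 m`, which already fixes the ratio.
    · rintro ⟨h, -⟩
      have h1 : (c₁ / c₂) ^ 2 = 4 := mul_left_cancel₀ hm.ne' (by linarith)
      have h2 : c₁ / c₂ = 2 := by nlinarith
      rw [h2] at hd
      exact hd.symm
    · intro h
      have h2 : c₁ / c₂ = 2 := by rw [h]; field_simp
      rw [h2]
      exact ⟨by ring, by linear_combination (-(6 + 4 * (m : ℝ))) * hd' - 3 * h⟩
  | H2 =>
    simp only [params, reduceCtorEq, exists_false, false_and, or_self, iff_false, not_and]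
    intro h
    have : 0 < m * (c₁ / c₂) ^ 2 := by positivity
    norm_num at h
    rcases h with h | h | h
    · exact absurd h (by exact_mod_cast hm.ne')
    · exact absurd h hc₁.ne'
    · exact absurd h hc₂.ne'
  | H3 β =>
    simp only [params, reduceCtorEq, exists_false, false_and, false_or, H3.injEq]
    constructor
    · rintro ⟨h, h'⟩
      have h1 : m * (β * (β - 2)) = 0 := by linarith
      rcases mul_eq_zero.1 ((mul_eq_zero.1 h1).resolve_left hm.ne') with h | h
      -- For `β = 0` the Ricci form vanishes on `ℍ^m` but not on `ℝ`, so the second equation fails.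
      · subst h
        norm_num at h'
        exact absurd h' hc₂.ne'
      · linarith
    · rintro rfl
      exact ⟨by ring, by linear_combination (-(2 * (6 + 8 * (m : ℝ)))) * hd'⟩
  | H4 =>
    simp only [params, reduceCtorEq, exists_false, false_and, or_self, iff_false, not_and]
    intro h
    exact absurd h (by norm_num; exact_mod_cast hm.ne')
  | H5 β =>
    simp only [params, reduceCtorEq, exists_false, false_and, or_self, iff_false, not_and]
    intro h
    have : 0 ≤ m * β ^ 2 := by positivity
    linarith

end Model

end Submax

/-! ### Explicit metrics and the conformally flat models. -/

namespace Submax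

open RiemGeom

variable {m : ℕ}

/-! ### The metrics of the models in coordinates -/

lemma inner_quat_mul_left (a u v : ℍ) : inner ℝ (a * u) (a * v) = ‖a‖ ^ 2 * inner ℝ u v := by
  have h : ‖a‖ ^ 2 = Quaternion.normSq a := by
    rw [Quaternion.normSq_eq_norm_mul_self, pow_two]
  rw [h, Quaternion.inner_def, Quaternion.inner_def, Quaternion.normSq_def']
  simp
  ring

lemma inner_quat_mul_right (a u v : ℍ) : inner ℝ (u * a) (v * a) = ‖a‖ ^ 2 * inner ℝ u v := by
  have h : ‖a‖ ^ 2 = Quaternion.normSq a := by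
    rw [Quaternion.normSq_eq_norm_mul_self, pow_two]
  rw [h, Quaternion.inner_def, Quaternion.inner_def, Quaternion.normSq_def']
  simp
  ring

lemma modelForm_eq_inner (c₁ c₂ : ℝ) (x y : ModelSpace m) :
    modelForm m c₁ c₂ x y = c₁ * inner ℝ x.1 y.1 + c₂ * quatForm m x.2 y.2 := rfl

namespace Model

variable (c₁ c₂ β : ℝ)

lemma ambientMetric_H3 (y u v : ModelSpace m) : (H3 β).ambientMetric m c₁ c₂ y u v =
    c₁ * (u.1.re * v.1.re + (Real.exp (2 * y.1.re) ^ 2)⁻¹ * inner ℝ u.1.im v.1.im) +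
      c₂ * ((Real.exp (β * y.1.re) ^ 2)⁻¹ * quatForm m u.2 v.2) := by
  change modelForm m c₁ c₂ (solvDL 0 2 β (solvInv 2 β y) u) (solvDL 0 2 β (solvInv 2 β y) v) = _
  rw [modelForm_apply, Quaternion.inner_def]
  simp [solvDL, solvInv, Real.exp_neg]
  ring

lemma ambientMetric_H4 (y u v : ModelSpace m) : H4.ambientMetric m c₁ c₂ y u v =
    c₁ * (u.1.re * v.1.re + inner ℝ u.1.im v.1.im) +
      c₂ * ((Real.exp y.1.re ^ 2)⁻¹ * quatForm m u.2 v.2) := by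
  change modelForm m c₁ c₂ (solvDL 0 0 1 (solvInv 0 1 y) u) (solvDL 0 0 1 (solvInv 0 1 y) v) = _
  rw [modelForm_apply, Quaternion.inner_def]
  simp [solvDL, solvInv, Real.exp_neg]
  ring

lemma ambientMetric_H5 (y u v : ModelSpace m) : (H5 β).ambientMetric m c₁ c₂ y u v =
    c₁ * ((‖y.1‖ ^ 2)⁻¹ * inner ℝ u.1 v.1) +
      c₂ * (((‖y.1‖ ^ β) ^ 2)⁻¹ * quatForm m u.2 v.2) := by
  change modelForm m c₁ c₂ ((H5 β).dL ((H5 β).inv y) u) ((H5 β).dL ((H5 β).inv y) v) = _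
  rw [modelForm_eq_inner]
  have h : ‖y.1⁻¹‖ ^ β = (‖y.1‖ ^ β)⁻¹ := by rw [norm_inv, Real.inv_rpow (norm_nonneg _)]
  simp [dL, inv, inner_quat_mul_left, Real.inv_rpow, -mul_eq_mul_left_iff, Real.rpow_neg]
  ring

/-! ### Conformally flat models -/

variable {c₁ c₂} (X : Model)

set_option maxSynthPendingDepth 10 in
lemma isMetricOn_conformal (hc₁ : 0 < c₁) (hc₂ : 0 < c₂) {f : ModelSpace m → ℝ}
    (hf : ContDiffOn ℝ ∞ f (X.domain m)) :
    IsMetricOn (fun y => Real.exp (2 * f y) • X.ambientMetric m c₁ c₂ y) (X.domain m) := by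
  refine isMetricOn_of_pos (K := fun y => Real.exp (2 * f y) • modelForm m c₁ c₂)
    (P := fun y => X.dL (X.inv y)) (X.domain m).isOpen ?_ X.contDiffOn_dL_inv ?_ ?_
    fun y hy => (X.isInvertible_dL (X.inv_mem hy)).injective
  · exact (Real.contDiff_exp.comp_contDiffOn (contDiffOn_const.mul hf)).smul contDiffOn_const
  · intro y _ u v
    exact congrArg (Real.exp (2 * f y) * ·) (modelForm_comm c₁ c₂ u v)
  · intro y _ u hu
    exact mul_pos (Real.exp_pos _) (modelForm_pos hc₁ hc₂ u hu)

/-- A flattening map `s` is enough. Its differential is injective automatically, since the pullback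
of the constant form is a positive multiple of the metric. -/
lemma isConformallyFlat_of_map (hc₁ : 0 < c₁) (hc₂ : 0 < c₂) {f : ModelSpace m → ℝ}
    (hf : ContDiffOn ℝ ∞ f (X.domain m)) {s : ModelSpace m → ModelSpace m}
    (hs : ContDiffOn ℝ ∞ s (X.domain m)) {s' : ModelSpace m → ModelSpace m →L[ℝ] ModelSpace m}
    (hs' : ∀ y ∈ X.domain m, HasFDerivAt s (s' y) y)
    (h : ∀ y ∈ X.domain m, ∀ u v, Real.exp (2 * f y) * X.ambientMetric m c₁ c₂ y u v =
      modelForm m c₁ c₂ (s' y u) (s' y v)) : IsConformallyFlat (X.metric m c₁ c₂) := by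
  have hinj : ∀ y ∈ X.domain m, Function.Injective (s' y) := by
    intro y hy
    refine (injective_iff_map_eq_zero (s' y)).2 fun u hu => ?_
    have h1 := h y hy u u
    rw [hu, map_zero, mul_eq_zero] at h1
    by_contra h0
    have h2 : X.dL (X.inv y) u ≠ 0 := fun h2 =>
      h0 ((X.isInvertible_dL (X.inv_mem hy)).injective (h2.trans (map_zero _).symm))
    exact (modelForm_pos hc₁ hc₂ _ h2).ne' (h1.resolve_left (Real.exp_pos _).ne')
  refine (X.isRestriction c₁ c₂).isConformallyFlat hf (s := s) (B := modelForm m c₁ c₂) ?_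
  refine ⟨X.isMetricOn_conformal hc₁ hc₂ hf, ?_, Set.mapsTo_univ _ _, hs, fun y hy => ?_,
    fun y hy u v => ?_⟩
  · exact isMetricOn_const (modelForm_comm c₁ c₂) (modelForm_pos hc₁ hc₂)
  · rw [(hs' y hy).fderiv]
    exact isInvertible_of_injective (hinj y hy)
  · rw [(hs' y hy).fderiv]
    exact h y hy u v

/-- The metric is `c₁ (dr² + e^{-4r} |dv|²) + c₂ e^{-4r} |dq|²`. Multiplied by `e^{4r}` it has
constant coefficients in the coordinate `e^{2r} / 2` instead of `r`. -/
lemma isConformallyFlat_H3 (hc₁ : 0 < c₁) (hc₂ : 0 < c₂) :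
    IsConformallyFlat ((H3 2).metric m c₁ c₂) := by
  have hd : ∀ y : ModelSpace m, HasFDerivAt (fun y : ModelSpace m => quatRe y.1)
      (quatRe ∘L .fst ℝ ℍ (Fin m → ℍ)) y := fun y =>
    (quatRe ∘L .fst ℝ ℍ (Fin m → ℍ)).hasFDerivAt
  refine (H3 2).isConformallyFlat_of_map hc₁ hc₂ (f := fun y => 2 * quatRe y.1)
    (s := fun y => (((Real.exp (2 * quatRe y.1) * 2⁻¹) • (1 : ℍ) + quatIm y.1 , y.2)))
    (s' := fun y => ((Real.exp (2 * y.1.re) • (quatRe ∘L .fst ℝ ℍ (Fin m → ℍ))).smulRight (1 : ℍ) +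
      quatIm ∘L .fst ℝ ℍ (Fin m → ℍ)).prod (.snd ℝ ℍ (Fin m → ℍ)))
    (by fun_prop) (by fun_prop) (fun y _ => ?_) (fun y _ u v => ?_)
  · have h1 := ((((hd y).const_mul 2).exp.mul_const (2⁻¹ : ℝ)).smul_const (1 : ℍ)).add
      (quatIm ∘L .fst ℝ ℍ (Fin m → ℍ)).hasFDerivAt
    refine HasFDerivAt.prodMk (h1.congr_fderiv ?_) (ContinuousLinearMap.snd ℝ ℍ (Fin m → ℍ)).hasFDerivAt
    refine ContinuousLinearMap.ext fun z => ?_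
    simp [smul_smul]
    exact Or.inl (by ring)
  · have e : Real.exp (2 * (2 * y.1.re)) = Real.exp (2 * y.1.re) ^ 2 := by
      rw [← Real.exp_nat_mul]; rfl
    rw [ambientMetric_H3, modelForm_apply, Quaternion.inner_def, quatRe_apply, e]
    have := Real.exp_pos (2 * y.1.re)
    simp
    field_simp
    ring

lemma exp_two_mul_log_norm {a : ℍ} (ha : a ≠ 0) : Real.exp (2 * Real.log ‖a‖) = ‖a‖ ^ 2 := by
  rw [mul_comm, Real.exp_mul, Real.exp_log (norm_pos_iff.2 ha)]
  exact Real.rpow_natCast ‖a‖ 2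

lemma contDiffOn_log_norm :
    ContDiffOn ℝ ∞ (fun y : ModelSpace m => Real.log ‖y.1‖) ((H5 β).domain m) := by
  intro y hy
  have hy : y.1 ≠ 0 := hy
  exact ((contDiffAt_fst.norm ℝ hy).log (norm_ne_zero_iff.2 hy)).contDiffWithinAt

/-- The metric is `(c₁ |dx|² + c₂ |dq|²) / |x|²`, so `|x|²` is the conformal factor and no change of
coordinates is needed. -/
lemma isConformallyFlat_H5 (hc₁ : 0 < c₁) (hc₂ : 0 < c₂) :
    IsConformallyFlat ((H5 1).metric m c₁ c₂) := by
  refine (H5 1).isConformallyFlat_of_map hc₁ hc₂ (contDiffOn_log_norm 1) contDiffOn_id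
    (fun y _ => hasFDerivAt_id y) (fun y hy u v => ?_)
  have hy : y.1 ≠ 0 := hy
  have := norm_pos_iff.2 hy
  rw [ambientMetric_H5, modelForm_eq_inner, exp_two_mul_log_norm hy, Real.rpow_one]
  simp
  field_simp

/-- Division of the metric by `|x|²` leaves `c₁ |x|^{-4} |dx|² + c₂ |dq|²`. Inversion `x ↦ x⁻¹`
scales lengths by `|x|^{-2}`, hence pulls the constant form back to this. -/
lemma isConformallyFlat_H5_neg (hc₁ : 0 < c₁) (hc₂ : 0 < c₂) :
    IsConformallyFlat ((H5 (-1)).metric m c₁ c₂) := by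
  refine (H5 (-1)).isConformallyFlat_of_map hc₁ hc₂ (f := fun y => -Real.log ‖y.1‖)
    (s := fun y => (y.1⁻¹, y.2))
    (s' := fun y => (-(ContinuousLinearMap.mulLeftRight ℝ ℍ y.1⁻¹ y.1⁻¹) ∘L
      .fst ℝ ℍ (Fin m → ℍ)).prod (.snd ℝ ℍ (Fin m → ℍ))) (contDiffOn_log_norm (-1)).neg
    (fun y hy => ?_) (fun y hy => ?_) (fun y hy u v => ?_)
  · have hy : y.1 ≠ 0 := hy
    have h' : ContDiffAt ℝ ∞ (fun a : ℍ => a⁻¹) y.1 := by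
      simpa using contDiffAt_ringInverse ℝ (Units.mk0 y.1 hy)
    exact ((h'.comp y contDiffAt_fst).prodMk contDiffAt_snd).contDiffWithinAt
  · have hy : y.1 ≠ 0 := hy
    exact ((hasFDerivAt_inv' hy).comp y hasFDerivAt_fst).prodMk hasFDerivAt_snd
  · have hy : y.1 ≠ 0 := hy
    have := norm_pos_iff.2 hy
    rw [ambientMetric_H5, modelForm_eq_inner, mul_neg, Real.exp_neg, exp_two_mul_log_norm hy]
    change _ = c₁ * inner ℝ (-(y.1⁻¹ * u.1 * y.1⁻¹)) (-(y.1⁻¹ * v.1 * y.1⁻¹)) +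
      c₂ * quatForm m u.2 v.2
    rw [inner_neg_neg, inner_quat_mul_right, inner_quat_mul_left, Real.rpow_neg_one, norm_inv]
    field_simp

lemma isConformallyFlat_iff [NeZero m] (hc₁ : 0 < c₁) (hc₂ : 0 < c₂) :
    IsConformallyFlat (X.metric m c₁ c₂) ↔ X = H3 2 ∨ X = H5 1 ∨ X = H5 (-1) := by
  constructor
  · intro h
    cases X with
    | H1 ε =>
      have h1 := α_eq_zero_of_isConformallyFlat _ hc₁ hc₂ h rfl
      rcases Int.units_eq_one_or ε with rfl | rfl <;> simp [params] at h1
    | H2 =>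
      have h1 := α_eq_zero_of_isConformallyFlat _ hc₁ hc₂ h rfl
      simp [params] at h1
    | H3 β =>
      have h1 := eq_of_isConformallyFlat _ hc₁ hc₂ h rfl
      simp [params, sub_eq_zero] at h1
      simp [h1]
    | H4 =>
      have h1 := eq_of_isConformallyFlat _ hc₁ hc₂ h rfl
      simp [params] at h1
    | H5 β =>
      have h1 := eq_of_isConformallyFlat _ hc₁ hc₂ h rfl
      simp [params] at h1
      simp [h1]
  · rintro (rfl | rfl | rfl)
    · exact isConformallyFlat_H3 hc₁ hc₂
    · exact isConformallyFlat_H5 hc₁ hc₂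
    · exact isConformallyFlat_H5_neg hc₁ hc₂

end Model

end Submax

/-! ### Homotheties through ambient vector spaces, and symmetries of the standard spaces. -/

namespace RiemGeom

/-! ### Metrics induced by maps to vector spaces, and homotheties -/

section Induced

variable {E : Type*} [NormedAddCommGroup E] [NormedSpace ℝ E]
  {F : Type*} [NormedAddCommGroup F] [NormedSpace ℝ F] {K : Type*} [TopologicalSpace K]
  {J : ModelWithCorners ℝ F K} {N : Type*} [TopologicalSpace N] [ChartedSpace K N]
  {F' : Type*} [NormedAddCommGroup F'] [NormedSpace ℝ F'] {K' : Type*} [TopologicalSpace K']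
  {J' : ModelWithCorners ℝ F' K'} {N' : Type*} [TopologicalSpace N'] [ChartedSpace K' N']
  {W : Type*} [NormedAddCommGroup W] [NormedSpace ℝ W]
  {W' : Type*} [NormedAddCommGroup W'] [NormedSpace ℝ W']

/-- The metric `h` is the pullback under the injective smooth map `ι` of the field `Q` of bilinear
forms on a vector space. -/
structure IsInduced (h : MetricField J N) (ι : N → W) (Q : W → W →L[ℝ] W →L[ℝ] ℝ) : Prop where
  injective : Function.Injective ι
  contMDiff : ContMDiff J 𝓘(ℝ, W) ∞ ι
  metric : ∀ (x : N) (u v : F), (show F →L[ℝ] F →L[ℝ] ℝ from h x) u v =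
    Q (ι x) ((mfderiv J 𝓘(ℝ, W) ι x : F →L[ℝ] W) u) ((mfderiv J 𝓘(ℝ, W) ι x : F →L[ℝ] W) v)

lemma hasMFDerivAt_val {U : Opens E} (x : U) :
    HasMFDerivAt 𝓘(ℝ, E) 𝓘(ℝ, E) (Subtype.val : U → E) x (ContinuousLinearMap.id ℝ E) := by
  have h := hasMFDerivAt_opens_val x
  rwa [extChartAt_opens_coe] at h

lemma IsRestriction.isInduced {U : Opens E} {g : MetricField 𝓘(ℝ, E) U}
    {G : E → E →L[ℝ] E →L[ℝ] ℝ} (hg : IsRestriction g G) : IsInduced g Subtype.val G where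
  injective := Subtype.val_injective
  contMDiff := contMDiff_subtype_val
  metric x u v := by
    rw [(hasMFDerivAt_val x).mfderiv]
    exact hg x u v

lemma isInduced_const (B : E →L[ℝ] E →L[ℝ] ℝ) :
    IsInduced (J := 𝓘(ℝ, E)) (fun _ : E => B) id (fun _ => B) where
  injective := Function.injective_id
  contMDiff := contMDiff_id
  metric x u v := by
    rw [mfderiv_id]
    rfl

lemma IsInduced.prod {h : MetricField J N} {ι : N → W} {Q : W → W →L[ℝ] W →L[ℝ] ℝ}
    {h' : MetricField J' N'} {ι' : N' → W'} {Q' : W' → W' →L[ℝ] W' →L[ℝ] ℝ}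
    (H : IsInduced h ι Q) (H' : IsInduced h' ι' Q') :
    IsInduced (prodMetric h h') (Prod.map ι ι') (fun w =>
      (Q w.1).bilinearComp (.fst ℝ W W') (.fst ℝ W W') +
        (Q' w.2).bilinearComp (.snd ℝ W W') (.snd ℝ W W')) where
  injective := H.injective.prodMap H'.injective
  contMDiff := (H.contMDiff.comp contMDiff_fst).prodMk_space (H'.contMDiff.comp contMDiff_snd)
  metric x u v := by
    have d : HasMFDerivAt (J.prod J') 𝓘(ℝ, W × W') (Prod.map ι ι') x
        (((mfderiv J 𝓘(ℝ, W) ι x.1 : F →L[ℝ] W) ∘L .fst ℝ F F').prod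
          ((mfderiv J' 𝓘(ℝ, W') ι' x.2 : F' →L[ℝ] W') ∘L .snd ℝ F F')) :=
      have h1 := ((H.contMDiff.mdifferentiable (by simp) x.1).hasMFDerivAt).comp x
        (hasMFDerivAt_fst x)
      have h2 := ((H'.contMDiff.mdifferentiable (by simp) x.2).hasMFDerivAt).comp x
        (hasMFDerivAt_snd x)
      ⟨h1.1.prodMk h2.1, h1.2.prodMk h2.2⟩
    rw [d.mfderiv]
    exact congrArg₂ (· + ·) (H.metric x.1 u.1 v.1) (H'.metric x.2 u.2 v.2)

/-- Except for the smoothness of `φ`, everything is checked in vector spaces: `f` is the map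
followed by `ι`, `k` provides its inverse, and injectivity of `ι` brings the identities back to `N`.
Spheres, half spaces and their products are thus treated alike. -/
lemma IsInduced.exists_homothety {h : MetricField J N} {ι : N → W} {Q : W → W →L[ℝ] W →L[ℝ] ℝ}
    (H : IsInduced h ι Q) {U : Opens E} {g : MetricField 𝓘(ℝ, E) U} {G : E → E →L[ℝ] E →L[ℝ] ℝ}
    (hg : IsRestriction g G) {c : ℝ} {f : E → W} {f' : E → E →L[ℝ] W} {k : W → E}
    {φ : U → N} (hφ : ContMDiff 𝓘(ℝ, E) J ∞ φ) (hf : ∀ x, ι (φ x) = f x)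
    (hf' : ∀ y ∈ U, HasFDerivAt f (f' y) y) (hk : ∀ n, ContDiffAt ℝ ∞ k (ι n))
    (hmem : ∀ n, k (ι n) ∈ U) (hleft : ∀ y ∈ U, k (f y) = y) (hright : ∀ n, f (k (ι n)) = ι n)
    (hQ : ∀ y ∈ U, ∀ u v, Q (f y) (f' y u) (f' y v) = c * G y u v) :
    ∃ Φ : U ≃ₘ^∞⟮𝓘(ℝ, E), J⟯ N, (∀ x, Φ x = φ x) ∧ ∀ (x : U) (u v : TangentSpace 𝓘(ℝ, E) x),
      h (Φ x) (mfderiv 𝓘(ℝ, E) J Φ x u) (mfderiv 𝓘(ℝ, E) J Φ x v) = c * g x u v := by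
  have hψ : ContMDiff J 𝓘(ℝ, E) ∞ (fun n => (⟨k (ι n), hmem n⟩ : U)) := by
    rw [← ContMDiff.subtypeVal_comp_iff]
    intro n
    exact (hk n).contMDiffAt.comp n (H.contMDiff n)
  refine ⟨⟨⟨φ, fun n => ⟨k (ι n), hmem n⟩, fun x => ?_, fun n => ?_⟩, hφ, hψ⟩, fun _ => rfl,
    fun x u v => ?_⟩
  · refine Subtype.ext ?_
    simp only [hf]
    exact hleft x x.2
  · refine H.injective ?_
    rw [hf]
    exact hright n
  · obtain ⟨dφ, hdφ⟩ : ∃ dφ : E →L[ℝ] F, dφ = mfderiv 𝓘(ℝ, E) J φ x := ⟨_, rfl⟩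
    obtain ⟨dι, hdι⟩ : ∃ dι : F →L[ℝ] W, dι = mfderiv J 𝓘(ℝ, W) ι (φ x) := ⟨_, rfl⟩
    have key : ∀ u : E, dι (dφ u) = f' x u := by
      intro u
      have h1 := mfderiv_comp x (H.contMDiff.mdifferentiable (by simp) (φ x))
        (hφ.mdifferentiable (by simp) x)
      have h2 : (ι ∘ φ) = f ∘ (Subtype.val : U → E) := funext hf
      have h3 := ((hf' x x.2).hasMFDerivAt.comp x (hasMFDerivAt_val x)).mfderiv
      rw [← h2, h1] at h3
      rw [hdι, hdφ]
      exact congrArg (fun L : E →L[ℝ] W => L u) h3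
    have h1 : ∀ u v : E, Q (ι (φ x)) (dι (dφ u)) (dι (dφ v)) = c * G x u v := fun u v => by
      rw [key, key, hf, hQ x x.2]
    rw [hdι, hdφ] at h1
    exact ((H.metric (φ x) _ _).trans (h1 u v)).trans (congrArg (c * ·) (hg x u v).symm)

lemma contMDiff_opens_mk {U : Opens E} {V : Opens F} {f : E → F} (hf : ContDiffOn ℝ ∞ f U)
    (hm : ∀ x : U, f x ∈ V) : ContMDiff 𝓘(ℝ, E) 𝓘(ℝ, F) ∞ (fun x : U => (⟨f x, hm x⟩ : V)) := by
  rw [← ContMDiff.subtypeVal_comp_iff]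
  intro x
  exact ((hf x x.2).contDiffAt (U.isOpen.mem_nhds x.2)).contMDiffAt.comp x
    contMDiff_subtype_val.contMDiffAt

lemma contMDiff_opens_space {U : Opens E} {f : E → F} (hf : ContDiffOn ℝ ∞ f U) :
    ContMDiff 𝓘(ℝ, E) 𝓘(ℝ, F) ∞ (fun x : U => f x) := by
  intro x
  exact ((hf x x.2).contDiffAt (U.isOpen.mem_nhds x.2)).contMDiffAt.comp x
    contMDiff_subtype_val.contMDiffAt

lemma IsRestriction.isSymmetricAt {U : Opens E} {g : MetricField 𝓘(ℝ, E) U}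
    {G : E → E →L[ℝ] E →L[ℝ] ℝ} (hg : IsRestriction g G) {s : E → E} {s' : E → E →L[ℝ] E}
    (hs : ContDiffOn ℝ ∞ s U) (hs' : ∀ y ∈ U, HasFDerivAt s (s' y) y) (hm : ∀ y ∈ U, s y ∈ U)
    (hinv : ∀ y ∈ U, s (s y) = y) (hG : ∀ y ∈ U, ∀ u v, G (s y) (s' y u) (s' y v) = G y u v)
    {p : U} (hp : s p = p) (hd : ∀ v, s' p v = -v) : IsSymmetricAt g p := by
  obtain ⟨Φ, h1, h2⟩ := hg.isInduced.exists_homothety hg (c := 1) (f := s) (f' := s') (k := s)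
    (contMDiff_opens_mk hs fun x => hm x x.2) (fun _ => rfl) hs'
    (fun n => (hs n n.2).contDiffAt (U.isOpen.mem_nhds n.2)) (fun n => hm n n.2) hinv
    (fun n => hinv n n.2) (fun y hy u v => by rw [hG y hy, one_mul])
  refine ⟨Φ, fun x u v => by rw [h2, one_mul], ?_, fun v => ?_⟩
  · rw [h1]; exact Subtype.ext hp
  · rw [(hasMFDerivAt_opens p (fun y => by rw [h1]) (hs' p p.2)).mfderiv]
    exact hd v

end Induced

/-! ### The standard spaces -/

lemma isInduced_euclidean (d : ℕ) : IsInduced (euclideanMetric d) id (fun _ => innerSL ℝ) :=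
  isInduced_const _

lemma isInduced_sphere (k : ℝ) : IsInduced (sphereMetric k) Subtype.val
    (fun _ => k⁻¹ • (innerSL ℝ : EuclideanSpace ℝ (Fin (3 + 1)) →L[ℝ] _ →L[ℝ] ℝ)) where
  injective := Subtype.val_injective
  contMDiff :=
    have : Fact (Module.finrank ℝ (EuclideanSpace ℝ (Fin (3 + 1))) = 3 + 1) :=
      ⟨finrank_euclideanSpace_fin⟩
    contMDiff_coe_sphere
  metric _ _ _ := rfl

/-- The hyperbolic metric as field of forms on the ambient space. -/
def hyperbolicForm (d : ℕ) (x : HalfSpaceAmbient d) :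
    HalfSpaceAmbient d →L[ℝ] HalfSpaceAmbient d →L[ℝ] ℝ :=
  (x.2 ^ 2)⁻¹ •
    ((innerSL ℝ).bilinearComp (.fst ℝ (EuclideanSpace ℝ (Fin (d - 1))) ℝ) (.fst ℝ _ ℝ) +
      (innerSL ℝ).bilinearComp (.snd ℝ (EuclideanSpace ℝ (Fin (d - 1))) ℝ) (.snd ℝ _ ℝ))

lemma hyperbolicForm_apply (d : ℕ) (x u v : HalfSpaceAmbient d) :
    hyperbolicForm d x u v = (x.2 ^ 2)⁻¹ * (inner ℝ u.1 v.1 + u.2 * v.2) := by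
  have h : hyperbolicForm d x u v = (x.2 ^ 2)⁻¹ * (inner ℝ u.1 v.1 + inner ℝ u.2 v.2) := rfl
  rw [h]
  simp [mul_comm]

lemma isRestriction_hyperbolic (d : ℕ) : IsRestriction (hyperbolicMetric d) (hyperbolicForm d) :=
  fun _ _ _ => rfl

lemma isSymmetricAt_const {E : Type*} [NormedAddCommGroup E] [NormedSpace ℝ E]
    (B : E →L[ℝ] E →L[ℝ] ℝ) (p : E) : IsSymmetricAt (I := 𝓘(ℝ, E)) (fun _ : E => B) p := by
  have hs : ContDiff ℝ ∞ fun x : E => (2 : ℝ) • p - x := by fun_prop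
  have hd : ∀ x, (mfderiv 𝓘(ℝ, E) 𝓘(ℝ, E) (fun x : E => (2 : ℝ) • p - x) x : E →L[ℝ] E) =
      -(ContinuousLinearMap.id ℝ E) :=
    fun x => ((hasFDerivAt_id x).const_sub ((2 : ℝ) • p)).hasMFDerivAt.mfderiv
  have hB : ∀ u v : E, B ((-(ContinuousLinearMap.id ℝ E) : E →L[ℝ] E) u)
      ((-(ContinuousLinearMap.id ℝ E) : E →L[ℝ] E) v) = B u v := fun u v => by simp
  refine ⟨⟨Equiv.subLeft ((2 : ℝ) • p), hs.contMDiff, ?_⟩, fun x => ?_, ?_, fun v => ?_⟩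
  · have : ⇑(Equiv.subLeft ((2 : ℝ) • p)).symm = fun x => (2 : ℝ) • p - x := by
      ext1 x; simp [sub_eq_neg_add]
    exact this ▸ hs.contMDiff
  · rw [← hd x] at hB
    exact hB
  · change (2 : ℝ) • p - p = p
    rw [two_smul, add_sub_cancel_right]
  · exact congrArg (fun L : E →L[ℝ] E => L v) (hd p)

/-- The symmetry is `(x, t) ↦ (-x, t) / (|x|² + t²)`, inversion in the unit hemisphere combined with
`x ↦ -x`. One base point suffices, as homogeneity is supplied by the groups of the models. -/
lemma isSymmetricAt_hyperbolic (d : ℕ) (p : hyperbolicSpace d) (hp : p.1 = (0, 1)) :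
    IsSymmetricAt (hyperbolicMetric d) p := by
  set A := HalfSpaceAmbient d
  set ρ : A → ℝ := fun y => inner ℝ y.1 y.1 + y.2 ^ 2 with hρ
  obtain ⟨τ, hτ1, hτ2⟩ : ∃ τ : A →L[ℝ] A, (∀ y, (τ y).1 = -y.1) ∧ ∀ y, (τ y).2 = y.2 :=
    ⟨(-(ContinuousLinearMap.fst ℝ (EuclideanSpace ℝ (Fin (d - 1))) ℝ)).prod (.snd ℝ _ ℝ),
      fun _ => rfl, fun _ => rfl⟩
  obtain ⟨ρ', hρ'⟩ : ∃ ρ' : A → A →L[ℝ] ℝ, ∀ y v, ρ' y v = 2 * (inner ℝ y.1 v.1 + y.2 * v.2) :=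
    ⟨fun y => (2 : ℝ) • ((innerSL ℝ y.1) ∘L (.fst ℝ _ ℝ) + y.2 • ContinuousLinearMap.snd ℝ _ ℝ),
      fun _ _ => rfl⟩
  have hs1 : ∀ (c : ℝ) (y : A), (c • y).1 = c • y.1 := fun _ _ => rfl
  have hs2 : ∀ (c : ℝ) (y : A), (c • y).2 = c * y.2 := fun _ _ => rfl
  have hρ0 : ∀ y ∈ hyperbolicSpace d, 0 < ρ y := by
    intro y hy
    have hy : 0 < y.2 := hy
    have : 0 ≤ inner ℝ y.1 y.1 := real_inner_self_nonneg
    positivity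
  have hρd : ∀ y, HasFDerivAt ρ (ρ' y) y := by
    intro y
    have h := (hasFDerivAt_fst (𝕜 := ℝ) (p := y)).inner ℝ hasFDerivAt_fst |>.add
      ((hasFDerivAt_snd (𝕜 := ℝ) (p := y)).pow 2)
    refine h.congr_fderiv (ContinuousLinearMap.ext fun z => ?_)
    simp [hρ', real_inner_comm]
    ring
  have hρc : ContDiff ℝ ∞ ρ := by
    exact (contDiff_fst.inner ℝ contDiff_fst).add (contDiff_snd.pow 2)
  refine (isRestriction_hyperbolic d).isSymmetricAt (s := fun y => (ρ y)⁻¹ • τ y)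
    (s' := fun y => (ρ y)⁻¹ • τ + (-(ρ y ^ 2)⁻¹ • ρ' y).smulRight (τ y)) ?_ ?_ ?_ ?_ ?_ ?_ ?_
  · exact (hρc.contDiffOn.inv fun y hy => (hρ0 y hy).ne').smul τ.contDiff.contDiffOn
  · intro y hy
    exact ((hasDerivAt_inv (hρ0 y hy).ne').comp_hasFDerivAt y (hρd y)).smul τ.hasFDerivAt
  · intro y hy
    refine mul_pos (inv_pos.2 (hρ0 y hy)) ?_
    rw [hτ2]
    exact hy
  · intro y hy
    -- `ρ` is quadratic and invariant under `τ`, so the map inverts `ρ`; hence it is an involution.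
    have h1 : ρ ((ρ y)⁻¹ • τ y) = (ρ y)⁻¹ := by
      have h0 := (hρ0 y hy).ne'
      have h2 : inner ℝ y.1 y.1 = ρ y - y.2 ^ 2 := by simp [ρ]
      generalize ρ y = R at *
      change inner ℝ (R⁻¹ • τ y).1 (R⁻¹ • τ y).1 + (R⁻¹ • τ y).2 ^ 2 = R⁻¹
      simp only [hs1, hs2, hτ1, hτ2, inner_smul_left, inner_smul_right,
        inner_neg_neg, h2, conj_trivial]
      field_simp
      ring
    rw [h1, inv_inv, map_smul, smul_inv_smul₀ (hρ0 y hy).ne']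
    exact Prod.ext (by rw [hτ1, hτ1, neg_neg]) (by rw [hτ2, hτ2])
  · intro y hy u v
    have h0 := (hρ0 y hy).ne'
    have hy : 0 < y.2 := hy
    have h2 : inner ℝ y.1 y.1 = ρ y - y.2 ^ 2 := by simp [ρ]
    rw [hyperbolicForm_apply, hyperbolicForm_apply]
    simp only [add_apply, smul_apply, ContinuousLinearMap.smulRight_apply, Prod.fst_add,
      Prod.snd_add, hs1, hs2, hτ1, hτ2, hρ', inner_add_left, inner_add_right,
      inner_smul_left, inner_smul_right, inner_neg_neg, h2, smul_eq_mul, conj_trivial,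
      real_inner_comm y.1 u.1]
    generalize ρ y = R at *
    field_simp
    ring
  · rw [hp]
    have h1 : ρ (0, 1) = 1 := by simp [ρ]
    rw [h1]
    exact Prod.ext (by simp [hτ1]) (by simp [hτ2])
  · intro v
    rw [hp]
    have h1 : ρ (0, 1) = 1 := by simp [ρ]
    rw [h1]
    refine Prod.ext ?_ ?_
    · simp only [add_apply, smul_apply, ContinuousLinearMap.smulRight_apply, Prod.fst_add, hs1,
        hτ1, hρ']
      simp
    · simp only [add_apply, smul_apply, ContinuousLinearMap.smulRight_apply, Prod.snd_add, hs2,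
        hτ2, hρ']
      simp
      ring

/-- The symmetry is the restriction of the orthogonal map that fixes `p` and is `-1` on its
orthogonal complement, which is the tangent space at `p`. -/
lemma isSymmetricAt_sphere (k : ℝ) (p : ThreeSphere) : IsSymmetricAt (sphereMetric k) p := by
  have hfin : Fact (Module.finrank ℝ (EuclideanSpace ℝ (Fin (3 + 1))) = 3 + 1) :=
    ⟨finrank_euclideanSpace_fin⟩
  set V := EuclideanSpace ℝ (Fin (3 + 1))
  have hpp : inner ℝ (p : V) (p : V) = 1 := by
    rw [real_inner_self_eq_norm_sq, norm_eq_of_mem_sphere, one_pow]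
  obtain ⟨S, hS⟩ : ∃ S : V →L[ℝ] V, ∀ x, S x = (2 * inner ℝ (p : V) x) • (p : V) - x :=
    ⟨((2 : ℝ) • innerSL ℝ (p : V)).smulRight (p : V) - .id ℝ V, fun _ => rfl⟩
  have hSi : ∀ x y, inner ℝ (S x) (S y) = inner ℝ x y := by
    intro x y
    simp only [hS, inner_sub_left, inner_sub_right, inner_smul_left, inner_smul_right, hpp,
      conj_trivial, real_inner_comm (p : V) x]
    ring
  have hSS : ∀ x, S (S x) = x := by
    intro x
    simp only [hS, inner_sub_right, inner_smul_right, hpp]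
    module
  have hm : ∀ x : ThreeSphere, S x ∈ Metric.sphere (0 : V) 1 := by
    intro x
    rw [mem_sphere_zero_iff_norm, ← sq_eq_sq₀ (norm_nonneg _) zero_le_one,
      ← real_inner_self_eq_norm_sq, hSi, real_inner_self_eq_norm_sq, norm_eq_of_mem_sphere]
  have hc : ContMDiff (𝓡 3) (𝓡 3) ∞ (fun x : ThreeSphere => (⟨S x, hm x⟩ : ThreeSphere)) :=
    (S.contDiff.contMDiff.comp contMDiff_coe_sphere).codRestrict_sphere hm
  let s : ThreeSphere ≃ₘ^∞⟮𝓡 3, 𝓡 3⟯ ThreeSphere :=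
    ⟨⟨fun x => ⟨S x, hm x⟩, fun x => ⟨S x, hm x⟩, fun x => Subtype.ext (hSS x),
      fun x => Subtype.ext (hSS x)⟩, hc, hc⟩
  obtain ⟨ds, hds⟩ : ∃ ds : ThreeSphere → EuclideanSpace ℝ (Fin 3) →L[ℝ] EuclideanSpace ℝ (Fin 3),
    ds = fun x => mfderiv (𝓡 3) (𝓡 3) s x := ⟨_, rfl⟩
  obtain ⟨dι, hdι⟩ : ∃ dι : ThreeSphere → EuclideanSpace ℝ (Fin 3) →L[ℝ] V,
    dι = fun x => mfderiv (𝓡 3) 𝓘(ℝ, V) (Subtype.val : ThreeSphere → V) x := ⟨_, rfl⟩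
  have key : ∀ x u, dι (s x) (ds x u) = S (dι x u) := by
    intro x u
    have d1 := (contMDiff_coe_sphere (n := 3) (E := V) (m := ∞)).mdifferentiable (by simp)
    have h1 := mfderiv_comp x (d1 (s x)) (s.mdifferentiable (by simp) x)
    have h2 := (S.hasFDerivAt.hasMFDerivAt.comp x (d1 x).hasMFDerivAt).mfderiv
    have h3 : (Subtype.val : ThreeSphere → V) ∘ s = S ∘ Subtype.val := rfl
    rw [h3] at h1
    rw [hds, hdι]
    exact congrArg (fun L : EuclideanSpace ℝ (Fin 3) →L[ℝ] V => L u) (h1.symm.trans h2)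
  have hsp : s p = p := by
    refine Subtype.ext ?_
    change S p = p
    rw [hS, hpp]
    module
  have r1 : ∀ x u v, k⁻¹ * inner ℝ (dι (s x) (ds x u)) (dι (s x) (ds x v)) =
      k⁻¹ * inner ℝ (dι x u) (dι x v) := fun x u v => by rw [key, key, hSi]
  have r2 : ∀ v, ds p v = -v := by
    intro v
    have hinj : Function.Injective (dι p) := by
      rw [hdι]; exact mfderiv_coe_sphere_injective p
    have ho : inner ℝ (p : V) (dι p v) = 0 := by
      have h := range_mfderiv_coe_sphere (n := 3) p
      have h1 : dι p v ∈ (Submodule.span ℝ {(p : V)})ᗮ := by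
        rw [← h, hdι]
        exact ⟨v, rfl⟩
      exact Submodule.mem_orthogonal_singleton_iff_inner_right.1 h1
    have h1 := key p v
    rw [hsp, hS, ho] at h1
    apply hinj
    rw [h1, map_neg]
    module
  rw [hds, hdι] at r1
  rw [hds] at r2
  exact ⟨s, r1, hsp, r2⟩

end RiemGeom

namespace RiemGeom

/-- The homothety also pulls back the symmetry of the standard space; both conclusions are kept for
the models. -/
lemma IsInduced.homothetic {E : Type*} [NormedAddCommGroup E] [NormedSpace ℝ E]
    {F : Type*} [NormedAddCommGroup F] [NormedSpace ℝ F] {K : Type*} [TopologicalSpace K]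
    {J : ModelWithCorners ℝ F K} {N : Type*} [TopologicalSpace N] [ChartedSpace K N]
    {W : Type*} [NormedAddCommGroup W] [NormedSpace ℝ W]
    {h : MetricField J N} {ι : N → W} {Q : W → W →L[ℝ] W →L[ℝ] ℝ}
    (H : IsInduced h ι Q) {U : Opens E} {g : MetricField 𝓘(ℝ, E) U} {G : E → E →L[ℝ] E →L[ℝ] ℝ}
    (hg : IsRestriction g G) {c : ℝ} (hc : 0 < c) {f : E → W} {f' : E → E →L[ℝ] W} {k : W → E}
    {φ : U → N} (hφ : ContMDiff 𝓘(ℝ, E) J ∞ φ) (hf : ∀ x, ι (φ x) = f x)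
    (hf' : ∀ y ∈ U, HasFDerivAt f (f' y) y) (hk : ∀ n, ContDiffAt ℝ ∞ k (ι n))
    (hmem : ∀ n, k (ι n) ∈ U) (hleft : ∀ y ∈ U, k (f y) = y) (hright : ∀ n, f (k (ι n)) = ι n)
    (hQ : ∀ y ∈ U, ∀ u v, Q (f y) (f' y u) (f' y v) = c * G y u v) {p : U}
    (hp : IsSymmetricAt h (φ p)) : Homothetic g h ∧ IsSymmetricAt g p := by
  obtain ⟨Φ, h1, h2⟩ := H.exists_homothety hg hφ hf hf' hk hmem hleft hright hQ
  exact ⟨⟨c, hc, Φ, h2⟩, IsSymmetricAt.of_homothety hc.ne' Φ h2 (by rwa [h1])⟩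

lemma exists_isometry_euclidean {V : Type*} [NormedAddCommGroup V] [InnerProductSpace ℝ V]
    [FiniteDimensional ℝ V] {d : ℕ} (hd : Module.finrank ℝ V = d) :
    ∃ e : V ≃L[ℝ] EuclideanSpace ℝ (Fin d), ∀ a b, inner ℝ (e a) (e b) = inner ℝ a b := by
  subst hd
  exact ⟨(stdOrthonormalBasis ℝ V).repr.toContinuousLinearEquiv,
    (stdOrthonormalBasis ℝ V).repr.inner_map_map⟩

end RiemGeom

/-! ### Models with real hyperbolic factors: `ℋ₃` and `ℋ₄`. -/

namespace Submax

open RiemGeom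

variable {m : ℕ}

/-! ### Linear isometries to Euclidean spaces -/

/-- `Fin m → ℍ` carries the sup norm, so the isometry passes through the Euclidean norm of `PiLp 2`.
-/
lemma exists_isometry_quatForm {d : ℕ} (hd : 4 * m = d) :
    ∃ e : (Fin m → ℍ) ≃L[ℝ] EuclideanSpace ℝ (Fin d), ∀ a b,
      inner ℝ (e a) (e b) = quatForm m a b := by
  obtain ⟨e, he⟩ := exists_isometry_euclidean (V := PiLp 2 fun _ : Fin m => ℍ) (d := d)
    (by rw [← hd, LinearEquiv.finrank_eq (WithLp.linearEquiv 2 ℝ (Fin m → ℍ))]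
        simp [Module.finrank_pi_fintype, Quaternion.finrank_eq_four, mul_comm])
  refine ⟨(PiLp.continuousLinearEquiv 2 ℝ fun _ : Fin m => ℍ).symm.trans e, fun a b => ?_⟩
  simp [he, PiLp.inner_apply, quatForm]

lemma exists_isometry_prod_quatForm {V : Type*} [NormedAddCommGroup V] [InnerProductSpace ℝ V]
    [FiniteDimensional ℝ V] {d : ℕ} (hd : Module.finrank ℝ V + 4 * m = d) :
    ∃ e : (V × (Fin m → ℍ)) ≃L[ℝ] EuclideanSpace ℝ (Fin d), ∀ a b,
      inner ℝ (e a) (e b) = inner ℝ a.1 b.1 + quatForm m a.2 b.2 := by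
  obtain ⟨e₁, he₁⟩ := exists_isometry_quatForm (m := m) rfl
  obtain ⟨e, he⟩ := exists_isometry_euclidean
    (V := WithLp 2 (V × EuclideanSpace ℝ (Fin (4 * m)))) (d := d)
    (by rw [← hd, LinearEquiv.finrank_eq (WithLp.linearEquiv 2 ℝ _)]; simp)
  refine ⟨((ContinuousLinearEquiv.refl ℝ V).prodCongr e₁).trans
    ((WithLp.prodContinuousLinearEquiv 2 ℝ V _).symm.trans e), fun a b => ?_⟩
  simp [he, he₁, WithLp.prod_inner_apply]

/-- The imaginary part of a quaternion as vector of `ℝ³`. -/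
def imVec : ℍ →L[ℝ] EuclideanSpace ℝ (Fin 3) :=
  LinearMap.toContinuousLinearMap
    { toFun := fun a => !₂[a.imI, a.imJ, a.imK]
      map_add' := fun a b => by ext i; fin_cases i <;> simp
      map_smul' := fun c a => by ext i; fin_cases i <;> simp }

/-- The imaginary quaternion with the given vector of components. -/
def ofIm : EuclideanSpace ℝ (Fin 3) →L[ℝ] ℍ :=
  LinearMap.toContinuousLinearMap
    { toFun := fun w => quat 0 (w 0) (w 1) (w 2)
      map_add' := fun a b => by ext <;> simp
      map_smul' := fun c a => by ext <;> simp }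

@[simp] lemma ofIm_re (w : EuclideanSpace ℝ (Fin 3)) : (ofIm w).re = 0 := rfl

@[simp] lemma imVec_ofIm (w : EuclideanSpace ℝ (Fin 3)) : imVec (ofIm w) = w := by
  ext i; fin_cases i <;> rfl

@[simp] lemma ofIm_imVec (a : ℍ) : ofIm (imVec a) = a.im := by
  ext <;> rfl

@[simp] lemma imVec_one : imVec 1 = 0 := by
  ext i; fin_cases i <;> rfl

@[simp] lemma inner_imVec (a b : ℍ) : inner ℝ (imVec a) (imVec b) = inner ℝ a.im b.im := by
  rw [PiLp.inner_apply, Quaternion.inner_def]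
  simp [imVec, Fin.sum_univ_three]
  ring

/-! ### Homotheties of the models to the standard spaces -/

namespace Model

variable {c₁ c₂ : ℝ}

/-- `κ` is a dilation of `ℍ^m` that absorbs the ratio of `c₁` and `c₂`. It is available because `α =
0` in these models, and explains why they impose no condition on `c₁, c₂`. -/
lemma exists_scale {a b : ℝ} (ha : 0 < a) (hb : 0 < b) : ∃ κ : ℝ, 0 < κ ∧ a * κ ^ 2 = b := by
  refine ⟨√(b / a), Real.sqrt_pos.2 (div_pos hb ha), ?_⟩
  rw [Real.sq_sqrt (div_pos hb ha).le]
  field_simp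

lemma hasFDerivAt_quatRe_fst (y : ModelSpace m) :
    HasFDerivAt (fun y : ModelSpace m => quatRe y.1) (quatRe ∘L .fst ℝ ℍ (Fin m → ℍ)) y :=
  (quatRe ∘L .fst ℝ ℍ (Fin m → ℍ)).hasFDerivAt

lemma re_smul_one_add_im (a : ℍ) : a.re • (1 : ℍ) + a.im = a := by
  ext <;> simp

/-- Height `t = e^{2r}`: then `dt / t = 2 dr`, so the metric is scaled by `4 / c₁`, the imaginary
part is doubled, and `c₁ κ² = 4 c₂`. -/
lemma hyperbolic_H3 (hc₁ : 0 < c₁) (hc₂ : 0 < c₂) :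
    Homothetic ((H3 2).metric m c₁ c₂) (hyperbolicMetric (4 * (m + 1))) ∧
      IsSymmetricAt ((H3 2).metric m c₁ c₂) 1 := by
  obtain ⟨κ, hκ, hκc⟩ := exists_scale hc₁ (mul_pos four_pos hc₂)
  obtain ⟨e, he⟩ := exists_isometry_prod_quatForm (m := m) (V := EuclideanSpace ℝ (Fin 3))
    (d := 4 * (m + 1) - 1) (by rw [finrank_euclideanSpace_fin]; omega)
  let A : ModelSpace m →L[ℝ] EuclideanSpace ℝ (Fin (4 * (m + 1) - 1)) :=
    e.toContinuousLinearMap ∘L (((2 : ℝ) • imVec ∘L .fst ℝ ℍ (Fin m → ℍ)).prod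
      (κ • .snd ℝ ℍ (Fin m → ℍ)))
  have hA : ∀ y, A y = e ((2 : ℝ) • imVec y.1, κ • y.2) := fun _ => rfl
  refine (isRestriction_hyperbolic (4 * (m + 1))).isInduced.homothetic
    ((H3 2).isRestriction c₁ c₂) (c := 4 / c₁) (by positivity)
    (f := fun y => (A y, Real.exp (2 * quatRe y.1)))
    (f' := fun y => A.prod (Real.exp (2 * quatRe y.1) •
      ((2 : ℝ) • (quatRe ∘L .fst ℝ ℍ (Fin m → ℍ)))))
    (k := fun w => ((Real.log w.2 / 2) • (1 : ℍ) + ofIm ((2⁻¹ : ℝ) • (e.symm w.1).1),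
      κ⁻¹ • (e.symm w.1).2))
    (contMDiff_opens_mk (f := fun y => (A y, Real.exp (2 * quatRe y.1))) (by fun_prop)
      (fun x => Real.exp_pos _)) (fun _ => rfl)
    (fun y _ => ?_) (fun n => ?_) (fun _ => trivial) (fun y _ => ?_) (fun n => ?_)
    (fun y _ u v => ?_) (isSymmetricAt_hyperbolic _ _ ?_)
  · exact A.hasFDerivAt.prodMk ((hasFDerivAt_quatRe_fst y).const_mul 2).exp
  · have hn : n.1.2 ≠ 0 := (show 0 < n.1.2 from n.2).ne'
    have h1 : ContDiffAt ℝ ∞ (fun w : HalfSpaceAmbient (4 * (m + 1)) => Real.log w.2) n.1 :=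
      contDiffAt_snd.log hn
    fun_prop
  · simp [hA, smul_smul, hκ.ne', re_smul_one_add_im]
  · have hn : 0 < n.1.2 := n.2
    refine Prod.ext ?_ ?_
    · simp [hA, smul_smul, hκ.ne']
    · simp [mul_div_cancel₀, Real.exp_log hn]
  · rw [hyperbolicForm_apply, ambientMetric_H3]
    simp [hA, he, inner_smul_left, inner_smul_right, -map_smul]
    have := Real.exp_pos (2 * y.1.re)
    field_simp
    linear_combination quatForm m u.2 v.2 * hκc
  · change (A 0, Real.exp (2 * quatRe (0 : ℍ))) = (0, 1)
    simp

/-- For `β = 0` the form on `ℍ^m` has no exponential factor and splits off as a Euclidean space; `ℍ`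
is treated as for `β = 2`. -/
lemma hyperbolic_prod_H3 (hc₁ : 0 < c₁) (hc₂ : 0 < c₂) :
    Homothetic ((H3 0).metric m c₁ c₂)
      (prodMetric (hyperbolicMetric 4) (euclideanMetric (4 * (m + 1) - 4))) ∧
      IsSymmetricAt ((H3 0).metric m c₁ c₂) 1 := by
  obtain ⟨κ, hκ, hκc⟩ := exists_scale hc₁ (mul_pos four_pos hc₂)
  obtain ⟨e, he⟩ := exists_isometry_quatForm (m := m) (d := 4 * (m + 1) - 4) (by omega)
  let A : ModelSpace m →L[ℝ] EuclideanSpace ℝ (Fin (4 - 1)) :=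
    (2 : ℝ) • imVec ∘L .fst ℝ ℍ (Fin m → ℍ)
  have hA : ∀ y, A y = (2 : ℝ) • imVec y.1 := fun _ => rfl
  let B : ModelSpace m →L[ℝ] EuclideanSpace ℝ (Fin (4 * (m + 1) - 4)) :=
    e.toContinuousLinearMap ∘L (κ • .snd ℝ ℍ (Fin m → ℍ))
  have hB : ∀ y, B y = e (κ • y.2) := fun _ => rfl
  refine ((isRestriction_hyperbolic 4).isInduced.prod (isInduced_euclidean _)).homothetic
    ((H3 0).isRestriction c₁ c₂) (c := 4 / c₁) (by positivity)
    (f := fun y => ((A y, Real.exp (2 * quatRe y.1)), B y))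
    (f' := fun y => (A.prod (Real.exp (2 * quatRe y.1) •
      ((2 : ℝ) • (quatRe ∘L .fst ℝ ℍ (Fin m → ℍ))))).prod B)
    (k := fun w => ((Real.log w.1.2 / 2) • (1 : ℍ) + ofIm ((2⁻¹ : ℝ) • w.1.1),
      κ⁻¹ • (e.symm w.2)))
    ((contMDiff_opens_mk (V := hyperbolicSpace 4) (f := fun y => (A y, Real.exp (2 * quatRe y.1)))
      (by fun_prop) (fun x => Real.exp_pos _)).prodMk
      (contMDiff_opens_space B.contDiff.contDiffOn)) (fun _ => rfl)
    (fun y _ => ?_) (fun n => ?_) (fun _ => trivial) (fun y _ => ?_) (fun n => ?_)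
    (fun y _ u v => ?_) ((isSymmetricAt_hyperbolic _ _ ?_).prod (isSymmetricAt_const _ _))
  · exact (A.hasFDerivAt.prodMk ((hasFDerivAt_quatRe_fst y).const_mul 2).exp).prodMk B.hasFDerivAt
  · have hn : n.1.1.2 ≠ 0 := (show 0 < n.1.1.2 from n.1.2).ne'
    have h1 : ContDiffAt ℝ ∞ (fun w : HalfSpaceAmbient 4 × EuclideanSpace ℝ (Fin (4 * (m + 1) - 4)) =>
        Real.log w.1.2) (n.1.1, n.2) :=
      (contDiffAt_snd.comp _ contDiffAt_fst).log hn
    fun_prop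
  · simp [hA, hB, smul_smul, hκ.ne', re_smul_one_add_im]
  · have hn : 0 < n.1.1.2 := n.1.2
    refine Prod.ext (Prod.ext ?_ ?_) ?_
    · simp [hA, smul_smul]
    · simp [mul_div_cancel₀, Real.exp_log hn]
    · simp [hB, smul_smul, hκ.ne']
  · rw [ambientMetric_H3]
    simp [hyperbolicForm_apply, hA, hB, he, inner_smul_left, inner_smul_right, -map_smul]
    have := Real.exp_pos (2 * y.1.re)
    field_simp
    linear_combination Real.exp (2 * y.1.re) ^ 2 * quatForm m u.2 v.2 * hκc
  · change (A 0, Real.exp (2 * quatRe (0 : ℍ))) = (0, 1)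
    simp

/-- Since `β₁ = 0`, now `Im ℍ` splits off, and `r` and `ℍ^m` form the half space with height `e^r`.
-/
lemma prod_hyperbolic_H4 (hc₁ : 0 < c₁) (hc₂ : 0 < c₂) :
    Homothetic (H4.metric m c₁ c₂)
      (prodMetric (euclideanMetric 3) (hyperbolicMetric (4 * (m + 1) - 3))) ∧
      IsSymmetricAt (H4.metric m c₁ c₂) 1 := by
  obtain ⟨κ, hκ, hκc⟩ := exists_scale hc₁ hc₂
  obtain ⟨e, he⟩ := exists_isometry_quatForm (m := m) (d := 4 * (m + 1) - 3 - 1) (by omega)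
  let A : ModelSpace m →L[ℝ] EuclideanSpace ℝ (Fin 3) := imVec ∘L .fst ℝ ℍ (Fin m → ℍ)
  have hA : ∀ y, A y = imVec y.1 := fun _ => rfl
  let B : ModelSpace m →L[ℝ] EuclideanSpace ℝ (Fin (4 * (m + 1) - 3 - 1)) :=
    e.toContinuousLinearMap ∘L (κ • .snd ℝ ℍ (Fin m → ℍ))
  have hB : ∀ y, B y = e (κ • y.2) := fun _ => rfl
  refine ((isInduced_euclidean _).prod
    (isRestriction_hyperbolic (4 * (m + 1) - 3)).isInduced).homothetic
    (H4.isRestriction c₁ c₂) (c := 1 / c₁) (by positivity)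
    (f := fun y => (A y, (B y, Real.exp (quatRe y.1))))
    (f' := fun y => A.prod (B.prod (Real.exp (quatRe y.1) • (quatRe ∘L .fst ℝ ℍ (Fin m → ℍ)))))
    (k := fun w => (Real.log w.2.2 • (1 : ℍ) + ofIm w.1, κ⁻¹ • (e.symm w.2.1)))
    ((contMDiff_opens_space A.contDiff.contDiffOn).prodMk
      (contMDiff_opens_mk (V := hyperbolicSpace (4 * (m + 1) - 3))
      (f := fun y => (B y, Real.exp (quatRe y.1))) (by fun_prop) (fun x => Real.exp_pos _)))
    (fun _ => rfl)
    (fun y _ => ?_) (fun n => ?_) (fun _ => trivial) (fun y _ => ?_) (fun n => ?_)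
    (fun y _ u v => ?_) ((isSymmetricAt_const _ _).prod (isSymmetricAt_hyperbolic _ _ ?_))
  · exact A.hasFDerivAt.prodMk (B.hasFDerivAt.prodMk (hasFDerivAt_quatRe_fst y).exp)
  · have hn : n.2.1.2 ≠ 0 := (show 0 < n.2.1.2 from n.2.2).ne'
    have h1 : ContDiffAt ℝ ∞ (fun w : EuclideanSpace ℝ (Fin 3) × HalfSpaceAmbient (4 * (m + 1) - 3) =>
        Real.log w.2.2) (n.1, n.2.1) :=
      (contDiffAt_snd.comp _ contDiffAt_snd).log hn
    fun_prop
  · simp [hA, hB, smul_smul, hκ.ne', re_smul_one_add_im]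
  · have hn : 0 < n.2.1.2 := n.2.2
    refine Prod.ext ?_ (Prod.ext ?_ ?_)
    · simp [hA]
    · simp [hB, smul_smul, hκ.ne']
    · simp [Real.exp_log hn]
  · rw [ambientMetric_H4]
    change inner ℝ (imVec u.1) (imVec v.1) + hyperbolicForm (4 * (m + 1) - 3)
      (B y, Real.exp (quatRe y.1)) (B u, Real.exp (quatRe y.1) * quatRe u.1)
      (B v, Real.exp (quatRe y.1) * quatRe v.1) = _
    simp [hyperbolicForm_apply, hB, he, inner_smul_left, inner_smul_right, -map_smul]
    have := Real.exp_pos y.1.re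
    field_simp
    linear_combination quatForm m u.2 v.2 * hκc
  · change (B 0, Real.exp (quatRe (0 : ℍ))) = (0, 1)
    simp

end Model

end Submax

/-! ### Polar coordinates on `ℍ ∖ 0` and the models `ℋ₅`. -/

namespace Submax

open RiemGeom

variable {m : ℕ}

namespace Model

variable {c₁ c₂ : ℝ}

/-- The derivative of `y ↦ log |y.1|`. -/
def logNormDeriv (y : ModelSpace m) : ModelSpace m →L[ℝ] ℝ :=
  (‖y.1‖ ^ 2)⁻¹ • (innerSL ℝ y.1 ∘L .fst ℝ ℍ (Fin m → ℍ))

@[simp] lemma logNormDeriv_apply (y u : ModelSpace m) :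
    logNormDeriv y u = (‖y.1‖ ^ 2)⁻¹ * inner ℝ y.1 u.1 := rfl

lemma hasFDerivAt_log_norm {y : ModelSpace m} (hy : y.1 ≠ 0) :
    HasFDerivAt (fun y : ModelSpace m => Real.log ‖y.1‖) (logNormDeriv y) y := by
  have hn : 0 < ‖y.1‖ := norm_pos_iff.2 hy
  have h : HasFDerivAt (fun y : ModelSpace m => ‖y.1‖ ^ 2)
      ((2 • innerSL ℝ y.1) ∘L .fst ℝ ℍ (Fin m → ℍ)) y :=
    (hasStrictFDerivAt_norm_sq y.1).hasFDerivAt.comp y hasFDerivAt_fst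
  have h2 := (h.log (pow_pos hn 2).ne').const_mul (2⁻¹ : ℝ)
  refine (h2.congr_fderiv (ContinuousLinearMap.ext fun u => ?_)).congr_of_eventuallyEq ?_
  · simp
    ring
  · refine Filter.Eventually.of_forall fun z => ?_
    simp [Real.log_pow]

/-- The unit quaternion `a / |a|`, as point of the unit sphere of `ℝ⁴`. -/
def direction (L : ℍ ≃L[ℝ] EuclideanSpace ℝ (Fin (3 + 1))) (y : ModelSpace m) :
    EuclideanSpace ℝ (Fin (3 + 1)) := Real.exp (-Real.log ‖y.1‖) • L y.1

/-- The derivative of `direction L`. -/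
def directionDeriv (L : ℍ ≃L[ℝ] EuclideanSpace ℝ (Fin (3 + 1))) (y : ModelSpace m) :
    ModelSpace m →L[ℝ] EuclideanSpace ℝ (Fin (3 + 1)) :=
  Real.exp (-Real.log ‖y.1‖) • (L.toContinuousLinearMap ∘L .fst ℝ ℍ (Fin m → ℍ)) +
    (Real.exp (-Real.log ‖y.1‖) • -logNormDeriv y).smulRight (L y.1)

section Direction

variable {L : ℍ ≃L[ℝ] EuclideanSpace ℝ (Fin (3 + 1))} {y : ModelSpace m}

lemma hasFDerivAt_direction (hy : y.1 ≠ 0) :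
    HasFDerivAt (direction L) (directionDeriv L y) y :=
  (hasFDerivAt_log_norm hy).neg.exp.smul
    (L.toContinuousLinearMap ∘L .fst ℝ ℍ (Fin m → ℍ)).hasFDerivAt

lemma contDiffOn_direction (β : ℝ) :
    ContDiffOn ℝ ∞ (direction (m := m) L) ((H5 β).domain m) :=
  (contDiffOn_log_norm β).neg.exp.smul
    (L.toContinuousLinearMap ∘L .fst ℝ ℍ (Fin m → ℍ)).contDiff.contDiffOn

lemma direction_eq (hy : y.1 ≠ 0) : direction L y = ‖y.1‖⁻¹ • L y.1 := by
  rw [direction, Real.exp_neg, Real.exp_log (norm_pos_iff.2 hy)]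

lemma direction_mem (hL : ∀ a b, inner ℝ (L a) (L b) = inner ℝ a b) (hy : y.1 ≠ 0) :
    direction L y ∈ Metric.sphere (0 : EuclideanSpace ℝ (Fin (3 + 1))) 1 := by
  have hn : 0 < ‖y.1‖ := norm_pos_iff.2 hy
  have h : ‖L y.1‖ = ‖y.1‖ := by
    rw [← sq_eq_sq₀ (norm_nonneg _) (norm_nonneg _), ← real_inner_self_eq_norm_sq, hL,
      real_inner_self_eq_norm_sq]
  rw [mem_sphere_zero_iff_norm, direction_eq hy, norm_smul, h, norm_inv, norm_norm,
    inv_mul_cancel₀ hn.ne']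

lemma norm_symm_sphere (hL : ∀ a b, inner ℝ (L a) (L b) = inner ℝ a b) (n : ThreeSphere) :
    ‖L.symm n‖ = 1 := by
  rw [← sq_eq_sq₀ (norm_nonneg _) zero_le_one, ← real_inner_self_eq_norm_sq, ← hL,
    L.apply_symm_apply, real_inner_self_eq_norm_sq, norm_eq_of_mem_sphere]

/-- Polar decomposition of the conformal metric: `|dx|² / |x|²` is the metric of the sphere plus the
square of `d log |x|`. -/
lemma inner_directionDeriv (hL : ∀ a b, inner ℝ (L a) (L b) = inner ℝ a b) (hy : y.1 ≠ 0)
    (u v : ModelSpace m) : inner ℝ (directionDeriv L y u) (directionDeriv L y v) =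
      (‖y.1‖ ^ 2)⁻¹ * inner ℝ u.1 v.1 - logNormDeriv y u * logNormDeriv y v := by
  have hn : 0 < ‖y.1‖ := norm_pos_iff.2 hy
  have h : ∀ u, directionDeriv L y u =
      ‖y.1‖⁻¹ • L u.1 + (‖y.1‖⁻¹ * -((‖y.1‖ ^ 2)⁻¹ * inner ℝ y.1 u.1)) • L y.1 := fun u => by
    rw [← Real.exp_log hn, ← Real.exp_neg, Real.exp_log hn]; rfl
  simp only [h, inner_add_left, inner_add_right, inner_smul_left, inner_smul_right, hL,
    real_inner_self_eq_norm_sq, conj_trivial, logNormDeriv_apply, real_inner_comm y.1 u.1]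
  field_simp
  ring

end Direction

/-- Height `t = |x|^β`, with `dt / t = β d log |x|`. To match this the metric is scaled by `β² /
c₁`, which turns the unit sphere into one of radius `|β|`, of curvature `1 / β²`; on `ℍ^m` this
requires `c₁ κ² = β² c₂`. -/
lemma sphere_prod_hyperbolic_H5 (hc₁ : 0 < c₁) (hc₂ : 0 < c₂) {β : ℝ} (hβ : β ≠ 0) :
    Homothetic ((H5 β).metric m c₁ c₂)
      (prodMetric (sphereMetric (1 / β ^ 2)) (hyperbolicMetric (4 * (m + 1) - 3))) ∧
      IsSymmetricAt ((H5 β).metric m c₁ c₂) 1 := by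
  have hfin : Fact (Module.finrank ℝ (EuclideanSpace ℝ (Fin (3 + 1))) = 3 + 1) :=
    ⟨finrank_euclideanSpace_fin⟩
  obtain ⟨κ, hκ, hκc⟩ := exists_scale hc₁ (mul_pos (sq_pos_of_ne_zero hβ) hc₂)
  obtain ⟨e, he⟩ := exists_isometry_quatForm (m := m) (d := 4 * (m + 1) - 3 - 1) (by omega)
  obtain ⟨L, hL⟩ := exists_isometry_euclidean (V := ℍ) (d := 3 + 1) Quaternion.finrank_eq_four
  let B : ModelSpace m →L[ℝ] EuclideanSpace ℝ (Fin (4 * (m + 1) - 3 - 1)) :=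
    e.toContinuousLinearMap ∘L (κ • .snd ℝ ℍ (Fin m → ℍ))
  have hB : ∀ y, B y = e (κ • y.2) := fun _ => rfl
  refine ((isInduced_sphere _).prod
    (isRestriction_hyperbolic (4 * (m + 1) - 3)).isInduced).homothetic
    ((H5 β).isRestriction c₁ c₂) (c := β ^ 2 / c₁) (by positivity)
    (f := fun y => (direction L y, (B y, Real.exp (β * Real.log ‖y.1‖))))
    (f' := fun y => (directionDeriv L y).prod
      (B.prod (Real.exp (β * Real.log ‖y.1‖) • (β • logNormDeriv y))))
    (k := fun w => (Real.exp (Real.log w.2.2 / β) • L.symm w.1, κ⁻¹ • (e.symm w.2.1)))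
    (ContMDiff.prodMk (ContMDiff.codRestrict_sphere (contMDiff_opens_space (contDiffOn_direction β))
      fun x => direction_mem hL x.2)
      (contMDiff_opens_mk (V := hyperbolicSpace (4 * (m + 1) - 3))
      (f := fun y => (B y, Real.exp (β * Real.log ‖y.1‖)))
      (B.contDiff.contDiffOn.prodMk (contDiffOn_const.mul (contDiffOn_log_norm β)).exp)
        (fun x => Real.exp_pos _)))
    (fun _ => rfl)
    (fun y hy => ?_) (fun n => ?_) (fun n => ?_) (fun y hy => ?_) (fun n => ?_)
    (fun y hy u v => ?_) ((isSymmetricAt_sphere _ _).prod (isSymmetricAt_hyperbolic _ _ ?_))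
  · exact (hasFDerivAt_direction hy).prodMk
      (B.hasFDerivAt.prodMk ((hasFDerivAt_log_norm hy).const_mul β).exp)
  · have hn : n.2.1.2 ≠ 0 := (show 0 < n.2.1.2 from n.2.2).ne'
    have h1 : ContDiffAt ℝ ∞ (fun w : EuclideanSpace ℝ (Fin (3 + 1)) ×
        HalfSpaceAmbient (4 * (m + 1) - 3) => Real.log w.2.2) (n.1.1, n.2.1) :=
      (contDiffAt_snd.comp _ contDiffAt_snd).log hn
    fun_prop
  · have h := norm_symm_sphere hL n.1
    exact smul_ne_zero (Real.exp_pos _).ne' (norm_ne_zero_iff.1 (h.trans_ne one_ne_zero))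
  · have hy : y.1 ≠ 0 := hy
    have hn : 0 < ‖y.1‖ := norm_pos_iff.2 hy
    simp [direction_eq hy, hB, smul_smul, hκ.ne', hβ, Real.exp_log hn, hn.ne']
  · have hn : 0 < n.2.1.2 := n.2.2
    have h := norm_symm_sphere hL n.1
    refine Prod.ext ?_ (Prod.ext ?_ ?_)
    · simp [direction, norm_smul, h, smul_smul, ← Real.exp_add]
    · simp [hB, smul_smul, hκ.ne']
    · simp [norm_smul, h, mul_div_cancel₀, hβ, Real.exp_log hn]
  · have hy : y.1 ≠ 0 := hy
    have hn : 0 < ‖y.1‖ := norm_pos_iff.2 hy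
    have hr : Real.exp (β * Real.log ‖y.1‖) = ‖y.1‖ ^ β := by
      rw [mul_comm, Real.exp_mul, Real.exp_log hn]
    have hr' : 0 < ‖y.1‖ ^ β := Real.rpow_pos_of_pos hn β
    have h := inner_directionDeriv hL hy u v
    rw [ambientMetric_H5]
    change (1 / β ^ 2)⁻¹ * inner ℝ (directionDeriv L y u) (directionDeriv L y v) +
      hyperbolicForm (4 * (m + 1) - 3) (B y, Real.exp (β * Real.log ‖y.1‖))
        (B u, Real.exp (β * Real.log ‖y.1‖) * (β * logNormDeriv y u))
        (B v, Real.exp (β * Real.log ‖y.1‖) * (β * logNormDeriv y v)) = _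
    rw [h]
    simp [hyperbolicForm_apply, hB, he, inner_smul_left, inner_smul_right,
      -map_smul, hr]
    field_simp
    linear_combination ‖y.1‖ ^ 4 * quatForm m u.2 v.2 * hκc
  · change (B (1, 0), Real.exp (β * Real.log ‖(1 : ℍ)‖)) = (0, 1)
    simp [hB]

/-- For `β = 0` the metric on `ℍ^m` is constant, and `log |x|` joins it as one more flat coordinate.
-/
lemma sphere_prod_euclidean_H5 (hc₁ : 0 < c₁) (hc₂ : 0 < c₂) :
    Homothetic ((H5 0).metric m c₁ c₂)
      (prodMetric (sphereMetric 1) (euclideanMetric (4 * (m + 1) - 3))) ∧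
      IsSymmetricAt ((H5 0).metric m c₁ c₂) 1 := by
  have hfin : Fact (Module.finrank ℝ (EuclideanSpace ℝ (Fin (3 + 1))) = 3 + 1) :=
    ⟨finrank_euclideanSpace_fin⟩
  obtain ⟨κ, hκ, hκc⟩ := exists_scale hc₁ hc₂
  obtain ⟨e, he⟩ := exists_isometry_prod_quatForm (m := m) (V := ℝ) (d := 4 * (m + 1) - 3)
    (by rw [Module.finrank_self]; omega)
  obtain ⟨L, hL⟩ := exists_isometry_euclidean (V := ℍ) (d := 3 + 1) Quaternion.finrank_eq_four
  refine ((isInduced_sphere _).prod (isInduced_euclidean _)).homothetic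
    ((H5 0).isRestriction c₁ c₂) (c := 1 / c₁) (by positivity)
    (f := fun y => (direction L y, e (Real.log ‖y.1‖, κ • y.2)))
    (f' := fun y => (directionDeriv L y).prod
      (e.toContinuousLinearMap ∘L ((logNormDeriv y).prod (κ • .snd ℝ ℍ (Fin m → ℍ)))))
    (k := fun w => (Real.exp (e.symm w.2).1 • L.symm w.1, κ⁻¹ • (e.symm w.2).2))
    (ContMDiff.prodMk (ContMDiff.codRestrict_sphere (contMDiff_opens_space (contDiffOn_direction 0))
      fun x => direction_mem hL x.2)
      (contMDiff_opens_space (f := fun y => e (Real.log ‖y.1‖, κ • y.2))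
        (e.contDiff.comp_contDiffOn
        ((contDiffOn_log_norm 0).prodMk (contDiff_snd.const_smul κ).contDiffOn))))
    (fun _ => rfl)
    (fun y hy => ?_) (fun n => ?_) (fun n => ?_) (fun y hy => ?_) (fun n => ?_)
    (fun y hy u v => ?_) ((isSymmetricAt_sphere _ _).prod (isSymmetricAt_const _ _))
  · exact (hasFDerivAt_direction hy).prodMk (e.hasFDerivAt.comp y
      ((hasFDerivAt_log_norm hy).prodMk (κ • ContinuousLinearMap.snd ℝ ℍ (Fin m → ℍ)).hasFDerivAt))
  · fun_prop
  · have h := norm_symm_sphere hL n.1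
    exact smul_ne_zero (Real.exp_pos _).ne' (norm_ne_zero_iff.1 (h.trans_ne one_ne_zero))
  · have hy : y.1 ≠ 0 := hy
    have hn : 0 < ‖y.1‖ := norm_pos_iff.2 hy
    simp [direction_eq hy, smul_smul, hκ.ne', Real.exp_log hn, hn.ne']
  · have h := norm_symm_sphere hL n.1
    refine Prod.ext ?_ ?_
    · simp [direction, norm_smul, h, smul_smul, ← Real.exp_add]
    · simp [norm_smul, h, smul_smul, hκ.ne']
  · have hy : y.1 ≠ 0 := hy
    have hn : 0 < ‖y.1‖ := norm_pos_iff.2 hy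
    have h := inner_directionDeriv hL hy u v
    rw [ambientMetric_H5]
    change 1⁻¹ * inner ℝ (directionDeriv L y u) (directionDeriv L y v) +
      inner ℝ (e (logNormDeriv y u, κ • u.2)) (e (logNormDeriv y v, κ • v.2)) = _
    rw [h]
    simp [he, -map_smul]
    field_simp
    linear_combination ‖y.1‖ ^ 4 * quatForm m u.2 v.2 * hκc

end Model

end Submax

/-! ### Quaternionic hyperbolic space, the Cayley transform and the models `ℋ₁`. -/

namespace RiemGeom

/-! ### The ball model of the quaternionic hyperbolic space -/

/-- The metric of the quaternionic hyperbolic space as field of forms on `ℍ^d`. -/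
def ballForm (d : ℕ) (z : Fin d → ℍ) : (Fin d → ℍ) →L[ℝ] (Fin d → ℍ) →L[ℝ] ℝ :=
  (1 - quatForm d z z)⁻¹ • quatForm d +
    ((1 - quatForm d z z) ^ 2)⁻¹ •
      (innerSL ℝ : ℍ →L[ℝ] ℍ →L[ℝ] ℝ).bilinearComp (σ₁₃ := .id ℝ) (σ₂₃ := .id ℝ)
        (quatHermitian d z) (quatHermitian d z)

lemma ballForm_apply (d : ℕ) (z u v : Fin d → ℍ) : ballForm d z u v =
    (1 - quatForm d z z)⁻¹ * quatForm d u v + ((1 - quatForm d z z) ^ 2)⁻¹ *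
      inner ℝ (quatHermitian d z u) (quatHermitian d z v) := rfl

lemma ballForm_comm {d : ℕ} (z u v : Fin d → ℍ) : ballForm d z u v = ballForm d z v u := by
  rw [ballForm_apply, ballForm_apply, Submax.quatForm_comm u, real_inner_comm]

lemma isRestriction_ball (d : ℕ) : IsRestriction (quatHyperbolicMetric d) (ballForm d) :=
  fun _ _ _ => rfl

lemma quatHermitian_apply {d : ℕ} (z u : Fin d → ℍ) :
    quatHermitian d z u = ∑ l, star (z l) * u l := by
  simp [quatHermitian]

lemma quatForm_eq_sum_inner {d : ℕ} (z u : Fin d → ℍ) :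
    quatForm d z u = ∑ l, inner ℝ (z l) (u l) := by
  simp [quatForm]

lemma isSymmetricAt_ball (d : ℕ) {p : quatHyperbolicSpace d} (hp : p.1 = 0) :
    IsSymmetricAt (quatHyperbolicMetric d) p := by
  have hq : ∀ z : Fin d → ℍ, quatForm d (-z) (-z) = quatForm d z z := fun z => by simp
  have hh : ∀ z u : Fin d → ℍ, quatHermitian d (-z) (-u) = quatHermitian d z u := fun z u => by
    simp [quatHermitian_apply]
  refine (isRestriction_ball d).isSymmetricAt (s := fun z => -z)
    (s' := fun _ => -(ContinuousLinearMap.id ℝ (Fin d → ℍ))) contDiff_neg.contDiffOn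
    (fun y _ => (hasFDerivAt_id y).neg) (fun y hy => ?_) (fun y _ => neg_neg y)
    (fun y _ u v => ?_) (by rw [hp, neg_zero]) (fun _ => rfl)
  · change quatForm d (-y) (-y) < 1
    rw [hq]
    exact hy
  · change ballForm d (-y) (-u) (-v) = _
    rw [ballForm_apply, ballForm_apply, hq, hh, hh]
    simp

end RiemGeom

namespace Submax

open RiemGeom

variable {m : ℕ}

lemma quatForm_cons (a b : ℍ) (p q : Fin m → ℍ) :
    quatForm (m + 1) (Fin.cons a p) (Fin.cons b q) = inner ℝ a b + quatForm m p q := by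
  simp [quatForm_eq_sum_inner, Fin.sum_univ_succ]

lemma quatHermitian_cons (a b : ℍ) (p q : Fin m → ℍ) :
    quatHermitian (m + 1) (Fin.cons a p) (Fin.cons b q) = star a * b + quatHermitian m p q := by
  simp [quatHermitian_apply, Fin.sum_univ_succ]

/-! ### The Cayley transform -/

/-- The Cayley transform from the Siegel domain to the ball, in terms of `D = ζ + 1`. -/
def cayley (D : ℍ) (q : Fin m → ℍ) : Fin (m + 1) → ℍ :=
  Fin.cons (1 - (2 : ℝ) • D⁻¹) fun l => √2 • (q l * D⁻¹)

/-- The differential of the Cayley transform at `(D, q)`, in the direction `(a, u)`. -/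
def cayleyDeriv (D : ℍ) (q : Fin m → ℍ) (a : ℍ) (u : Fin m → ℍ) : Fin (m + 1) → ℍ :=
  Fin.cons ((2 : ℝ) • (D⁻¹ * a * D⁻¹)) fun l => √2 • ((u l - q l * (D⁻¹ * a)) * D⁻¹)

lemma quatForm_mul_same (p q : Fin m → ℍ) (a : ℍ) :
    quatForm m (fun l => p l * a) (fun l => q l * a) = ‖a‖ ^ 2 * quatForm m p q := by
  simp only [quatForm_eq_sum_inner, inner_quat_mul_right, Finset.mul_sum]

lemma inner_quatHermitian (q u : Fin m → ℍ) (e : ℍ) :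
    inner ℝ e (quatHermitian m q u) = quatForm m (fun l => q l * e) u := by
  rw [quatHermitian_apply, quatForm_eq_sum_inner, inner_sum]
  refine Finset.sum_congr rfl fun l _ => ?_
  rw [Quaternion.inner_def, Quaternion.inner_def]
  simp
  ring

lemma quatHermitian_mul_self (q : Fin m → ℍ) (e : ℍ) :
    quatHermitian m q (fun l => q l * e) = quatForm m q q • e := by
  simp only [quatHermitian_apply, quatForm_self, ← mul_assoc, Quaternion.star_mul_self,
    Quaternion.normSq_eq_norm_mul_self, Quaternion.coe_mul_eq_smul, Finset.sum_smul, sq]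

lemma quatHermitian_mul_mul (p u : Fin m → ℍ) (a b : ℍ) :
    quatHermitian m (fun l => p l * a) (fun l => u l * b) = star a * quatHermitian m p u * b := by
  simp only [quatHermitian_apply, Finset.mul_sum, Finset.sum_mul, star_mul, mul_assoc]

lemma quatHermitian_smul_smul (c d : ℝ) (p u : Fin m → ℍ) :
    quatHermitian m (c • p) (d • u) = (c * d) • quatHermitian m p u := by
  simp [quatHermitian_apply, Finset.smul_sum, smul_smul, mul_comm]

lemma inner_self_mul (e D : ℍ) : inner ℝ e (D * e) = D.re * ‖e‖ ^ 2 := by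
  rw [← real_inner_self_eq_norm_sq, Quaternion.inner_def, Quaternion.inner_def]
  simp
  ring

/-- In terms of `ζ = D - 1` the numerator is `4 (Re ζ - |q|² / 2)`: the unit ball corresponds to the
Siegel domain. -/
lemma one_sub_quatForm_cayley {D : ℍ} (hD : D ≠ 0) (q : Fin m → ℍ) :
    1 - quatForm (m + 1) (cayley D q) (cayley D q) =
      (4 * D.re - 4 - 2 * quatForm m q q) / ‖D‖ ^ 2 := by
  have hn : 0 < ‖D‖ := norm_pos_iff.2 hD
  have h1 : (fun l => √2 • (q l * D⁻¹)) = √2 • fun l => q l * D⁻¹ := rfl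
  have h2 : inner ℝ (1 : ℍ) D⁻¹ = D.re / ‖D‖ ^ 2 := by
    have := inner_quat_mul_left D 1 D⁻¹
    rw [mul_inv_cancel₀ hD, mul_one, Quaternion.inner_def] at this
    rw [eq_div_iff (by positivity), mul_comm, ← this]
    simp
  have h3 : √2 * √2 = 2 := Real.mul_self_sqrt (by norm_num)
  rw [cayley, quatForm_cons, h1, map_smul, map_smul, smul_apply, quatForm_mul_same,
    inner_sub_left, inner_sub_right, inner_sub_right, inner_smul_left, inner_smul_left,
    inner_smul_right, inner_smul_right, real_inner_comm 1 D⁻¹, h2, real_inner_self_eq_norm_sq,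
    real_inner_self_eq_norm_sq, norm_inv, smul_eq_mul, smul_eq_mul, conj_trivial]
  simp
  field_simp
  linear_combination quatForm m q q * -h3

/-- The ball metric on the Siegel domain, where `ρ = Re ζ - |q|² / 2`. Only the diagonal is
computed, so that products of quaternions enter through norms; polarization recovers the rest. -/
lemma ballForm_cayley {D : ℍ} {q : Fin m → ℍ} {ρ : ℝ} (hρ : 0 < ρ)
    (hD : D.re = ρ + quatForm m q q / 2 + 1) (a : ℍ) (u : Fin m → ℍ) :
    ballForm (m + 1) (cayley D q) (cayleyDeriv D q a u) (cayleyDeriv D q a u) =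
      ‖a - quatHermitian m q u‖ ^ 2 / (4 * ρ ^ 2) + quatForm m u u / (2 * ρ) := by
  have hD0 : D ≠ 0 := by
    rintro rfl
    have := quatForm_self_nonneg q
    simp at hD
    linarith
  have hn : 0 < ‖D‖ := norm_pos_iff.2 hD0
  have h3 : √2 * √2 = 2 := Real.mul_self_sqrt (by norm_num)
  -- Writing `a = D e` removes the factors `D⁻¹` inside the differential. The remaining outer
  -- factors contribute only powers of the norm of `D`.
  obtain ⟨e, rfl⟩ : ∃ e, a = D * e := ⟨D⁻¹ * a, by rw [mul_inv_cancel_left₀ hD0]⟩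
  set h := quatHermitian m q u with hh
  set Q := quatForm m q q with hQ
  have hw : ∀ l, u l - q l * (D⁻¹ * (D * e)) = u l - q l * e := fun l => by
    rw [inv_mul_cancel_left₀ hD0]
  have hwf : quatForm m (fun l => u l - q l * e) (fun l => u l - q l * e) =
      quatForm m u u - 2 * inner ℝ e h + Q * ‖e‖ ^ 2 := by
    have : (fun l => u l - q l * e) = u - fun l => q l * e := rfl
    rw [this, hh, inner_quatHermitian]
    simp only [map_sub, sub_apply, quatForm_mul_same, quatForm_comm u]
    ring
  have hwh : quatHermitian m q (fun l => u l - q l * e) = h - Q • e := by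
    have : (fun l => u l - q l * e) = u - fun l => q l * e := rfl
    rw [this, map_sub, quatHermitian_mul_self]
  have hform : quatForm (m + 1) (cayleyDeriv D q (D * e) u) (cayleyDeriv D q (D * e) u) =
      (4 * ‖e‖ ^ 2 + 2 * (quatForm m u u - 2 * inner ℝ e h + Q * ‖e‖ ^ 2)) / ‖D‖ ^ 2 := by
    have h1 : (fun l => √2 • ((u l - q l * e) * D⁻¹)) = √2 • fun l => (u l - q l * e) * D⁻¹ := rfl
    simp only [cayleyDeriv, hw]
    rw [quatForm_cons, h1, map_smul, map_smul, smul_apply, quatForm_mul_same, hwf,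
      inv_mul_cancel_left₀ hD0, inner_smul_left, inner_smul_right, inner_quat_mul_right,
      real_inner_self_eq_norm_sq, norm_inv, smul_eq_mul, smul_eq_mul, conj_trivial]
    field_simp
    linear_combination (quatForm m u u - 2 * inner ℝ e h + ‖e‖ ^ 2 * Q) * h3
  have hherm : quatHermitian (m + 1) (cayley D q) (cayleyDeriv D q (D * e) u) =
      star D⁻¹ * ((2 : ℝ) • ((2 * ρ) • e - (D * e - h)) * D⁻¹) := by
    simp only [cayley, cayleyDeriv, hw]
    have h1 : (fun l => √2 • (q l * D⁻¹)) = √2 • fun l => q l * D⁻¹ := rfl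
    have h2 : (fun l => √2 • ((u l - q l * e) * D⁻¹)) = √2 • fun l => (u l - q l * e) * D⁻¹ := rfl
    have h4 : star D⁻¹ * star D = 1 := by rw [← star_mul, mul_inv_cancel₀ hD0, star_one]
    have h5 : star (1 - (2 : ℝ) • D⁻¹) = star D⁻¹ * (star D - 2) := by
      rw [mul_sub, h4, star_sub, star_one, Quaternion.star_smul, mul_two, two_smul]
    -- `star D` is expressed by `Re D = ρ + Q / 2 + 1`, so that the terms in `Q • e` cancel and the
    -- combination `a - h` with `a = D e` emerges.
    have h6 : star D = (2 * D.re : ℝ) • (1 : ℍ) - D := by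
      ext <;> simp; ring
    rw [quatHermitian_cons, h1, h2, quatHermitian_smul_smul, h3, quatHermitian_mul_mul, hwh, h5,
      inv_mul_cancel_left₀ hD0, h6, hD]
    have h7 : ((2 * (ρ + Q / 2 + 1)) • (1 : ℍ) - D - 2) * ((2 : ℝ) • e) + (2 : ℝ) • (h - Q • e) =
        (2 : ℝ) • ((2 * ρ) • e - (D * e - h)) := by
      rw [sub_mul, sub_mul, smul_one_mul, mul_smul_comm, two_mul (_ : ℍ)]
      module
    rw [← h7]
    simp only [mul_add, add_mul, smul_mul_assoc, mul_smul_comm, mul_assoc]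
  have hsq : ‖(2 * ρ) • e - (D * e - h)‖ ^ 2 = 4 * ρ ^ 2 * ‖e‖ ^ 2 -
      4 * ρ * (D.re * ‖e‖ ^ 2 - inner ℝ e h) + ‖D * e - h‖ ^ 2 := by
    rw [norm_sub_sq_real, norm_smul, inner_smul_left, inner_sub_right, inner_self_mul,
      conj_trivial, Real.norm_eq_abs, mul_pow, sq_abs]
    ring
  rw [ballForm_apply, one_sub_quatForm_cayley hD0, hform, hherm, real_inner_self_eq_norm_sq,
    norm_mul, norm_mul, norm_smul, norm_star, norm_inv, mul_pow, mul_pow, mul_pow, hsq, hD, ← hQ,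
    show 4 * (ρ + Q / 2 + 1) - 4 - 2 * Q = 4 * ρ by ring, Real.norm_ofNat]
  field_simp
  ring

/-- The differential of the Cayley transform at `(D, q)`. -/
def cayleyCLM (D : ℍ) (q : Fin m → ℍ) : ModelSpace m →L[ℝ] (Fin (m + 1) → ℍ) :=
  LinearMap.toContinuousLinearMap
    { toFun := fun u => cayleyDeriv D q u.1 u.2
      map_add' := fun u v => by
        funext l
        refine Fin.cases ?_ (fun l => ?_) l
        · simp [cayleyDeriv, mul_add, add_mul]
        · simp only [cayleyDeriv, Fin.cons_succ, Pi.add_apply, Prod.fst_add, Prod.snd_add, mul_add,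
            add_mul, sub_mul, smul_add, smul_sub]
          abel
      map_smul' := fun c u => by
        funext l
        refine Fin.cases ?_ (fun l => ?_) l
        · simp [cayleyDeriv, smul_comm c]
        · simp [cayleyDeriv, smul_comm c, ← smul_sub] }

@[simp] lemma cayleyCLM_apply (D : ℍ) (q : Fin m → ℍ) (u : ModelSpace m) :
    cayleyCLM D q u = cayleyDeriv D q u.1 u.2 := rfl

lemma hasFDerivAt_cayley {x : ModelSpace m} (hx : x.1 ≠ 0) :
    HasFDerivAt (fun x : ModelSpace m => cayley x.1 x.2) (cayleyCLM x.1 x.2) x := by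
  have h1 : HasFDerivAt (fun x : ModelSpace m => x.1⁻¹)
      (-ContinuousLinearMap.mulLeftRight ℝ ℍ x.1⁻¹ x.1⁻¹ ∘L .fst ℝ ℍ (Fin m → ℍ)) x :=
    (hasFDerivAt_inv' hx).comp x hasFDerivAt_fst
  refine hasFDerivAt_pi'' fun l => Fin.cases ?_ (fun l => ?_) l
  · refine ((h1.const_smul (2 : ℝ)).const_sub (1 : ℍ)).congr_fderiv
      (ContinuousLinearMap.ext fun u => ?_)
    simp [cayleyDeriv]
  · have h2 : HasFDerivAt (fun x : ModelSpace m => x.2 l)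
        (.proj (R := ℝ) (φ := fun _ : Fin m => ℍ) l ∘L .snd ℝ ℍ (Fin m → ℍ)) x :=
      (ContinuousLinearMap.proj (R := ℝ) (φ := fun _ : Fin m => ℍ) l ∘L
        .snd ℝ ℍ (Fin m → ℍ)).hasFDerivAt
    refine ((h2.mul' h1).const_smul √2).congr_fderiv (ContinuousLinearMap.ext fun u => ?_)
    simp [cayleyDeriv, sub_mul, mul_assoc, smul_sub]
    abel

lemma contDiffAt_quat_inv {a : ℍ} (ha : a ≠ 0) : ContDiffAt ℝ ∞ (fun a : ℍ => a⁻¹) a := by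
  simpa using contDiffAt_ringInverse ℝ (Units.mk0 a ha)

lemma contDiffAt_cayley {x : ModelSpace m} (hx : x.1 ≠ 0) :
    ContDiffAt ℝ ∞ (fun x : ModelSpace m => cayley x.1 x.2) x := by
  have h1 : ContDiffAt ℝ ∞ (fun x : ModelSpace m => x.1⁻¹) x :=
    (contDiffAt_quat_inv hx).comp x contDiffAt_fst
  refine contDiffAt_pi.2 fun l => Fin.cases ?_ (fun l => ?_) l
  · exact contDiffAt_const.sub (h1.const_smul (2 : ℝ))
  · exact (ContDiffAt.mul (f := fun x : ModelSpace m => x.2 l) (by fun_prop) h1).const_smul √2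

/-- The coordinate `D` of the inverse of the Cayley transform. -/
def cayleyInv (z : Fin (m + 1) → ℍ) : ℍ := (2 : ℝ) • (1 - z 0)⁻¹

/-- The coordinates `q` of the inverse of the Cayley transform. -/
def cayleyInvTail (z : Fin (m + 1) → ℍ) : Fin m → ℍ :=
  fun l => (√2)⁻¹ • (z l.succ * cayleyInv z)

lemma cayleyInv_cayley (D : ℍ) (q : Fin m → ℍ) : cayleyInv (cayley D q) = D := by
  simp [cayleyInv, cayley, smul_inv₀, smul_smul]

lemma cayleyInvTail_cayley {D : ℍ} (hD : D ≠ 0) (q : Fin m → ℍ) :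
    cayleyInvTail (cayley D q) = q := by
  funext l
  rw [cayleyInvTail, cayleyInv_cayley]
  simp [cayley, smul_smul, hD]

lemma cayleyInv_ne_zero {z : Fin (m + 1) → ℍ} (hz : z 0 ≠ 1) : cayleyInv z ≠ 0 :=
  smul_ne_zero two_ne_zero (inv_ne_zero (sub_ne_zero.2 hz.symm))

lemma cayley_cayleyInv {z : Fin (m + 1) → ℍ} (hz : z 0 ≠ 1) :
    cayley (cayleyInv z) (cayleyInvTail z) = z := by
  have h := cayleyInv_ne_zero hz
  funext l
  refine Fin.cases ?_ (fun l => ?_) l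
  · simp [cayley, cayleyInv, smul_inv₀, smul_smul]
  · simp [cayley, cayleyInvTail, smul_smul, h]

lemma ne_one_of_quatForm_lt {z : Fin (m + 1) → ℍ} (hz : quatForm (m + 1) z z < 1) : z 0 ≠ 1 := by
  intro h
  rw [quatForm_self] at hz
  have := Finset.single_le_sum (f := fun l => ‖z l‖ ^ 2) (fun _ _ => sq_nonneg _)
    (Finset.mem_univ (0 : Fin (m + 1)))
  simp only [h, norm_one, one_pow] at this
  linarith

/-- The inverse map takes the logarithm of this quantity. It is positive because `1 - |z|²` is `4 /
|D|²` times it. -/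
lemma cayleyInv_re_pos {z : Fin (m + 1) → ℍ} (hz : quatForm (m + 1) z z < 1) :
    0 < (cayleyInv z).re - 1 - quatForm m (cayleyInvTail z) (cayleyInvTail z) / 2 := by
  have h0 := ne_one_of_quatForm_lt hz
  have h1 := cayleyInv_ne_zero h0
  have h2 := one_sub_quatForm_cayley h1 (cayleyInvTail z)
  have hn : 0 < ‖cayleyInv z‖ ^ 2 := pow_pos (norm_pos_iff.2 h1) 2
  rw [cayley_cayleyInv h0, eq_div_iff hn.ne'] at h2
  have := mul_pos (sub_pos.2 hz) hn
  linarith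

lemma contDiffAt_cayleyInv {z : Fin (m + 1) → ℍ} (hz : z 0 ≠ 1) :
    ContDiffAt ℝ ∞ (cayleyInv (m := m)) z :=
  ((contDiffAt_quat_inv (sub_ne_zero.2 hz.symm)).comp
    (f := fun z : Fin (m + 1) → ℍ => 1 - z 0) z (by fun_prop)).const_smul (2 : ℝ)

lemma contDiffAt_cayleyInvTail {z : Fin (m + 1) → ℍ} (hz : z 0 ≠ 1) :
    ContDiffAt ℝ ∞ (cayleyInvTail (m := m)) z :=
  contDiffAt_pi.2 fun l => (ContDiffAt.mul (f := fun z : Fin (m + 1) → ℍ => z l.succ)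
    (by fun_prop) (contDiffAt_cayleyInv hz)).const_smul (√2)⁻¹

namespace Model

variable {c₁ c₂ : ℝ}

lemma ambientMetric_H1_self (ε : ℤˣ) (y u : ModelSpace m) :
    (H1 ε).ambientMetric m c₁ c₂ y u u =
      c₁ * (u.1.re ^ 2 + (Real.exp (2 * y.1.re) ^ 2)⁻¹ *
        ‖u.1.im - (((ε : ℤ) : ℝ) / 2) • theta y.2 u.2‖ ^ 2) +
      c₂ * ((Real.exp (2 * y.1.re))⁻¹ * quatForm m u.2 u.2) := by
  change modelForm m c₁ c₂ (solvDL ((ε : ℤ) : ℝ) 2 1 (solvInv 2 1 y) u)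
    (solvDL ((ε : ℤ) : ℝ) 2 1 (solvInv 2 1 y) u) = _
  have h : Real.exp (2 * y.1.re) = Real.exp y.1.re ^ 2 := by
    rw [sq, ← Real.exp_add, two_mul]
  have h0 := Real.exp_pos y.1.re
  rw [modelForm_apply, ← real_inner_self_eq_norm_sq, Quaternion.inner_def]
  have ht : theta (-((Real.exp y.1.re)⁻¹ • y.2)) u.2 = -((Real.exp y.1.re)⁻¹ • theta y.2 u.2) := by
    rw [← neg_smul, theta_smul_left, neg_smul]
  simp [solvDL, solvInv, Real.exp_neg, h, ht, -theta_imI, -theta_imJ, -theta_imK]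
  field_simp
  ring

/-- The point `ζ + 1` of the coordinate `ζ` on the Siegel domain. -/
def siegel (ε : ℤˣ) (y : ModelSpace m) : ℍ :=
  (Real.exp (2 * quatRe y.1) + quatForm m y.2 y.2 / 2 + 1) • (1 : ℍ) +
    (2 * ((ε : ℤ) : ℝ)) • quatIm y.1

/-- The differential of `siegel`. -/
def siegelDeriv (ε : ℤˣ) (y : ModelSpace m) : ModelSpace m →L[ℝ] ℍ :=
  ((2 * Real.exp (2 * quatRe y.1)) • (quatRe ∘L .fst ℝ ℍ (Fin m → ℍ)) +
    quatForm m y.2 ∘L .snd ℝ ℍ (Fin m → ℍ)).smulRight (1 : ℍ) +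
    (2 * ((ε : ℤ) : ℝ)) • (quatIm ∘L .fst ℝ ℍ (Fin m → ℍ))

lemma siegel_re (ε : ℤˣ) (y : ModelSpace m) :
    (siegel ε y).re = Real.exp (2 * y.1.re) + quatForm m y.2 y.2 / 2 + 1 := by
  simp [siegel]

lemma siegel_ne_zero (ε : ℤˣ) (y : ModelSpace m) : siegel ε y ≠ 0 := by
  intro h
  have h1 := siegel_re ε y
  have h2 := quatForm_self_nonneg y.2
  have h3 := Real.exp_pos (2 * y.1.re)
  rw [h, Quaternion.re_zero] at h1
  linarith

lemma contDiff_siegel (ε : ℤˣ) : ContDiff ℝ ∞ (siegel (m := m) ε) := by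
  unfold siegel
  fun_prop

lemma hasFDerivAt_siegel (ε : ℤˣ) (y : ModelSpace m) :
    HasFDerivAt (siegel ε) (siegelDeriv ε y) y := by
  have h1 := ((hasFDerivAt_quatRe_fst y).const_mul 2).exp
  have h2 : HasFDerivAt (fun y : ModelSpace m => quatForm m y.2 y.2)
      (quatForm m y.2 ∘L .snd ℝ ℍ (Fin m → ℍ) + (quatForm m y.2 ∘L .snd ℝ ℍ (Fin m → ℍ))) y := by
    have h3 : HasFDerivAt (fun y : ModelSpace m => quatForm m y.2)
      (quatForm m ∘L .snd ℝ ℍ (Fin m → ℍ)) y :=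
      (quatForm m ∘L .snd ℝ ℍ (Fin m → ℍ)).hasFDerivAt
    refine (h3.clm_apply hasFDerivAt_snd).congr_fderiv (ContinuousLinearMap.ext fun u => ?_)
    simp [quatForm_comm u.2]
  have h4 := (((h1.add (h2.mul_const (2⁻¹ : ℝ))).add_const (1 : ℝ)).smul_const (1 : ℍ)).add
    ((quatIm ∘L .fst ℝ ℍ (Fin m → ℍ)).hasFDerivAt.const_smul (2 * ((ε : ℤ) : ℝ)))
  refine h4.congr_fderiv (ContinuousLinearMap.ext fun u => ?_)
  simp [siegelDeriv]
  ring_nf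

/-- The real part `⟨q, dq⟩` cancels the derivative of `|q|² / 2`, and the imaginary part is `Θ(q,
dq)`. As `ε² = 1`, the factor `2 ε` in `siegel` produces exactly the invariant form `dv - (ε / 2)
Θ(q, dq)` of either sign. -/
lemma siegelDeriv_sub (ε : ℤˣ) (y u : ModelSpace m) :
    siegelDeriv ε y u - quatHermitian m y.2 u.2 =
      (2 * Real.exp (2 * y.1.re) * u.1.re) • (1 : ℍ) +
        (2 * ((ε : ℤ) : ℝ)) • (u.1.im - (((ε : ℤ) : ℝ) / 2) • theta y.2 u.2) := by
  have hε : ((ε : ℤ) : ℝ) * ((ε : ℤ) : ℝ) = 1 := by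
    rcases Int.units_eq_one_or ε with rfl | rfl <;> simp
  have h : quatHermitian m y.2 u.2 = quatForm m y.2 u.2 • (1 : ℍ) + theta y.2 u.2 := by
    have h1 := inner_quatHermitian y.2 u.2 1
    have h2 := inner_quatHermitian y.2 u.2 qi
    have h3 := inner_quatHermitian y.2 u.2 qj
    have h4 := inner_quatHermitian y.2 u.2 qk
    rw [Quaternion.inner_def] at h1 h2 h3 h4
    ext
    · simpa using h1
    · simpa using h2
    · simpa using h3
    · simpa using h4
  rw [h, smul_sub, smul_smul, show 2 * ((ε : ℤ) : ℝ) * (((ε : ℤ) : ℝ) / 2) = 1 by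
    linear_combination hε, one_smul]
  simp [siegelDeriv]
  module

lemma norm_sq_smul_one_add {w : ℍ} (hw : w.re = 0) (s t : ℝ) :
    ‖s • (1 : ℍ) + t • w‖ ^ 2 = s ^ 2 + t ^ 2 * ‖w‖ ^ 2 := by
  rw [← real_inner_self_eq_norm_sq, ← real_inner_self_eq_norm_sq, Quaternion.inner_def,
    Quaternion.inner_def]
  simp [hw]
  ring

/-- Polarization. -/
lemma eq_of_diag {E : Type*} [NormedAddCommGroup E] [NormedSpace ℝ E] {B C : E →L[ℝ] E →L[ℝ] ℝ}
    (hB : ∀ u v, B u v = B v u) (hC : ∀ u v, C u v = C v u) (h : ∀ u, B u u = C u u) (u v : E) :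
    B u v = C u v := by
  have h1 := h (u + v)
  simp only [map_add, add_apply, hB v u, hC v u, h u, h v] at h1
  linarith

/-- In horospherical coordinates `ρ = e^{2r}` and `Im ζ = 2 ε v`, the ball metric becomes `dr² +
e^{-4r} |dv - (ε / 2) Θ(q, dq)|² + ½ e^{-2r} |dq|²`. Multiplied by `c₁` it is the metric of the
model, since `c₁ / 2 = c₂`. -/
lemma quatHyperbolic_H1 (hc₁ : 0 < c₁) (hc₂ : 0 < c₂) (h : c₁ = 2 * c₂) (ε : ℤˣ) :
    Homothetic ((H1 ε).metric m c₁ c₂) (quatHyperbolicMetric (m + 1)) ∧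
      IsSymmetricAt ((H1 ε).metric m c₁ c₂) 1 := by
  have hε : ((ε : ℤ) : ℝ) * ((ε : ℤ) : ℝ) = 1 := by
    rcases Int.units_eq_one_or ε with rfl | rfl <;> simp
  have hball : ∀ y : ModelSpace m, quatForm (m + 1) (cayley (siegel ε y) y.2)
      (cayley (siegel ε y) y.2) < 1 := fun y => by
    rw [← sub_pos, one_sub_quatForm_cayley (siegel_ne_zero ε y), siegel_re]
    have h2 := Real.exp_pos (2 * y.1.re)
    have h3 := norm_pos_iff.2 (siegel_ne_zero ε y)
    exact div_pos (by linarith) (pow_pos h3 2)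
  refine (isRestriction_ball (m + 1)).isInduced.homothetic ((H1 ε).isRestriction c₁ c₂)
    (c := 1 / c₁) (by positivity)
    (f := fun y => cayley (siegel ε y) y.2)
    (f' := fun y => cayleyCLM (siegel ε y) y.2 ∘L (siegelDeriv ε y).prod (.snd ℝ ℍ (Fin m → ℍ)))
    (k := fun z => ((Real.log ((cayleyInv z).re - 1 -
      quatForm m (cayleyInvTail z) (cayleyInvTail z) / 2) / 2) • (1 : ℍ) +
        (((ε : ℤ) : ℝ) / 2) • quatIm (cayleyInv z), cayleyInvTail z))
    (contMDiff_opens_mk (V := quatHyperbolicSpace (m + 1))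
      (f := fun y => cayley (siegel ε y) y.2) (fun y _ => ?_)
      (fun x => hball x.1)) (fun _ => rfl)
    (fun y _ => ?_) (fun n => ?_) (fun _ => trivial) (fun y _ => ?_) (fun n => ?_)
    (fun y _ u v => ?_) (isSymmetricAt_ball _ ?_)
  · exact ((contDiffAt_cayley (x := (siegel ε y, y.2)) (siegel_ne_zero ε y)).comp y
      ((contDiff_siegel ε).prodMk contDiff_snd).contDiffAt).contDiffWithinAt
  · exact (hasFDerivAt_cayley (x := (siegel ε y, y.2)) (siegel_ne_zero ε y)).comp y
      ((hasFDerivAt_siegel ε y).prodMk hasFDerivAt_snd)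
  · have hz := ne_one_of_quatForm_lt n.2
    have h1 := contDiffAt_cayleyInv hz
    have h2 := contDiffAt_cayleyInvTail hz
    have h3 : ContDiffAt ℝ ∞ (fun z => Real.log (quatRe (cayleyInv z) - 1 -
        quatForm m (cayleyInvTail z) (cayleyInvTail z) / 2)) n.1 :=
      ContDiffAt.log (by fun_prop) (cayleyInv_re_pos n.2).ne'
    exact (((h3.div_const 2).smul contDiffAt_const).add
      ((quatIm.contDiff.contDiffAt.comp _ h1).const_smul (((ε : ℤ) : ℝ) / 2))).prodMk h2
  · refine Prod.ext ?_ ?_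
    · simp only [cayleyInv_cayley, cayleyInvTail_cayley (siegel_ne_zero ε y), siegel_re]
      rw [show Real.exp (2 * y.1.re) + quatForm m y.2 y.2 / 2 + 1 - 1 - quatForm m y.2 y.2 / 2 =
        Real.exp (2 * y.1.re) by ring, Real.log_exp]
      ext
      · simp [siegel]
      · simp [siegel]
        linear_combination y.1.imI * hε
      · simp [siegel]
        linear_combination y.1.imJ * hε
      · simp [siegel]
        linear_combination y.1.imK * hε
    · exact cayleyInvTail_cayley (siegel_ne_zero ε y) y.2
  · have hz := ne_one_of_quatForm_lt n.2
    have h1 := cayleyInv_re_pos n.2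
    refine Eq.trans ?_ (cayley_cayleyInv hz)
    congr 1
    ext
    · simp [siegel, mul_div_cancel₀, Real.exp_log h1]
    · simp [siegel]
      linear_combination (cayleyInv n.1).imI * hε
    · simp [siegel]
      linear_combination (cayleyInv n.1).imJ * hε
    · simp [siegel]
      linear_combination (cayleyInv n.1).imK * hε
  · refine eq_of_diag (B := (ballForm (m + 1) (cayley (siegel ε y) y.2)).bilinearComp
      (cayleyCLM (siegel ε y) y.2 ∘L (siegelDeriv ε y).prod (.snd ℝ ℍ (Fin m → ℍ)))
      (cayleyCLM (siegel ε y) y.2 ∘L (siegelDeriv ε y).prod (.snd ℝ ℍ (Fin m → ℍ))))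
      (C := (1 / c₁) • (H1 ε).ambientMetric m c₁ c₂ y) (fun u v => ?_) (fun u v => ?_)
      (fun u => ?_) u v
    · exact ballForm_comm _ _ _
    · exact congrArg (1 / c₁ * ·) (modelForm_comm c₁ c₂ _ _)
    · have hρ := Real.exp_pos (2 * y.1.re)
      refine (ballForm_cayley hρ (siegel_re ε y) _ _).trans ?_
      change _ = 1 / c₁ * (H1 ε).ambientMetric m c₁ c₂ y u u
      rw [ambientMetric_H1_self]
      change ‖siegelDeriv ε y u - quatHermitian m y.2 u.2‖ ^ 2 / _ + quatForm m u.2 u.2 / _ = _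
      rw [siegelDeriv_sub, norm_sq_smul_one_add (by simp), h]
      field_simp
      linear_combination 8 * ‖u.1.im - (((ε : ℤ) : ℝ) / 2) • theta y.2 u.2‖ ^ 2 * hε
  · change cayley (siegel ε 0) (0 : Fin m → ℍ) = 0
    funext l
    refine Fin.cases ?_ (fun l => ?_) l
    · simp [cayley, siegel, smul_inv₀, smul_smul]
      norm_num
    · simp [cayley]

end Model

end Submax

/-! ### The equivalences for local and global symmetry, and the theorem. -/

namespace Submax

open RiemGeom

variable {m : ℕ} {c₁ c₂ : ℝ}

namespace Model

/-- The locally symmetric models. -/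
def IsSymmetricModel (X : Model) (c₁ c₂ : ℝ) : Prop :=
  ((∃ ε : ℤˣ, X = H1 ε) ∧ c₁ = 2 * c₂) ∨ X = H3 0 ∨ X = H3 2 ∨ X = H4 ∨ ∃ β : ℝ, X = H5 β

lemma IsSymmetricModel.of_hasParallelCurvature [NeZero m] (hc₁ : 0 < c₁) (hc₂ : 0 < c₂) {X : Model}
    (h : HasParallelCurvature (X.metric m c₁ c₂)) : X.IsSymmetricModel c₁ c₂ := by
  cases X with
  | H1 ε => exact .inl ⟨⟨ε, rfl⟩, parallel_H1 hc₁ hc₂ h⟩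
  | H2 => exact absurd h (not_parallel_H2 hc₁ hc₂)
  | H3 β =>
    rcases parallel_H3 hc₁ hc₂ h with rfl | rfl
    · exact .inr (.inl rfl)
    · exact .inr (.inr (.inl rfl))
  | H4 => exact .inr (.inr (.inr (.inl rfl)))
  | H5 β => exact .inr (.inr (.inr (.inr ⟨β, rfl⟩)))

lemma IsSymmetricModel.isRiemannianSymmetric (hc₁ : 0 < c₁) (hc₂ : 0 < c₂) {X : Model}
    (h : X.IsSymmetricModel c₁ c₂) : IsRiemannianSymmetric (X.metric m c₁ c₂) := by
  refine isRiemannianSymmetric_of_one ?_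
  rcases h with ⟨⟨ε, rfl⟩, h⟩ | rfl | rfl | rfl | ⟨β, rfl⟩
  · exact (quatHyperbolic_H1 hc₁ hc₂ h ε).2
  · exact (hyperbolic_prod_H3 hc₁ hc₂).2
  · exact (hyperbolic_H3 hc₁ hc₂).2
  · exact (prod_hyperbolic_H4 hc₁ hc₂).2
  · rcases eq_or_ne β 0 with rfl | hβ
    · exact (sphere_prod_euclidean_H5 hc₁ hc₂).2
    · exact (sphere_prod_hyperbolic_H5 hc₁ hc₂ hβ).2

lemma hasParallelCurvature_of_isRiemannianSymmetric (hc₁ : 0 < c₁) (hc₂ : 0 < c₂) {X : Model}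
    (h : IsRiemannianSymmetric (X.metric m c₁ c₂)) : HasParallelCurvature (X.metric m c₁ c₂) :=
  fun p => IsSymmetricAt.nablaCurvatureAt_eq_zero (E := ModelSpace m) (h p)
    (X.isRestriction c₁ c₂) (X.isMetricOn hc₁ hc₂)

variable (X : Model) [NeZero m]

/-- Closes the circle: parallel curvature restricts the model, the models on the list are globally
symmetric by their homotheties, and point symmetries make the curvature parallel. -/
lemma hasParallelCurvature_iff (hc₁ : 0 < c₁) (hc₂ : 0 < c₂) :
    HasParallelCurvature (X.metric m c₁ c₂) ↔ X.IsSymmetricModel c₁ c₂ :=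
  ⟨.of_hasParallelCurvature hc₁ hc₂, fun h =>
    hasParallelCurvature_of_isRiemannianSymmetric hc₁ hc₂ (h.isRiemannianSymmetric hc₁ hc₂)⟩

lemma isRiemannianSymmetric_iff (hc₁ : 0 < c₁) (hc₂ : 0 < c₂) :
    IsRiemannianSymmetric (X.metric m c₁ c₂) ↔ X.IsSymmetricModel c₁ c₂ :=
  ⟨fun h => .of_hasParallelCurvature hc₁ hc₂
    (hasParallelCurvature_of_isRiemannianSymmetric hc₁ hc₂ h), fun h => h.isRiemannianSymmetric hc₁ hc₂⟩

end Model

end Submax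

end

theorem mainTheorem8 (n : ℕ) (hn : 2 < n) (c₁ c₂ : ℝ) (hc₁ : 0 < c₁) (hc₂ : 0 < c₂) :
    (∀ X : Submax.Model,
      (RiemGeom.IsEinstein (X.metric (n - 1) c₁ c₂) ↔
        ((∃ ε : ℤˣ, X = .H1 ε) ∧ c₁ = 2 * c₂) ∨ X = .H3 2) ∧
      (RiemGeom.IsConformallyFlat (X.metric (n - 1) c₁ c₂) ↔
        X = .H3 2 ∨ X = .H5 1 ∨ X = .H5 (-1)) ∧
      (RiemGeom.HasParallelCurvature (X.metric (n - 1) c₁ c₂) ↔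
        ((∃ ε : ℤˣ, X = .H1 ε) ∧ c₁ = 2 * c₂) ∨ X = .H3 0 ∨ X = .H3 2 ∨ X = .H4 ∨
          ∃ β : ℝ, X = .H5 β) ∧
      (RiemGeom.IsRiemannianSymmetric (X.metric (n - 1) c₁ c₂) ↔
        ((∃ ε : ℤˣ, X = .H1 ε) ∧ c₁ = 2 * c₂) ∨ X = .H3 0 ∨ X = .H3 2 ∨ X = .H4 ∨
          ∃ β : ℝ, X = .H5 β)) ∧
    (∀ ε : ℤˣ, c₁ = 2 * c₂ →
      RiemGeom.Homothetic ((Submax.Model.H1 ε).metric (n - 1) c₁ c₂)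
        (RiemGeom.quatHyperbolicMetric n)) ∧
    RiemGeom.Homothetic ((Submax.Model.H3 2).metric (n - 1) c₁ c₂)
      (RiemGeom.hyperbolicMetric (4 * n)) ∧
    RiemGeom.Homothetic ((Submax.Model.H3 0).metric (n - 1) c₁ c₂)
      (RiemGeom.prodMetric (RiemGeom.hyperbolicMetric 4)
        (RiemGeom.euclideanMetric (4 * n - 4))) ∧
    RiemGeom.Homothetic (Submax.Model.H4.metric (n - 1) c₁ c₂)
      (RiemGeom.prodMetric (RiemGeom.euclideanMetric 3)
        (RiemGeom.hyperbolicMetric (4 * n - 3))) ∧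
    (∀ β : ℝ, β ≠ 0 →
      RiemGeom.Homothetic ((Submax.Model.H5 β).metric (n - 1) c₁ c₂)
        (RiemGeom.prodMetric (RiemGeom.sphereMetric (1 / β ^ 2))
          (RiemGeom.hyperbolicMetric (4 * n - 3)))) ∧
    RiemGeom.Homothetic ((Submax.Model.H5 0).metric (n - 1) c₁ c₂)
      (RiemGeom.prodMetric (RiemGeom.sphereMetric 1)
        (RiemGeom.euclideanMetric (4 * n - 3))) := by
  -- The number of quaternionic coordinates is `m = n - 1`; it is nonzero, as the test vectors in
  -- `ℍ^m` require.
  obtain ⟨m, rfl⟩ : ∃ m, n = m + 1 := ⟨n - 1, by omega⟩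
  have : NeZero m := ⟨by omega⟩
  exact ⟨fun X => ⟨X.isEinstein_iff_eq (m := m) hc₁ hc₂,
    X.isConformallyFlat_iff (m := m) hc₁ hc₂,
    X.hasParallelCurvature_iff (m := m) hc₁ hc₂, X.isRiemannianSymmetric_iff (m := m) hc₁ hc₂⟩,
    fun ε h => (Submax.Model.quatHyperbolic_H1 hc₁ hc₂ h ε).1,
    (Submax.Model.hyperbolic_H3 hc₁ hc₂).1, (Submax.Model.hyperbolic_prod_H3 hc₁ hc₂).1,
    (Submax.Model.prod_hyperbolic_H4 hc₁ hc₂).1,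
    fun β hβ => (Submax.Model.sphere_prod_hyperbolic_H5 hc₁ hc₂ hβ).1,
    (Submax.Model.sphere_prod_euclidean_H5 hc₁ hc₂).1⟩
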